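/- **Setting.** Let $A$ be a finite alphabet. $A^+$ denotes the free semigroup of nonempty finite words over $A$, and languages are subsets of $A^+$. A word is viewed as a structure whose elements are its positions, with equality, the linear order $<$, and unary label predicates $P_a$ ($a\in A$). A language $L\subseteq A^+$ is *definable* in a logic if it is the set of words of $A^+$ that satisfy some sentence of that logic. Let $\mathcal F$ be one of the following *weak fragments*: - $\mathrm{FO}(=)$: first-order logic with label predicates and equality only; - $\mathrm{FO}^2(<)$: first-order logic with $=$, $<$ and the label predicates, using only two (reusable) variables; - $\Sigma_n(<)$, resp. $\Pi_n(<)$, for some $n\ge 1$: prenex sentences with $=$, $<$ and the label predicates, with at most $n$ blocks of quantifiers, the first block (possibly empty) being existential, resp. universal; - $\mathcal B\Sigma_n(<)$ for some $n\ge 1$: Boolean combinations of $\Sigma_n(<)$ and $\Pi_n(<)$ sentences. The *strong variant* $\mathcal F^+$ of $\mathcal F$ is defined in the same way, except that the predicates $\min(x)$ (first position), $\max(x)$ (last position) and $y=x+1$ (successor) are also available as atomic formulas. For a finite semigroup $S$ with set of idempotents $E(S)$, the *alphabet of well-formed words* of $S$ is the disjoint union $$\mathbb A_S=(E(S)\times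 S\times E(S))\sqcup(S\times E(S))\sqcup(E(S)\times S)\sqcup S .$$ A word of $\mathbb A_S^+$ is *well-formed* if it is a single letter $s\in S$, or if it is of the form $(s_0,f_0)(e_1,s_1,f_1)\cdots(e_n,s_n,f_n)(e_{n+1},s_{n+1})$ with $n\ge 0$, first letter in $S\times E(S)$, last letter in $E(S)\times S$, the other letters in $E(S)\times S\times E(S)$, and $f_i=e_{i+1}$ for all $0\le i\le n$. Let $\beta:\mathbb A_S^+\to S$ be the morphism given on letters by $\beta((e,s,f))=esf$, $\beta((s,f))=sf$, $\beta((e,s))=es$, $\beta(s)=s$. If $\alpha:A^+\to S$ is a morphism that recognizes $L\subseteq A^+$ (that is, $L=\alpha^{-1}(P)$ for some $P\subseteq S$), the *language of well-formed words associated with $L$* is $$\mathbb L=\{\mathbb w\in\mathbb A_S^+ : \mathbb w\text{ is well-formed and }\beta(\mathbb w)\in\alpha(L)\}.$$ **Theorem.** 1. Assume that, for every finite semigroup $T$, the set of well-formed words of $\mathbb A_T^+$ is definable in $\mathcal F$. Let $\alpha:A^+\to S$ be a surjective morphism from $A^+$, with $A$ a finite alphabet, onto a finite semigroup $S$, let $L\subseteq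 A^+$ be a language recognized by $\alpha$, and let $\mathbb L\subseteq\mathbb A_S^+$ be the language of well-formed words associated with $L$. Then $L$ is definable in $\mathcal F^+$ if and only if $\mathbb L$ is definable in $\mathcal F$. 2. The assumption of part 1 holds when $\mathcal F$ is $\Pi_n(<)$ or $\mathcal B\Sigma_n(<)$ with $n\ge 2$, or $\Sigma_n(<)$ with $n\ge 3$. -/

import Mathlib

universe u v

namespace WordLogic

/-! Words, positions and first-order formulas. The set `A⁺` of nonempty finite words over `A` is
the free semigroup `FreeSemigroup A`. -/

/-- The list of letters of a nonempty word. -/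
def letters {A : Type*} (w : FreeSemigroup A) : List A :=
  w.head :: w.tail

/-- The positions of a word, linearly ordered from left to right. -/
abbrev Pos {A : Type*} (w : FreeSemigroup A) : Type :=
  Fin (letters w).length

/-- Atomic formulas; the variables are natural numbers. -/
inductive Atom (A : Type*) where
  /-- position `x` carries the letter `a` -/
  | label (a : A) (x : ℕ)
  /-- `x = y` -/
  | eq (x y : ℕ)
  /-- `x < y` -/
  | lt (x y : ℕ)
  /-- `y = x + 1` -/
  | succ (x y : ℕ)
  /-- `x` is the first position -/
  | min (x : ℕ)
  /-- `x` is the last position -/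
  | max (x : ℕ)

namespace Atom

variable {A : Type*}

/-- The variables of an atomic formula. -/
def vars : Atom A → Finset ℕ
  | label _ x => {x}
  | eq x y => {x, y}
  | lt x y => {x, y}
  | succ x y => {x, y}
  | min x => {x}
  | max x => {x}

/-- Truth of an atomic formula in the word `w` under the assignment `ν`. -/
def Sat (w : FreeSemigroup A) (ν : ℕ → Pos w) : Atom A → Prop
  | label a x => (letters w).get (ν x) = a
  | eq x y => ν x = ν y
  | lt x y => ν x < ν y
  | succ x y => ν x < ν y ∧ ¬ ∃ z : Pos w, ν x < z ∧ z < ν y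
  | min x => ∀ y : Pos w, ¬ y < ν x
  | max x => ∀ y : Pos w, ¬ ν x < y

/-- The atoms added by the enrichment: successor, first position, last position. -/
def IsEnriched : Atom A → Prop
  | label _ _ => False
  | eq _ _ => False
  | lt _ _ => False
  | succ _ _ => True
  | min _ => True
  | max _ => True

end Atom

/-- First-order formulas over words on the alphabet `A`, with named variables (a variable may be
quantified several times, as needed for the two-variable fragment). -/
inductive Formula (A : Type*) where
  | atom (a : Atom A)
  | neg (φ : Formula A)
  | and (φ ψ : Formula A)
  | or (φ ψ : Formula A)
  | ex (x : ℕ) (φ : Formula A)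
  | all (x : ℕ) (φ : Formula A)

namespace Formula

variable {A : Type*}

/-- Truth of a formula in the word `w` under the assignment `ν`. -/
def Sat (w : FreeSemigroup A) : (ℕ → Pos w) → Formula A → Prop
  | ν, atom a => a.Sat w ν
  | ν, neg φ => ¬ Sat w ν φ
  | ν, and φ ψ => Sat w ν φ ∧ Sat w ν ψ
  | ν, or φ ψ => Sat w ν φ ∨ Sat w ν ψ
  | ν, ex x φ => ∃ p : Pos w, Sat w (Function.update ν x p) φ
  | ν, all x φ => ∀ p : Pos w, Sat w (Function.update ν x p) φ

/-- The free variables of a formula. -/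
def freeVars : Formula A → Finset ℕ
  | atom a => a.vars
  | neg φ => freeVars φ
  | and φ ψ => freeVars φ ∪ freeVars ψ
  | or φ ψ => freeVars φ ∪ freeVars ψ
  | ex x φ => (freeVars φ).erase x
  | all x φ => (freeVars φ).erase x

/-- All variables occurring in a formula, free, bound or merely quantified. -/
def allVars : Formula A → Finset ℕ
  | atom a => a.vars
  | neg φ => allVars φ
  | and φ ψ => allVars φ ∪ allVars ψ
  | or φ ψ => allVars φ ∪ allVars ψ
  | ex x φ => insert x (allVars φ)
  | all x φ => insert x (allVars φ)

/-- A sentence is a formula without free variables. -/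
def IsSentence (φ : Formula A) : Prop := φ.freeVars = ∅

/-- Every atom of the formula satisfies `P`. -/
def AtomsIn (P : Atom A → Prop) : Formula A → Prop
  | atom a => P a
  | neg φ => AtomsIn P φ
  | and φ ψ => AtomsIn P φ ∧ AtomsIn P ψ
  | or φ ψ => AtomsIn P φ ∧ AtomsIn P ψ
  | ex _ φ => AtomsIn P φ
  | all _ φ => AtomsIn P φ

/-- Quantifier-free formulas. -/
def IsQF : Formula A → Prop
  | atom _ => True
  | neg φ => IsQF φ
  | and φ ψ => IsQF φ ∧ IsQF ψ
  | or φ ψ => IsQF φ ∧ IsQF ψ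
  | ex _ _ => False
  | all _ _ => False

end Formula

/-- The two kinds of quantifiers. -/
inductive Quant where
  | ex
  | all

/-- `IsPrenexLevel q n φ`: the formula `φ` is in prenex form, with at most `n` blocks of
quantifiers, the first of which (possibly empty) is of kind `q`. So `IsPrenexLevel .ex n` is the
level `Σₙ` and `IsPrenexLevel .all n` is the level `Πₙ`. -/
inductive IsPrenexLevel {A : Type*} : Quant → ℕ → Formula A → Prop
  | qf {q : Quant} {n : ℕ} {φ : Formula A} (h : φ.IsQF) : IsPrenexLevel q n φ
  | ex {n : ℕ} {φ : Formula A} (x : ℕ) (h : IsPrenexLevel .ex (n + 1) φ) :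
      IsPrenexLevel .ex (n + 1) (.ex x φ)
  | all {n : ℕ} {φ : Formula A} (x : ℕ) (h : IsPrenexLevel .all (n + 1) φ) :
      IsPrenexLevel .all (n + 1) (.all x φ)
  | exOfAll {n : ℕ} {φ : Formula A} (h : IsPrenexLevel .all n φ) : IsPrenexLevel .ex (n + 1) φ
  | allOfEx {n : ℕ} {φ : Formula A} (h : IsPrenexLevel .ex n φ) : IsPrenexLevel .all (n + 1) φ

/-- Boolean combinations of formulas satisfying `P`. -/
inductive IsBoolComb {A : Type*} (P : Formula A → Prop) : Formula A → Prop
  | base {φ : Formula A} (h : P φ) : IsBoolComb P φ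
  | neg {φ : Formula A} (h : IsBoolComb P φ) : IsBoolComb P (.neg φ)
  | and {φ ψ : Formula A} (h : IsBoolComb P φ) (h' : IsBoolComb P ψ) : IsBoolComb P (.and φ ψ)
  | or {φ ψ : Formula A} (h : IsBoolComb P φ) (h' : IsBoolComb P ψ) : IsBoolComb P (.or φ ψ)

/-- The logical fragments: `FO(=)`, `FO²(<)`, and, for `n ≥ 1`, the levels `Σₙ(<)`, `Πₙ(<)` and
`BΣₙ(<)` of the quantifier alternation hierarchy. -/
inductive Fragment where
  | foEq
  | foTwo
  | sigma (n : ℕ) (hn : 1 ≤ n)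
  | pi (n : ℕ) (hn : 1 ≤ n)
  | bsigma (n : ℕ) (hn : 1 ≤ n)

namespace Fragment

variable {A : Type*}

/-- The restriction that the fragment puts on the shape of formulas. -/
def Shape : Fragment → Formula A → Prop
  | foEq, _ => True
  | foTwo, φ => φ.allVars ⊆ {0, 1}
  | sigma n _, φ => IsPrenexLevel .ex n φ
  | pi n _, φ => IsPrenexLevel .all n φ
  | bsigma n _, φ => IsBoolComb (fun ψ => IsPrenexLevel .ex n ψ ∨ IsPrenexLevel .all n ψ) φ

/-- The fragment may use the linear order: all of them but `FO(=)`. -/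
def HasOrder : Fragment → Prop
  | foEq => False
  | foTwo => True
  | sigma _ _ => True
  | pi _ _ => True
  | bsigma _ _ => True

/-- The atoms available in the weak variant of the fragment. -/
def WeakAtom (F : Fragment) : Atom A → Prop
  | .label _ _ => True
  | .eq _ _ => True
  | .lt _ _ => F.HasOrder
  | .succ _ _ => False
  | .min _ => False
  | .max _ => False

/-- The sentences of the weak variant `F`. -/
def IsWeakSentence (F : Fragment) (φ : Formula A) : Prop :=
  φ.IsSentence ∧ F.Shape φ ∧ φ.AtomsIn F.WeakAtom

/-- The sentences of the strong variant `F⁺`, where `+1`, `min` and `max` may be used. -/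
def IsStrongSentence (F : Fragment) (φ : Formula A) : Prop :=
  φ.IsSentence ∧ F.Shape φ ∧ φ.AtomsIn (fun a => F.WeakAtom a ∨ a.IsEnriched)

end Fragment

/-- The language `L ⊆ A⁺` is the set of the words that satisfy the sentence `φ` (whose truth does
not depend on the assignment). -/
def Defines {A : Type*} (φ : Formula A) (L : Set (FreeSemigroup A)) : Prop :=
  ∀ (w : FreeSemigroup A) (ν : ℕ → Pos w), w ∈ L ↔ φ.Sat w ν

namespace Fragment

/-- `L` is definable in the weak variant `F`. -/
def WeakDefinable {A : Type*} (F : Fragment) (L : Set (FreeSemigroup A)) : Prop :=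
  ∃ φ : Formula A, F.IsWeakSentence φ ∧ Defines φ L

/-- `L` is definable in the strong variant `F⁺`. -/
def StrongDefinable {A : Type*} (F : Fragment) (L : Set (FreeSemigroup A)) : Prop :=
  ∃ φ : Formula A, F.IsStrongSentence φ ∧ Defines φ L

/-- The fragments from `Π₂(<)` upward in the quantifier alternation hierarchy: `Πₙ(<)` and
`BΣₙ(<)` for `n ≥ 2`, and `Σₙ(<)` for `n ≥ 3`. -/
def AbovePiTwo : Fragment → Prop
  | foEq => False
  | foTwo => False
  | sigma n _ => 3 ≤ n
  | pi n _ => 2 ≤ n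
  | bsigma n _ => 2 ≤ n

end Fragment

/-! Well-formed words. -/

/-- The set `E(S)` of idempotents of `S`. -/
abbrev Idem (S : Type*) [Mul S] : Type _ := {e : S // IsIdempotentElem e}

/-- The alphabet of well-formed words, the disjoint union of `E(S) × S × E(S)`, `S × E(S)`,
`E(S) × S` and `S`. -/
inductive WFLetter (S : Type*) [Mul S] where
  | mid (e : Idem S) (s : S) (f : Idem S)
  | first (s : S) (f : Idem S)
  | last (e : Idem S) (s : S)
  | single (s : S)

/-- `IsWFTail e l`: the list `l` is `(e₁,s₁,f₁) ⋯ (eₙ,sₙ,fₙ) (eₙ₊₁,sₙ₊₁)` with `n ≥ 0`, `e = e₁`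
and `fᵢ = eᵢ₊₁` for `1 ≤ i ≤ n`. -/
inductive IsWFTail {S : Type*} [Mul S] : Idem S → List (WFLetter S) → Prop
  | last (e : Idem S) (s : S) : IsWFTail e [.last e s]
  | mid (e : Idem S) (s : S) (f : Idem S) {l : List (WFLetter S)} (h : IsWFTail f l) :
      IsWFTail e (.mid e s f :: l)

/-- The set of well-formed words: the one-letter words `s` with `s ∈ S`, and the words
`(s₀,f₀) (e₁,s₁,f₁) ⋯ (eₙ,sₙ,fₙ) (eₙ₊₁,sₙ₊₁)` with `fᵢ = eᵢ₊₁` for `0 ≤ i ≤ n`. -/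
def wellFormedWords (S : Type*) [Mul S] : Set (FreeSemigroup (WFLetter S)) :=
  {w | (∃ s : S, letters w = [.single s]) ∨
    ∃ (s : S) (f : Idem S) (l : List (WFLetter S)), letters w = .first s f :: l ∧ IsWFTail f l}

/-- The value in `S` of a letter. -/
def letterValue {S : Type*} [Mul S] : WFLetter S → S
  | .mid e s f => e * s * f
  | .first s f => s * f
  | .last e s => e * s
  | .single s => s

/-- The morphism `β` from the words over the alphabet of well-formed words to `S`. -/
def beta (S : Type*) [Semigroup S] : FreeSemigroup (WFLetter S) →ₙ* S :=
  FreeSemigroup.lift letterValue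

/-- The morphism `α : A⁺ → S` recognizes the language `L`. -/
def Recognizes {A S : Type*} [Semigroup S] (α : FreeSemigroup A →ₙ* S)
    (L : Set (FreeSemigroup A)) : Prop :=
  ∃ P : Set S, L = α ⁻¹' P

/-- The language of well-formed words associated with `L`. -/
def associatedLanguage {A S : Type*} [Semigroup S] (α : FreeSemigroup A →ₙ* S)
    (L : Set (FreeSemigroup A)) : Set (FreeSemigroup (WFLetter S)) :=
  {w | w ∈ wellFormedWords S ∧ beta S w ∈ α '' L}

end WordLogic

namespace WordLogic

/-! Games between labelled linear orders. -/

/-! Definability is handled through Ehrenfeucht–Fraïssé games. Over a finite alphabet a language is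
definable in a fragment exactly when it is closed under finitely many of the games attached to that
fragment (`Fragment.definableWith_iff`). A game is a finite list of moves, and the kinds of its
moves encode quantifier alternation. Both directions of part 1 thus become transfers of Duplicator's
strategies, treated uniformly for all fragments.

From `𝕃` to `L`, each word `w` receives a canonical well-formed word with value `α w`
(`beta_canonicalWord`). A position is kept if it is the first one, or if some word ending just
before it, of length at most `|S|`, has a value fixed by right multiplication by an idempotent `e`;
that `e` is inserted there, which does not change the product. By pigeonhole such positions occur at
bounded distance from each other (`exists_stabilizer`), so whether a position is kept, and the
letter it carries, depend only on a window of bounded size (`scan_congr`). With successor, `min` and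
`max` available, further moves of the same kind as the last block read this window. Hence a strong
game on words, lengthened within its last block, yields a weak game on the canonical words
(`sim_canonicalWord`).

From `L` to `𝕃`, words `u s` of value `s` are fixed by surjectivity, and each letter `(e, s, f)` is
expanded to `(u e)^N (u s) (u f)^N`, which has value `e s f`. In the idealized expansion, with
infinitely many copies of `u e` and `u f`, two consecutive positions always lie in the same block,
so a weak strategy on well-formed words gives a strong one on the idealized expansions
(`sim_expansion_of_sim`). Finally, for `N ≥ 2 ^ r` the true expansion and the idealized one cannot
be told apart in fewer than `r` rounds (`sim_expansion`): a long run of copies of one word looks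
like an infinite run of copies to the right followed by one to the left. This is where the equality
`fᵢ = eᵢ₊₁` matters, and it is why well-formedness itself must be definable in the fragment.

For part 2, well-formedness is a condition on the two ends and on pairs of positions with nothing in
between, of the form `∀∀∃` over `<`. -/

/-- Truth of an atomic formula in a linear order `X` labelled by `lab`. -/
def Atom.Holds {A X : Type*} [LinearOrder X] (lab : X → A) (ν : ℕ → X) : Atom A → Prop
  | label a x => lab (ν x) = a
  | eq x y => ν x = ν y
  | lt x y => ν x < ν y
  | succ x y => ν x < ν y ∧ ¬ ∃ z : X, ν x < z ∧ z < ν y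
  | min x => ∀ y : X, ¬ y < ν x
  | max x => ∀ y : X, ¬ ν x < y

theorem Atom.sat_iff_holds {A : Type*} (w : FreeSemigroup A) (ν : ℕ → Pos w) (a : Atom A) :
    a.Sat w ν ↔ a.Holds (letters w).get ν := by
  cases a <;> exact Iff.rfl

theorem Atom.holds_congr {A X : Type*} [LinearOrder X] {lab : X → A} {ν ν' : ℕ → X} {a : Atom A}
    (h : ∀ x ∈ a.vars, ν x = ν' x) : a.Holds lab ν ↔ a.Holds lab ν' := by
  cases a <;> simp [Atom.vars, Atom.Holds] at * <;> simp [h]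

/-- Two assignments agree on the atoms in `P` with variables in `D`. -/
def Agree {A X Y : Type*} [LinearOrder X] [LinearOrder Y] (P : Atom A → Prop)
    (lab : X → A) (lab' : Y → A) (D : Finset ℕ) (ν : ℕ → X) (ν' : ℕ → Y) : Prop :=
  ∀ a : Atom A, P a → a.vars ⊆ D → (a.Holds lab ν ↔ a.Holds lab' ν')

/-- Duplicator wins the game in which the moves allowed in the successive rounds are listed
by `q`: an `ex`-move picks an element of the left structure, an `all`-move an element of the right
one, and the element becomes the value of a variable in `V`. The atoms in `P` are preserved for
the variables assigned so far, initially those in `D`. -/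
def Sim {A X Y : Type*} [LinearOrder X] [LinearOrder Y] (P : Atom A → Prop)
    (lab : X → A) (lab' : Y → A) (V : Finset ℕ) :
    List (Set Quant) → Finset ℕ → (ℕ → X) → (ℕ → Y) → Prop
  | [], D, ν, ν' => Agree P lab lab' D ν ν'
  | m :: q, D, ν, ν' => Agree P lab lab' D ν ν' ∧
      (Quant.ex ∈ m → ∀ x ∈ V, ∀ p, ∃ p', Sim P lab lab' V q (insert x D)
        (Function.update ν x p) (Function.update ν' x p')) ∧
      (Quant.all ∈ m → ∀ x ∈ V, ∀ p', ∃ p, Sim P lab lab' V q (insert x D)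
        (Function.update ν x p) (Function.update ν' x p'))

theorem Sim.agree {A X Y : Type*} [LinearOrder X] [LinearOrder Y] {P : Atom A → Prop}
    {lab : X → A} {lab' : Y → A} {V : Finset ℕ} {q : List (Set Quant)} {D : Finset ℕ}
    {ν : ℕ → X} {ν' : ℕ → Y} (h : Sim P lab lab' V q D ν ν') : Agree P lab lab' D ν ν' := by
  cases q with
  | nil => exact h
  | cons m q => exact h.1

/-- The game on words. -/
abbrev WSim {A : Type*} (P : Atom A → Prop) (V : Finset ℕ) (q : List (Set Quant))
    (D : Finset ℕ) {w w' : FreeSemigroup A} (ν : ℕ → Pos w) (ν' : ℕ → Pos w') : Prop :=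
  Sim P (letters w).get (letters w').get V q D ν ν'

namespace Quant

/-- The other quantifier. -/
def dual : Quant → Quant
  | ex => all
  | all => ex

end Quant

namespace Formula

variable {A : Type*}

/-- Quantification of the given kind. -/
def quant : Quant → ℕ → Formula A → Formula A
  | .ex => ex
  | .all => all

/-- Quantifier depth. -/
def depth : Formula A → ℕ
  | atom _ => 0
  | neg φ => depth φ
  | and φ ψ => Max.max (depth φ) (depth ψ)
  | or φ ψ => Max.max (depth φ) (depth ψ)
  | ex _ φ => depth φ + 1
  | all _ φ => depth φ + 1

theorem sat_congr {w : FreeSemigroup A} (φ : Formula A) :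
    ∀ {ν ν' : ℕ → Pos w}, (∀ x ∈ φ.freeVars, ν x = ν' x) → (φ.Sat w ν ↔ φ.Sat w ν') := by
  have key : ∀ (φ : Formula A) (x : ℕ) (ν ν' : ℕ → Pos w) (p : Pos w),
      (∀ y ∈ φ.freeVars.erase x, ν y = ν' y) →
      ∀ y ∈ φ.freeVars, Function.update ν x p y = Function.update ν' x p y := by
    intro φ x ν ν' p h y hy
    by_cases hyx : y = x
    · subst hyx; simp
    · simp [hyx, h y (Finset.mem_erase.2 ⟨hyx, hy⟩)]
  induction φ with
  | atom a =>
    intro ν ν' h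
    simp only [Sat, Atom.sat_iff_holds]
    exact Atom.holds_congr h
  | neg φ ih => intro ν ν' h; exact not_congr (ih h)
  | and φ ψ h1 h2 =>
    intro ν ν' h
    exact and_congr (h1 fun x hx => h x (Finset.mem_union_left _ hx))
      (h2 fun x hx => h x (Finset.mem_union_right _ hx))
  | or φ ψ h1 h2 =>
    intro ν ν' h
    exact or_congr (h1 fun x hx => h x (Finset.mem_union_left _ hx))
      (h2 fun x hx => h x (Finset.mem_union_right _ hx))
  | ex x φ ih => intro ν ν' h; exact exists_congr fun p => ih (key φ x ν ν' p h)
  | all x φ ih => intro ν ν' h; exact forall_congr' fun p => ih (key φ x ν ν' p h)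

/-! Preservation of formulas by the game. -/

section Preservation

variable {P : Atom A → Prop} {V : Finset ℕ} {w w' : FreeSemigroup A}

theorem sat_iff_of_agree (φ : Formula A) (hq : φ.IsQF) (hP : φ.AtomsIn P) {D : Finset ℕ}
    (hD : φ.freeVars ⊆ D) {ν : ℕ → Pos w} {ν' : ℕ → Pos w'}
    (h : Agree P (letters w).get (letters w').get D ν ν') : φ.Sat w ν ↔ φ.Sat w' ν' := by
  induction φ with
  | atom a =>
    simp only [Sat, Atom.sat_iff_holds]
    exact h a hP hD
  | neg φ ih => exact not_congr (ih hq hP hD)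
  | and φ ψ h1 h2 =>
    exact and_congr (h1 hq.1 hP.1 (Finset.union_subset_left hD))
      (h2 hq.2 hP.2 (Finset.union_subset_right hD))
  | or φ ψ h1 h2 =>
    exact or_congr (h1 hq.1 hP.1 (Finset.union_subset_left hD))
      (h2 hq.2 hP.2 (Finset.union_subset_right hD))
  | ex x φ ih => exact hq.elim
  | all x φ ih => exact hq.elim

theorem sat_iff_of_sim_univ (φ : Formula A) (hP : φ.AtomsIn P) (hV : φ.allVars ⊆ V) :
    ∀ {r : ℕ} {D : Finset ℕ}, φ.depth ≤ r → φ.freeVars ⊆ D →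
      ∀ {ν : ℕ → Pos w} {ν' : ℕ → Pos w'}, WSim P V (List.replicate r Set.univ) D ν ν' →
      (φ.Sat w ν ↔ φ.Sat w' ν') := by
  induction φ with
  | atom a =>
    intro r D _ hD ν ν' h
    exact sat_iff_of_agree (.atom a) trivial hP hD h.agree
  | neg φ ih => intro r D hr hD ν ν' h; exact not_congr (ih hP hV hr hD h)
  | and φ ψ h1 h2 =>
    intro r D hr hD ν ν' h
    exact and_congr
      (h1 hP.1 (Finset.union_subset_left hV) (le_trans (le_max_left _ _) hr)
        (Finset.union_subset_left hD) h)
      (h2 hP.2 (Finset.union_subset_right hV) (le_trans (le_max_right _ _) hr)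
        (Finset.union_subset_right hD) h)
  | or φ ψ h1 h2 =>
    intro r D hr hD ν ν' h
    exact or_congr
      (h1 hP.1 (Finset.union_subset_left hV) (le_trans (le_max_left _ _) hr)
        (Finset.union_subset_left hD) h)
      (h2 hP.2 (Finset.union_subset_right hV) (le_trans (le_max_right _ _) hr)
        (Finset.union_subset_right hD) h)
  | ex x φ ih =>
    intro r D hr hD ν ν' h
    obtain _ | r := r
    · simp [depth] at hr
    have hx : x ∈ V := hV (Finset.mem_insert_self _ _)
    have ih' := fun ν ν' => @ih hP ((Finset.subset_insert _ _).trans hV) r (insert x D)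
      (Nat.le_of_succ_le_succ hr) (Finset.subset_insert_iff.2 hD) ν ν'
    constructor
    · rintro ⟨p, hp⟩
      obtain ⟨p', hp'⟩ := h.2.1 trivial x hx p
      exact ⟨p', (ih' _ _ hp').1 hp⟩
    · rintro ⟨p', hp⟩
      obtain ⟨p, hp'⟩ := h.2.2 trivial x hx p'
      exact ⟨p, (ih' _ _ hp').2 hp⟩
  | all x φ ih =>
    intro r D hr hD ν ν' h
    obtain _ | r := r
    · simp [depth] at hr
    have hx : x ∈ V := hV (Finset.mem_insert_self _ _)
    have ih' := fun ν ν' => @ih hP ((Finset.subset_insert _ _).trans hV) r (insert x D)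
      (Nat.le_of_succ_le_succ hr) (Finset.subset_insert_iff.2 hD) ν ν'
    constructor
    · intro hp p'
      obtain ⟨p, hp'⟩ := h.2.2 trivial x hx p'
      exact (ih' _ _ hp').1 (hp p)
    · intro hp p
      obtain ⟨p', hp'⟩ := h.2.1 trivial x hx p
      exact (ih' _ _ hp').2 (hp p')

end Preservation

end Formula

/-- `IsMoveLevel c n q`: the sequence of moves `q` consists of at most `n` blocks of moves of the
same kind, the first of which (possibly empty) is of kind `c`. -/
inductive IsMoveLevel : Quant → ℕ → List (Set Quant) → Prop
  | nil (c : Quant) (n : ℕ) : IsMoveLevel c n []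
  | cons {c : Quant} {n : ℕ} {q : List (Set Quant)} (h : IsMoveLevel c (n + 1) q) :
      IsMoveLevel c (n + 1) ({c} :: q)
  | alternate {c d : Quant} {n : ℕ} {q : List (Set Quant)} (hcd : c ≠ d)
      (h : IsMoveLevel d n q) : IsMoveLevel c (n + 1) q

theorem Quant.ne_dual (c : Quant) : c ≠ c.dual := by cases c <;> simp [Quant.dual]

/-- The last block can be prolonged at no cost in alternation. The extra moves will serve to read
the neighbourhood of a position. -/
theorem IsMoveLevel.exists_append {c : Quant} {n : ℕ} {q : List (Set Quant)}
    (h : IsMoveLevel c n q) (hn : 1 ≤ n) :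
    ∃ d : Quant, ∀ k, IsMoveLevel c n (q ++ List.replicate k {d}) := by
  have rep : ∀ (c : Quant) (n k : ℕ), IsMoveLevel c (n + 1) (List.replicate k {c}) := by
    intro c n k
    induction k with
    | zero => exact .nil _ _
    | succ k ih => exact .cons ih
  induction h with
  | nil c n =>
    obtain ⟨n, rfl⟩ := Nat.exists_eq_add_of_le' hn
    exact ⟨c, fun k => rep c n k⟩
  | cons h ih =>
    obtain ⟨d, hd⟩ := ih hn
    exact ⟨d, fun k => .cons (hd k)⟩
  | @alternate c d n q hcd h ih =>
    -- At level `0` the remaining list is empty, so the block to be prolonged is the current one, of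
    -- kind `c`.
    obtain _ | n := n
    · cases h
      exact ⟨c, fun k => rep c 0 k⟩
    · obtain ⟨d, hd⟩ := ih (by omega)
      exact ⟨d, fun k => .alternate hcd (hd k)⟩

theorem IsMoveLevel.nonempty_of_mem {c : Quant} {n : ℕ} {q : List (Set Quant)}
    (h : IsMoveLevel c n q) : ∀ m ∈ q, m.Nonempty := by
  induction h with
  | nil => simp
  | cons h ih => simpa using ih
  | alternate _ h ih => exact ih

/-- Prenex formulas are preserved by a game with the corresponding sequence of moves, and
reflected by a game with the dual one. -/
theorem IsPrenexLevel.exists_moves {A : Type*} {P : Atom A → Prop} {c : Quant} {n : ℕ}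
    {φ : Formula A} (h : IsPrenexLevel c n φ) (hP : φ.AtomsIn P) :
    (∃ q, IsMoveLevel c n q ∧ ∀ (V D : Finset ℕ), φ.allVars ⊆ V → φ.freeVars ⊆ D →
      ∀ {w w' : FreeSemigroup A} (ν : ℕ → Pos w) (ν' : ℕ → Pos w'),
        WSim P V q D ν ν' → φ.Sat w ν → φ.Sat w' ν') ∧
    (∃ q, IsMoveLevel c.dual n q ∧ ∀ (V D : Finset ℕ), φ.allVars ⊆ V → φ.freeVars ⊆ D →
      ∀ {w w' : FreeSemigroup A} (ν : ℕ → Pos w) (ν' : ℕ → Pos w'),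
        WSim P V q D ν ν' → φ.Sat w' ν' → φ.Sat w ν) := by
  induction h with
  | @qf c n φ h =>
    refine ⟨⟨[], .nil _ _, fun V D _ hD w w' ν ν' hs => ?_⟩,
      ⟨[], .nil _ _, fun V D _ hD w w' ν ν' hs => ?_⟩⟩
    · exact (Formula.sat_iff_of_agree φ h hP hD hs).1
    · exact (Formula.sat_iff_of_agree φ h hP hD hs).2
  | @ex n φ x h ih =>
    obtain ⟨⟨q, hq, h1⟩, ⟨q', hq', h2⟩⟩ := ih hP
    refine ⟨⟨{.ex} :: q, .cons hq, fun V D hV hD w w' ν ν' hs => ?_⟩,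
      ⟨{.all} :: q', .cons hq', fun V D hV hD w w' ν ν' hs => ?_⟩⟩
    · rintro ⟨p, hp⟩
      obtain ⟨p', hp'⟩ := hs.2.1 rfl x (hV (Finset.mem_insert_self _ _)) p
      exact ⟨p', h1 V _ ((Finset.subset_insert _ _).trans hV)
        (Finset.subset_insert_iff.2 hD) _ _ hp' hp⟩
    · rintro ⟨p, hp⟩
      obtain ⟨p', hp'⟩ := hs.2.2 rfl x (hV (Finset.mem_insert_self _ _)) p
      exact ⟨p', h2 V _ ((Finset.subset_insert _ _).trans hV)
        (Finset.subset_insert_iff.2 hD) _ _ hp' hp⟩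
  | @all n φ x h ih =>
    obtain ⟨⟨q, hq, h1⟩, ⟨q', hq', h2⟩⟩ := ih hP
    refine ⟨⟨{.all} :: q, .cons hq, fun V D hV hD w w' ν ν' hs => ?_⟩,
      ⟨{.ex} :: q', .cons hq', fun V D hV hD w w' ν ν' hs => ?_⟩⟩
    · intro hp p
      obtain ⟨p', hp'⟩ := hs.2.2 rfl x (hV (Finset.mem_insert_self _ _)) p
      exact h1 V _ ((Finset.subset_insert _ _).trans hV)
        (Finset.subset_insert_iff.2 hD) _ _ hp' (hp p')
    · intro hp p
      obtain ⟨p', hp'⟩ := hs.2.1 rfl x (hV (Finset.mem_insert_self _ _)) p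
      exact h2 V _ ((Finset.subset_insert _ _).trans hV)
        (Finset.subset_insert_iff.2 hD) _ _ hp' (hp p')
  | exOfAll h ih =>
    obtain ⟨⟨q, hq, h1⟩, ⟨q', hq', h2⟩⟩ := ih hP
    exact ⟨⟨q, .alternate (by simp) hq, h1⟩, ⟨q', .alternate (by simp [Quant.dual]) hq', h2⟩⟩
  | allOfEx h ih =>
    obtain ⟨⟨q, hq, h1⟩, ⟨q', hq', h2⟩⟩ := ih hP
    exact ⟨⟨q, .alternate (by simp) hq, h1⟩, ⟨q', .alternate (by simp [Quant.dual]) hq', h2⟩⟩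

/-! Renaming of variables and merging of prenex formulas. -/

/-- Renaming of the variables of an atomic formula. -/
def Atom.rename {A : Type*} (σ : ℕ → ℕ) : Atom A → Atom A
  | label a x => label a (σ x)
  | eq x y => eq (σ x) (σ y)
  | lt x y => lt (σ x) (σ y)
  | succ x y => succ (σ x) (σ y)
  | min x => min (σ x)
  | max x => max (σ x)

namespace Formula

variable {A : Type*}

/-- Renaming of all the variables of a formula, free or bound. -/
def rename (σ : ℕ → ℕ) : Formula A → Formula A
  | atom a => atom (a.rename σ)
  | neg φ => neg (rename σ φ)
  | and φ ψ => and (rename σ φ) (rename σ ψ)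
  | or φ ψ => or (rename σ φ) (rename σ ψ)
  | ex x φ => ex (σ x) (rename σ φ)
  | all x φ => all (σ x) (rename σ φ)

theorem sat_rename {w : FreeSemigroup A} (σ : Equiv.Perm ℕ) (φ : Formula A) :
    ∀ ν : ℕ → Pos w, (φ.rename σ).Sat w ν ↔ φ.Sat w (ν ∘ σ) := by
  have key : ∀ (ν : ℕ → Pos w) (x : ℕ) (p : Pos w),
      Function.update ν (σ x) p ∘ σ = Function.update (ν ∘ σ) x p := fun ν x p =>
    Function.update_comp_eq_of_injective ν σ.injective x p
  induction φ with
  | atom a => intro ν; cases a <;> exact Iff.rfl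
  | neg φ ih => intro ν; exact not_congr (ih ν)
  | and φ ψ h1 h2 => intro ν; exact and_congr (h1 ν) (h2 ν)
  | or φ ψ h1 h2 => intro ν; exact or_congr (h1 ν) (h2 ν)
  | ex x φ ih => intro ν; exact exists_congr fun p => by rw [ih, key]
  | all x φ ih => intro ν; exact forall_congr' fun p => by rw [ih, key]

theorem freeVars_rename (σ : Equiv.Perm ℕ) (φ : Formula A) :
    (φ.rename σ).freeVars = φ.freeVars.image σ := by
  induction φ with
  | atom a => cases a <;> simp [rename, freeVars, Atom.rename, Atom.vars, Finset.image_insert]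
  | neg φ ih => exact ih
  | and φ ψ h1 h2 => simp [rename, freeVars, h1, h2, Finset.image_union]
  | or φ ψ h1 h2 => simp [rename, freeVars, h1, h2, Finset.image_union]
  | ex x φ ih => simp [rename, freeVars, ih, Finset.image_erase σ.injective]
  | all x φ ih => simp [rename, freeVars, ih, Finset.image_erase σ.injective]

theorem AtomsIn.rename {P : Atom A → Prop} (hP : ∀ (σ : ℕ → ℕ) a, P a → P (a.rename σ))
    (σ : ℕ → ℕ) {φ : Formula A} (h : φ.AtomsIn P) : (φ.rename σ).AtomsIn P := by
  induction φ with
  | atom a => exact hP σ a h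
  | neg φ ih => exact ih h
  | and φ ψ h1 h2 => exact ⟨h1 h.1, h2 h.2⟩
  | or φ ψ h1 h2 => exact ⟨h1 h.1, h2 h.2⟩
  | ex x φ ih => exact ih h
  | all x φ ih => exact ih h

theorem IsQF.rename (σ : ℕ → ℕ) {φ : Formula A} (h : φ.IsQF) : (φ.rename σ).IsQF := by
  induction φ with
  | atom a => trivial
  | neg φ ih => exact ih h
  | and φ ψ h1 h2 => exact ⟨h1 h.1, h2 h.2⟩
  | or φ ψ h1 h2 => exact ⟨h1 h.1, h2 h.2⟩
  | ex x φ ih => exact h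
  | all x φ ih => exact h

theorem depth_rename (σ : ℕ → ℕ) (φ : Formula A) : (φ.rename σ).depth = φ.depth := by
  induction φ <;> simp_all [Formula.rename, depth]

end Formula

namespace IsPrenexLevel

variable {A : Type*}

theorem rename (σ : ℕ → ℕ) {c : Quant} {n : ℕ} {φ : Formula A} (h : IsPrenexLevel c n φ) :
    IsPrenexLevel c n (φ.rename σ) := by
  induction h with
  | qf h => exact .qf (h.rename σ)
  | ex x h ih => exact .ex _ ih
  | all x h ih => exact .all _ ih
  | exOfAll h ih => exact .exOfAll ih
  | allOfEx h ih => exact .allOfEx ih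

theorem quant {c : Quant} {n : ℕ} {φ : Formula A} (x : ℕ) (h : IsPrenexLevel c (n + 1) φ) :
    IsPrenexLevel c (n + 1) (.quant c x φ) := by
  cases c
  · exact .ex x h
  · exact .all x h

theorem of_ne {c d : Quant} {n : ℕ} {φ : Formula A} (hcd : c ≠ d) (h : IsPrenexLevel d n φ) :
    IsPrenexLevel c (n + 1) φ := by
  cases c <;> cases d
  · exact absurd rfl hcd
  · exact .exOfAll h
  · exact .allOfEx h
  · exact absurd rfl hcd

theorem isQF {c : Quant} {φ : Formula A} (h : IsPrenexLevel c 0 φ) : φ.IsQF := by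
  cases h; assumption

theorem cases_succ {c : Quant} {n : ℕ} {φ : Formula A} (h : IsPrenexLevel c (n + 1) φ) :
    (∃ x ψ, φ = .quant c x ψ ∧ IsPrenexLevel c (n + 1) ψ) ∨ IsPrenexLevel c.dual n φ := by
  cases h with
  | qf h => exact .inr (.qf h)
  | ex x h => exact .inl ⟨x, _, rfl, h⟩
  | all x h => exact .inl ⟨x, _, rfl, h⟩
  | exOfAll h => exact .inr h
  | allOfEx h => exact .inr h

end IsPrenexLevel

namespace Formula

variable {A : Type*}

/-- Conjunction or disjunction. -/
def conn : Quant → Formula A → Formula A → Formula A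
  | .ex => or
  | .all => and

theorem sat_conn_comm (b : Quant) (φ ψ : Formula A) {w : FreeSemigroup A} (ν : ℕ → Pos w) :
    (conn b φ ψ).Sat w ν ↔ (conn b ψ φ).Sat w ν := by
  cases b
  · exact or_comm
  · exact and_comm

theorem sat_conn_congr (b : Quant) {φ ψ φ' ψ' : Formula A} {w : FreeSemigroup A}
    {ν ν' : ℕ → Pos w} (h : φ.Sat w ν ↔ φ'.Sat w ν') (h' : ψ.Sat w ν ↔ ψ'.Sat w ν') :
    (conn b φ ψ).Sat w ν ↔ (conn b φ' ψ').Sat w ν' := by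
  cases b
  · exact or_congr h h'
  · exact and_congr h h'

@[simp] theorem freeVars_conn (b : Quant) (φ ψ : Formula A) :
    (conn b φ ψ).freeVars = φ.freeVars ∪ ψ.freeVars := by cases b <;> rfl

@[simp] theorem freeVars_quant (c : Quant) (x : ℕ) (φ : Formula A) :
    (quant c x φ).freeVars = φ.freeVars.erase x := by cases c <;> rfl

@[simp] theorem depth_quant (c : Quant) (x : ℕ) (φ : Formula A) :
    (quant c x φ).depth = φ.depth + 1 := by cases c <;> rfl

@[simp] theorem atomsIn_quant (P : Atom A → Prop) (c : Quant) (x : ℕ) (φ : Formula A) :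
    (quant c x φ).AtomsIn P ↔ φ.AtomsIn P := by cases c <;> rfl

theorem sat_quant_congr (c : Quant) {x x' : ℕ} {φ φ' : Formula A} {w : FreeSemigroup A}
    {ν ν' : ℕ → Pos w} (h : ∀ p, φ.Sat w (Function.update ν x p) ↔
      φ'.Sat w (Function.update ν' x' p)) : (quant c x φ).Sat w ν ↔ (quant c x' φ').Sat w ν' := by
  cases c
  · exact exists_congr h
  · exact forall_congr' h

/-- Two of the four cases, such as `(∃ x, φ) ∨ ψ`, require a nonempty domain; words have at least
one position. -/
theorem sat_conn_quant (b c : Quant) {x : ℕ} {φ ψ : Formula A} (hx : x ∉ ψ.freeVars)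
    {w : FreeSemigroup A} (ν : ℕ → Pos w) :
    (conn b (quant c x φ) ψ).Sat w ν ↔ (quant c x (conn b φ ψ)).Sat w ν := by
  have key : ∀ p, ψ.Sat w (Function.update ν x p) ↔ ψ.Sat w ν := fun p =>
    sat_congr ψ fun y hy => by
      rw [Function.update_of_ne]; rintro rfl; exact hx hy
  have : Nonempty (Pos w) := ⟨ν 0⟩
  cases b <;> cases c <;> simp only [conn, quant, Sat, key]
  · simp [exists_or]
  · exact forall_or_right.symm
  · exact exists_and_right.symm
  · simp [forall_and]

/-- Renaming acts through a transposition of all variables, bound ones included, so that no capture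
can occur. -/
theorem sat_quant_fresh (c : Quant) {x y : ℕ} {φ : Formula A} (hy : y ∉ φ.freeVars)
    {w : FreeSemigroup A} (ν : ℕ → Pos w) :
    (quant c y (φ.rename (Equiv.swap x y))).Sat w ν ↔ (quant c x φ).Sat w ν := by
  refine sat_quant_congr c fun p => ?_
  rw [sat_rename]
  refine sat_congr φ fun z hz => ?_
  have hzy : z ≠ y := fun h => hy (h ▸ hz)
  by_cases hzx : z = x
  · subst hzx; simp
  · simp [Equiv.swap_apply_of_ne_of_ne hzx hzy, hzx, hzy]

end Formula

/-- Quantifiers of the leading kind `c` are pulled out of either formula, one at a time and under a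
fresh name, until both formulas start one level lower with the dual kind; the induction on `n` then
takes over. The inner induction bounds the sum of the depths. Since both leading blocks merge into
one, the level does not grow. -/
theorem IsPrenexLevel.exists_conn {A : Type*} {P : Atom A → Prop}
    (hP : ∀ (σ : ℕ → ℕ) a, P a → P (a.rename σ)) (b : Quant) :
    ∀ (n : ℕ) {c : Quant} {φ ψ : Formula A}, IsPrenexLevel c n φ → IsPrenexLevel c n ψ →
      φ.AtomsIn P → ψ.AtomsIn P →
      ∃ χ : Formula A, IsPrenexLevel c n χ ∧ χ.AtomsIn P ∧
        χ.freeVars ⊆ φ.freeVars ∪ ψ.freeVars ∧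
        ∀ (w : FreeSemigroup A) (ν : ℕ → Pos w), χ.Sat w ν ↔ (Formula.conn b φ ψ).Sat w ν := by
  intro n
  induction n with
  | zero =>
    intro c φ ψ hφ hψ hPφ hPψ
    refine ⟨.conn b φ ψ, .qf ?_, ?_, by simp, fun w ν => Iff.rfl⟩ <;> cases b
    exacts [⟨hφ.isQF, hψ.isQF⟩, ⟨hφ.isQF, hψ.isQF⟩, ⟨hPφ, hPψ⟩, ⟨hPφ, hPψ⟩]
  | succ n ihn =>
    intro c
    suffices H : ∀ (N : ℕ) {φ ψ : Formula A}, φ.depth + ψ.depth ≤ N →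
        IsPrenexLevel c (n + 1) φ → IsPrenexLevel c (n + 1) ψ → φ.AtomsIn P → ψ.AtomsIn P →
        ∃ χ : Formula A, IsPrenexLevel c (n + 1) χ ∧ χ.AtomsIn P ∧
        χ.freeVars ⊆ φ.freeVars ∪ ψ.freeVars ∧
        ∀ (w : FreeSemigroup A) (ν : ℕ → Pos w), χ.Sat w ν ↔ (Formula.conn b φ ψ).Sat w ν from
      fun {φ ψ} => H _ le_rfl
    have pull : ∀ (N : ℕ),
        (∀ {φ ψ : Formula A}, φ.depth + ψ.depth ≤ N →
        IsPrenexLevel c (n + 1) φ → IsPrenexLevel c (n + 1) ψ → φ.AtomsIn P → ψ.AtomsIn P →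
        ∃ χ : Formula A, IsPrenexLevel c (n + 1) χ ∧ χ.AtomsIn P ∧
        χ.freeVars ⊆ φ.freeVars ∪ ψ.freeVars ∧
        ∀ (w : FreeSemigroup A) (ν : ℕ → Pos w),
          χ.Sat w ν ↔ (Formula.conn b φ ψ).Sat w ν) →
        ∀ (x : ℕ) {φ ψ : Formula A}, φ.depth + ψ.depth ≤ N →
        IsPrenexLevel c (n + 1) φ → IsPrenexLevel c (n + 1) ψ → φ.AtomsIn P → ψ.AtomsIn P →
        ∃ χ : Formula A, IsPrenexLevel c (n + 1) χ ∧ χ.AtomsIn P ∧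
        χ.freeVars ⊆ φ.freeVars.erase x ∪ ψ.freeVars ∧
        ∀ (w : FreeSemigroup A) (ν : ℕ → Pos w),
          χ.Sat w ν ↔ (Formula.conn b (.quant c x φ) ψ).Sat w ν := by
      intro N IH x φ ψ hN hφ hψ hPφ hPψ
      -- The variable `y` is free in neither formula, so the quantifier can be renamed and then
      -- moved over `ψ`.
      obtain ⟨y, hy⟩ := Infinite.exists_notMem_finset (φ.freeVars ∪ ψ.freeVars)
      rw [Finset.mem_union, not_or] at hy
      obtain ⟨χ, h1, h2, h3, h4⟩ := IH (φ := φ.rename (Equiv.swap x y)) (ψ := ψ)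
        (by rwa [Formula.depth_rename]) (hφ.rename _) hψ (hPφ.rename hP _) hPψ
      refine ⟨.quant c y χ, h1.quant y, by simpa, ?_, fun w ν => ?_⟩
      · intro z hz
        rw [Formula.freeVars_quant, Finset.mem_erase] at hz
        have := h3 hz.2
        rw [Formula.freeVars_rename, Finset.mem_union, Finset.mem_image] at this
        rw [Finset.mem_union, Finset.mem_erase]
        obtain ⟨z', hz', rfl⟩ | h := this
        · by_cases hx : z' = x
          · subst hx; simp at hz
          · have : z' ≠ y := fun h => hy.1 (h ▸ hz')
            rw [Equiv.swap_apply_of_ne_of_ne hx this]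
            exact .inl ⟨hx, hz'⟩
        · exact .inr h
      · rw [Formula.sat_conn_congr b (Formula.sat_quant_fresh c hy.1 ν).symm Iff.rfl,
          Formula.sat_conn_quant b c hy.2]
        exact Formula.sat_quant_congr c fun p => h4 w _
    intro N
    induction N with
    | zero =>
      intro φ ψ hN hφ hψ hPφ hPψ
      obtain ⟨x, φ', rfl, -⟩ | hφ' := hφ.cases_succ
      · simp at hN
      obtain ⟨x, ψ', rfl, -⟩ | hψ' := hψ.cases_succ
      · simp at hN
      obtain ⟨χ, h1, h2⟩ := ihn hφ' hψ' hPφ hPψ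
      exact ⟨χ, h1.of_ne c.ne_dual, h2⟩
    | succ N ihN =>
      intro φ ψ hN hφ hψ hPφ hPψ
      obtain ⟨x, φ', rfl, hφ'⟩ | hφ' := hφ.cases_succ
      · simp only [Formula.depth_quant, Formula.atomsIn_quant, Formula.freeVars_quant] at *
        exact pull N ihN x (by omega) hφ' hψ hPφ hPψ
      obtain ⟨x, ψ', rfl, hψ'⟩ | hψ' := hψ.cases_succ
      · simp only [Formula.depth_quant, Formula.atomsIn_quant, Formula.freeVars_quant] at *
        obtain ⟨χ, h1, h2, h3, h4⟩ := pull N ihN x (by omega) hψ' hφ hPψ hPφ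
        exact ⟨χ, h1, h2, by rwa [Finset.union_comm], fun w ν =>
          (h4 w ν).trans (Formula.sat_conn_comm _ _ _ _)⟩
      obtain ⟨χ, h1, h2⟩ := ihn hφ' hψ' hPφ hPψ
      exact ⟨χ, h1.of_ne c.ne_dual, h2⟩

end WordLogic
namespace WordLogic

/-! From games to formulas. -/

/-- Properties of words with an assignment. -/
abbrev Pred (A : Type*) := (w : FreeSemigroup A) → (ℕ → Pos w) → Prop

theorem finite_conn {A : Type*} {K : Set (Pred A)}
    (htrue : (fun _ _ => True) ∈ K) (hfalse : (fun _ _ => False) ∈ K)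
    (hand : ∀ Q ∈ K, ∀ R ∈ K, (fun w ν => Q w ν ∧ R w ν) ∈ K)
    (hor : ∀ Q ∈ K, ∀ R ∈ K, (fun w ν => Q w ν ∨ R w ν) ∈ K)
    {Φ : Set (Pred A)} (hf : Φ.Finite) (hΦ : Φ ⊆ K) :
    (fun w ν => ∀ Q ∈ Φ, Q w ν) ∈ K ∧ (fun w ν => ∃ Q ∈ Φ, Q w ν) ∈ K := by
  induction Φ, hf using Set.Finite.induction_on with
  | empty => simpa using ⟨htrue, hfalse⟩
  | @insert Q Φ _ _ ih =>
    have := ih ((Set.subset_insert _ _).trans hΦ)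
    have hQ := hΦ (Set.mem_insert _ _)
    simp only [Set.forall_mem_insert, Set.exists_mem_insert]
    exact ⟨hand _ hQ _ this.1, hor _ hQ _ this.2⟩

theorem finite_atoms (A : Type*) [Finite A] (D : Finset ℕ) :
    {a : Atom A | a.vars ⊆ D}.Finite := by
  have h1 : (Set.univ ×ˢ (D : Set ℕ) : Set (A × ℕ)).Finite :=
    Set.finite_univ.prod D.finite_toSet
  have h2 : ((D : Set ℕ) ×ˢ (D : Set ℕ)).Finite := D.finite_toSet.prod D.finite_toSet
  refine ((h1.image fun p => Atom.label p.1 p.2).union <|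
    (h2.image fun p => Atom.eq p.1 p.2).union <| (h2.image fun p => Atom.lt p.1 p.2).union <|
    (h2.image fun p => Atom.succ p.1 p.2).union <| (D.finite_toSet.image Atom.min).union <|
    (D.finite_toSet.image Atom.max)).subset ?_
  intro a ha
  cases a <;> simp_all [Atom.vars, Finset.insert_subset_iff]

/-- For every sequence of moves there is a finite set of properties, in any family that is closed
under the operations below, such that duplicator wins as soon as these are preserved. -/
theorem exists_basis {A : Type*} [Finite A] (P : Atom A → Prop) (V : Finset ℕ)
    (K : List (Set Quant) → Finset ℕ → Set (Pred A))
    (hlit : ∀ q D, D ⊆ V → ∀ a : Atom A, P a → a.vars ⊆ D →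
      (fun w ν => a.Sat w ν) ∈ K q D ∧ (fun w ν => ¬ a.Sat w ν) ∈ K q D)
    (htrue : ∀ q D, D ⊆ V → D.Nonempty → (fun _ _ => True) ∈ K q D)
    (hfalse : ∀ q D, D ⊆ V → D.Nonempty → (fun _ _ => False) ∈ K q D)
    (hand : ∀ q D, ∀ Q ∈ K q D, ∀ R ∈ K q D, (fun w ν => Q w ν ∧ R w ν) ∈ K q D)
    (hor : ∀ q D, ∀ Q ∈ K q D, ∀ R ∈ K q D, (fun w ν => Q w ν ∨ R w ν) ∈ K q D)
    (hex : ∀ m q D, ∀ x ∈ V, Quant.ex ∈ m → ∀ Q ∈ K q (insert x D),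
      (fun w ν => ∃ p, Q w (Function.update ν x p)) ∈ K (m :: q) D)
    (hall : ∀ m q D, ∀ x ∈ V, Quant.all ∈ m → ∀ Q ∈ K q (insert x D),
      (fun w ν => ∀ p, Q w (Function.update ν x p)) ∈ K (m :: q) D) :
    ∀ (q : List (Set Quant)) (D : Finset ℕ), D ⊆ V → ∃ Φ : Set (Pred A), Φ.Finite ∧ Φ ⊆ K q D ∧
      ∀ {w w' : FreeSemigroup A} (ν : ℕ → Pos w) (ν' : ℕ → Pos w'),
        (∀ Q ∈ Φ, Q w ν → Q w' ν') → WSim P V q D ν ν' := by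
  have base : ∀ (q : List (Set Quant)) (D : Finset ℕ), D ⊆ V →
      ∃ Φ : Set (Pred A), Φ.Finite ∧ Φ ⊆ K q D ∧
      ∀ {w w' : FreeSemigroup A} (ν : ℕ → Pos w) (ν' : ℕ → Pos w'),
        (∀ Q ∈ Φ, Q w ν → Q w' ν') → Agree P (letters w).get (letters w').get D ν ν' := by
    intro q D hD
    have hfin : {a : Atom A | P a ∧ a.vars ⊆ D}.Finite :=
      (finite_atoms A D).subset fun a ha => ha.2
    refine ⟨(fun (a : Atom A) => (fun w ν => a.Sat w ν : Pred A)) '' {a | P a ∧ a.vars ⊆ D} ∪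
      (fun (a : Atom A) => (fun w ν => ¬ a.Sat w ν : Pred A)) '' {a | P a ∧ a.vars ⊆ D},
      (hfin.image _).union (hfin.image _), ?_, ?_⟩
    · rintro _ (⟨a, ha, rfl⟩ | ⟨a, ha, rfl⟩)
      · exact (hlit q D hD a ha.1 ha.2).1
      · exact (hlit q D hD a ha.1 ha.2).2
    · intro w w' ν ν' h a hPa ha
      rw [← Atom.sat_iff_holds, ← Atom.sat_iff_holds]
      refine ⟨h _ (.inl ⟨a, ⟨hPa, ha⟩, rfl⟩), fun h' => ?_⟩
      by_contra hn
      exact h _ (.inr ⟨a, ⟨hPa, ha⟩, rfl⟩) hn h'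
  intro q
  induction q with
  | nil => exact base []
  | cons m q ih =>
    intro D hD
    obtain ⟨Φ₀, hf₀, hK₀, h₀⟩ := base (m :: q) D hD
    have hins : ∀ x ∈ V, insert x D ⊆ V := fun x hx => Finset.insert_subset hx hD
    choose! Φ hf hK h using fun x (hx : x ∈ V) => ih (insert x D) (hins x hx)
    -- Truth and falsity are only needed with at least one assigned variable, since without
    -- constants a quantifier-free formula needs a variable to express them.
    have conn : ∀ x ∈ V, ∀ Ψ ⊆ Φ x, _ := fun x hx Ψ hΨ =>
      finite_conn (htrue q _ (hins x hx) (Finset.insert_nonempty _ _))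
        (hfalse q _ (hins x hx) (Finset.insert_nonempty _ _)) (hand q _) (hor q _)
        ((hf x hx).subset hΨ) (hΨ.trans (hK x hx))
    -- Besides the literals, the basis contains `∃ p, ⋀ Ψ` for moves on the left and `∀ p, ⋁ Ψ` for
    -- moves on the right, where `Ψ` ranges over the finitely many subsets of the basis for the
    -- remaining moves.
    refine ⟨Φ₀ ∪ ({R | Quant.ex ∈ m ∧ R ∈ ⋃ x ∈ V, (fun Ψ : Set (Pred A) =>
        (fun w ν => ∃ p, ∀ Q ∈ Ψ, Q w (Function.update ν x p) : Pred A)) '' 𝒫 (Φ x)} ∪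
      {R | Quant.all ∈ m ∧ R ∈ ⋃ x ∈ V, (fun Ψ : Set (Pred A) =>
        (fun w ν => ∀ p, ∃ Q ∈ Ψ, Q w (Function.update ν x p) : Pred A)) '' 𝒫 (Φ x)}),
      hf₀.union (.union ?_ ?_), Set.union_subset hK₀ (Set.union_subset ?_ ?_), ?_⟩
    · exact (V.finite_toSet.biUnion fun x hx =>
        ((hf x hx).finite_subsets.image _)).subset fun R hR => hR.2
    · exact (V.finite_toSet.biUnion fun x hx =>
        ((hf x hx).finite_subsets.image _)).subset fun R hR => hR.2
    · rintro R ⟨hm, hR⟩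
      simp only [Set.mem_iUnion] at hR
      obtain ⟨x, hx, Ψ, hΨ, rfl⟩ := hR
      exact hex m q D x hx hm _ (conn x hx Ψ hΨ).1
    · rintro R ⟨hm, hR⟩
      simp only [Set.mem_iUnion] at hR
      obtain ⟨x, hx, Ψ, hΨ, rfl⟩ := hR
      exact hall m q D x hx hm _ (conn x hx Ψ hΨ).2
    · intro w w' ν ν' hpres
      refine ⟨h₀ ν ν' fun Q hQ => hpres Q (.inl hQ), fun hm x hx p => ?_, fun hm x hx p' => ?_⟩
      -- Here `Ψ` is the set of all basis properties true at `p`; a witness on the right is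
      -- Duplicator's answer.
      · obtain ⟨p', hp'⟩ := hpres _ (.inr (.inl ⟨hm, Set.mem_iUnion₂.2 ⟨x, hx,
          {Q ∈ Φ x | Q w (Function.update ν x p)}, fun Q hQ => hQ.1, rfl⟩⟩))
          ⟨p, fun Q hQ => hQ.2⟩
        exact ⟨p', h x hx _ _ fun Q hQ hQp => hp' Q ⟨hQ, hQp⟩⟩
      -- Dually, `Ψ` is the set of basis properties false at `p'`. If no `p` were an answer, every
      -- `p` would satisfy some member of `Ψ`; this transfers to the right and fails at `p'`.
      · by_contra! hcon
        obtain ⟨Q, hQ, hQp⟩ := hpres _ (.inr (.inr ⟨hm, Set.mem_iUnion₂.2 ⟨x, hx,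
          {Q ∈ Φ x | ¬ Q w' (Function.update ν' x p')}, fun Q hQ => hQ.1, rfl⟩⟩))
          (fun p => by
            have := mt (h x hx _ _) (hcon p)
            push Not at this
            obtain ⟨Q, hQ, h1, h2⟩ := this
            exact ⟨Q, ⟨hQ, h2⟩, h1⟩) p'
        exact hQ.2 hQp

/-! Definability in prenex classes. -/

/-- The property `Q` is defined by a prenex formula of level `(c, n)`. -/
def PrenexDef {A : Type*} (P : Atom A → Prop) (c : Quant) (n : ℕ) (D : Finset ℕ)
    (Q : Pred A) : Prop :=
  ∃ φ : Formula A, IsPrenexLevel c n φ ∧ φ.AtomsIn P ∧ φ.freeVars ⊆ D ∧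
    ∀ w ν, Q w ν ↔ φ.Sat w ν

namespace PrenexDef

variable {A : Type*} {P : Atom A → Prop} {c : Quant} {n : ℕ} {D : Finset ℕ} {Q R : Pred A}

theorem of_ne {d : Quant} (hcd : c ≠ d) (h : PrenexDef P d n D Q) :
    PrenexDef P c (n + 1) D Q := by
  obtain ⟨φ, h1, h2⟩ := h
  exact ⟨φ, h1.of_ne hcd, h2⟩

theorem and (hP : ∀ (σ : ℕ → ℕ) a, P a → P (a.rename σ)) (hQ : PrenexDef P c n D Q)
    (hR : PrenexDef P c n D R) : PrenexDef P c n D (fun w ν => Q w ν ∧ R w ν) := by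
  obtain ⟨φ, a1, a2, a3, a4⟩ := hQ
  obtain ⟨ψ, b1, b2, b3, b4⟩ := hR
  obtain ⟨χ, h1, h2, h3, h4⟩ := IsPrenexLevel.exists_conn hP .all n a1 b1 a2 b2
  exact ⟨χ, h1, h2, h3.trans (Finset.union_subset a3 b3), fun w ν =>
    (and_congr (a4 w ν) (b4 w ν)).trans (h4 w ν).symm⟩

theorem or (hP : ∀ (σ : ℕ → ℕ) a, P a → P (a.rename σ)) (hQ : PrenexDef P c n D Q)
    (hR : PrenexDef P c n D R) : PrenexDef P c n D (fun w ν => Q w ν ∨ R w ν) := by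
  obtain ⟨φ, a1, a2, a3, a4⟩ := hQ
  obtain ⟨ψ, b1, b2, b3, b4⟩ := hR
  obtain ⟨χ, h1, h2, h3, h4⟩ := IsPrenexLevel.exists_conn hP .ex n a1 b1 a2 b2
  exact ⟨χ, h1, h2, h3.trans (Finset.union_subset a3 b3), fun w ν =>
    (or_congr (a4 w ν) (b4 w ν)).trans (h4 w ν).symm⟩

theorem ex {x : ℕ} (hQ : PrenexDef P .ex (n + 1) (insert x D) Q) :
    PrenexDef P .ex (n + 1) D (fun w ν => ∃ p, Q w (Function.update ν x p)) := by
  obtain ⟨φ, a1, a2, a3, a4⟩ := hQ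
  exact ⟨.ex x φ, .ex x a1, a2, Finset.subset_insert_iff.1 a3, fun w ν =>
    exists_congr fun p => a4 _ _⟩

theorem all {x : ℕ} (hQ : PrenexDef P .all (n + 1) (insert x D) Q) :
    PrenexDef P .all (n + 1) D (fun w ν => ∀ p, Q w (Function.update ν x p)) := by
  obtain ⟨φ, a1, a2, a3, a4⟩ := hQ
  exact ⟨.all x φ, .all x a1, a2, Finset.subset_insert_iff.1 a3, fun w ν =>
    forall_congr' fun p => a4 _ _⟩

theorem const (hP : ∀ x y, P (.eq x y)) {x : ℕ} (hx : x ∈ D) (b : Prop) :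
    PrenexDef P c n D (fun _ _ => b) := by
  by_cases hb : b
  · exact ⟨.atom (.eq x x), .qf trivial, hP _ _, by simpa [Formula.freeVars, Atom.vars],
      fun w ν => by simp [hb, Formula.Sat, Atom.Sat]⟩
  · exact ⟨.neg (.atom (.eq x x)), .qf trivial, hP _ _, by simpa [Formula.freeVars, Atom.vars],
      fun w ν => by simp [hb, Formula.Sat, Atom.Sat]⟩

/-- With no variable available, a constant is written with a dummy quantifier, which costs one
block. All prenex fragments have `n ≥ 1`. -/
theorem const_succ (hP : ∀ x y, P (.eq x y)) (b : Prop) :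
    PrenexDef P c (n + 1) D (fun _ _ => b) := by
  have h := const (c := c) (n := n + 1) (D := insert 0 D) hP (Finset.mem_insert_self 0 D) b
  have inh : ∀ {w : FreeSemigroup A} (_ : ℕ → Pos w), Nonempty (Pos w) := fun ν => ⟨ν 0⟩
  cases c
  · obtain ⟨φ, h1, h2, h3, h4⟩ := h.ex
    exact ⟨φ, h1, h2, h3, fun w ν => by rw [← h4]; have := inh ν; simp⟩
  · obtain ⟨φ, h1, h2, h3, h4⟩ := h.all
    exact ⟨φ, h1, h2, h3, fun w ν => by rw [← h4]; have := inh ν; simp⟩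

end PrenexDef

/-- Skipping empty blocks brings the level down to one whose leading kind `d` is that of the first
move; definability at this lower level implies definability at the original one. -/
theorem IsMoveLevel.cases_cons {A : Type*} {P : Atom A → Prop} {c : Quant} {n : ℕ}
    {m : Set Quant} {q : List (Set Quant)} (h : IsMoveLevel c n (m :: q)) :
    ∃ d k, m = {d} ∧ IsMoveLevel d (k + 1) q ∧
      ∀ (D : Finset ℕ) (Q : Pred A), PrenexDef P d (k + 1) D Q → PrenexDef P c n D Q := by
  generalize hq : m :: q = q' at h
  induction h with
  | nil => cases hq
  | @cons c n q' h ih =>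
    cases hq
    exact ⟨c, n, rfl, h, fun D Q hQ => hQ⟩
  | @alternate c d n q' hcd h ih =>
    obtain ⟨e, k, h1, h2, h3⟩ := ih hq
    exact ⟨e, k, h1, h2, fun D Q hQ => (h3 D Q hQ).of_ne hcd⟩

theorem exists_basis_prenex {A : Type*} [Finite A] {P : Atom A → Prop}
    (hP : ∀ (σ : ℕ → ℕ) a, P a → P (a.rename σ)) (hPeq : ∀ x y, P (.eq x y)) (V : Finset ℕ)
    {c : Quant} {n : ℕ} {q : List (Set Quant)} (hq : IsMoveLevel c n q) :
    ∃ Φ : Set (Pred A), Φ.Finite ∧ (∀ Q ∈ Φ, PrenexDef P c n ∅ Q) ∧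
      ∀ {w w' : FreeSemigroup A} (ν : ℕ → Pos w) (ν' : ℕ → Pos w'),
        (∀ Q ∈ Φ, Q w ν → Q w' ν') → WSim P V q ∅ ν ν' := by
  obtain ⟨Φ, h1, h2, h3⟩ := exists_basis P V
    -- The family consists of the properties definable at every level that admits the list `q`; the
    -- quantification over levels makes the closure conditions inductive.
    (fun q D => {Q | ∀ c n, IsMoveLevel c n q → PrenexDef P c n D Q})
    (fun q D _ a ha hD => ⟨fun c n _ => ⟨.atom a, .qf trivial, ha, hD, fun w ν => Iff.rfl⟩,
      fun c n _ => ⟨.neg (.atom a), .qf trivial, ha, hD, fun w ν => Iff.rfl⟩⟩)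
    (fun q D _ hD c n _ => .const hPeq hD.choose_spec _)
    (fun q D _ hD c n _ => .const hPeq hD.choose_spec _)
    (fun q D Q hQ R hR c n h => (hQ c n h).and hP (hR c n h))
    (fun q D Q hQ R hR c n h => (hQ c n h).or hP (hR c n h))
    (fun m q D x hx hm Q hQ c n h => by
      obtain ⟨d, k, rfl, hd, hdc⟩ := h.cases_cons (P := P)
      cases hm
      exact hdc _ _ (hQ _ _ hd).ex)
    (fun m q D x hx hm Q hQ c n h => by
      obtain ⟨d, k, rfl, hd, hdc⟩ := h.cases_cons (P := P)
      cases hm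
      exact hdc _ _ (hQ _ _ hd).all) q ∅ (Finset.empty_subset _)
  exact ⟨Φ, h1, fun Q hQ => h2 hQ c n hq, h3⟩

theorem exists_basis_allVars {A : Type*} [Finite A] {P : Atom A → Prop}
    (hPeq : ∀ x y, P (.eq x y)) (V : Finset ℕ) (q : List (Set Quant)) :
    ∃ Φ : Set (Pred A), Φ.Finite ∧ (∀ Q ∈ Φ, ∃ φ : Formula A, φ.allVars ⊆ V ∧ φ.AtomsIn P ∧
        φ.freeVars ⊆ ∅ ∧ ∀ w ν, Q w ν ↔ φ.Sat w ν) ∧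
      ∀ {w w' : FreeSemigroup A} (ν : ℕ → Pos w) (ν' : ℕ → Pos w'),
        (∀ Q ∈ Φ, Q w ν → Q w' ν') → WSim P V q ∅ ν ν' := by
  refine exists_basis P V
    (fun q D => {Q | ∃ φ : Formula A, φ.allVars ⊆ V ∧ φ.AtomsIn P ∧
        φ.freeVars ⊆ D ∧ ∀ w ν, Q w ν ↔ φ.Sat w ν})
    (fun q D hV a ha hD => ⟨⟨.atom a, hD.trans hV, ha, hD, fun w ν => Iff.rfl⟩,
      ⟨.neg (.atom a), hD.trans hV, ha, hD, fun w ν => Iff.rfl⟩⟩)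
    ?_ ?_ ?_ ?_ ?_ ?_ q ∅ (Finset.empty_subset _)
  · rintro q D hV ⟨x, hx⟩
    exact ⟨.atom (.eq x x), by simpa [Formula.allVars, Atom.vars] using hV hx, hPeq _ _,
      by simpa [Formula.freeVars, Atom.vars], fun w ν => by simp [Formula.Sat, Atom.Sat]⟩
  · rintro q D hV ⟨x, hx⟩
    exact ⟨.neg (.atom (.eq x x)), by simpa [Formula.allVars, Atom.vars] using hV hx, hPeq _ _,
      by simpa [Formula.freeVars, Atom.vars], fun w ν => by simp [Formula.Sat, Atom.Sat]⟩
  · rintro q D Q ⟨φ, a1, a2, a3, a4⟩ R ⟨ψ, b1, b2, b3, b4⟩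
    exact ⟨.and φ ψ, Finset.union_subset a1 b1, ⟨a2, b2⟩, Finset.union_subset a3 b3,
      fun w ν => and_congr (a4 w ν) (b4 w ν)⟩
  · rintro q D Q ⟨φ, a1, a2, a3, a4⟩ R ⟨ψ, b1, b2, b3, b4⟩
    exact ⟨.or φ ψ, Finset.union_subset a1 b1, ⟨a2, b2⟩, Finset.union_subset a3 b3,
      fun w ν => or_congr (a4 w ν) (b4 w ν)⟩
  · rintro m q D x hx - Q ⟨φ, a1, a2, a3, a4⟩
    exact ⟨.ex x φ, Finset.insert_subset hx a1, a2, Finset.subset_insert_iff.1 a3,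
      fun w ν => exists_congr fun p => a4 _ _⟩
  · rintro m q D x hx - Q ⟨φ, a1, a2, a3, a4⟩
    exact ⟨.all x φ, Finset.insert_subset hx a1, a2, Finset.subset_insert_iff.1 a3,
      fun w ν => forall_congr' fun p => a4 _ _⟩

/-! Definability in a fragment by means of games. -/

namespace Fragment

/-- The games that correspond to the fragment. -/
def IsTest : Fragment → Finset ℕ × List (Set Quant) → Prop
  | foEq, t => ∃ r, t.2 = List.replicate r Set.univ
  | foTwo, t => t.1 ⊆ {0, 1} ∧ ∃ r, t.2 = List.replicate r Set.univ
  | sigma n _, t => IsMoveLevel .ex n t.2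
  | pi n _, t => IsMoveLevel .all n t.2
  | bsigma n _, t => IsMoveLevel .ex n t.2 ∨ IsMoveLevel .all n t.2

variable {A : Type*}

/-- `L` is defined by a sentence of the shape of the fragment, with atoms in `P`. -/
def DefinableWith (F : Fragment) (P : Atom A → Prop) (L : Set (FreeSemigroup A)) : Prop :=
  ∃ φ : Formula A, (φ.IsSentence ∧ F.Shape φ ∧ φ.AtomsIn P) ∧ Defines φ L

theorem exists_tests_of_shape (F : Fragment) {P : Atom A → Prop} {φ : Formula A}
    (hs : F.Shape φ) (hP : φ.AtomsIn P) (hφ : φ.IsSentence) :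
    ∃ T : Set (Finset ℕ × List (Set Quant)), T.Finite ∧ (∀ t ∈ T, F.IsTest t) ∧
      ∀ {w w' : FreeSemigroup A} (ν : ℕ → Pos w) (ν' : ℕ → Pos w'),
        (∀ t ∈ T, WSim P t.1 t.2 ∅ ν ν') → φ.Sat w ν → φ.Sat w' ν' := by
  have hφ' : φ.freeVars ⊆ ∅ := hφ.subset
  cases F with
  | foEq =>
    exact ⟨{(φ.allVars, List.replicate φ.depth Set.univ)}, Set.finite_singleton _,
      by rintro _ rfl; exact ⟨_, rfl⟩, fun ν ν' h =>
        (Formula.sat_iff_of_sim_univ φ hP subset_rfl le_rfl hφ' (h _ rfl)).1⟩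
  | foTwo =>
    exact ⟨{(φ.allVars, List.replicate φ.depth Set.univ)}, Set.finite_singleton _,
      by rintro _ rfl; exact ⟨hs, _, rfl⟩, fun ν ν' h =>
        (Formula.sat_iff_of_sim_univ φ hP subset_rfl le_rfl hφ' (h _ rfl)).1⟩
  | sigma n hn =>
    obtain ⟨⟨q, h1, h2⟩, -⟩ := IsPrenexLevel.exists_moves hs hP
    exact ⟨{(φ.allVars, q)}, Set.finite_singleton _, by rintro _ rfl; exact h1, fun ν ν' h =>
      h2 _ _ subset_rfl hφ' ν ν' (h _ rfl)⟩
  | pi n hn =>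
    obtain ⟨⟨q, h1, h2⟩, -⟩ := IsPrenexLevel.exists_moves hs hP
    exact ⟨{(φ.allVars, q)}, Set.finite_singleton _, by rintro _ rfl; exact h1, fun ν ν' h =>
      h2 _ _ subset_rfl hφ' ν ν' (h _ rfl)⟩
  | bsigma n hn =>
    -- Negations reverse implications, so the induction over Boolean combinations needs an
    -- equivalence. Its base case uses both the preserving and the reflecting list of moves.
    suffices H : ∃ T : Set (Finset ℕ × List (Set Quant)), T.Finite ∧
        (∀ t ∈ T, (bsigma n hn).IsTest t) ∧
        ∀ {w w' : FreeSemigroup A} (ν : ℕ → Pos w) (ν' : ℕ → Pos w'),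
          (∀ t ∈ T, WSim P t.1 t.2 ∅ ν ν') → (φ.Sat w ν ↔ φ.Sat w' ν') by
      obtain ⟨T, h1, h2, h3⟩ := H
      exact ⟨T, h1, h2, fun ν ν' h => (h3 ν ν' h).1⟩
    clear hφ
    change IsBoolComb _ φ at hs
    induction hs with
    | @base φ h =>
      have key : ∀ c, IsPrenexLevel c n φ → _ := fun c h =>
        IsPrenexLevel.exists_moves (P := P) h hP
      have test : ∀ (c : Quant) (V : Finset ℕ) (q : List (Set Quant)), IsMoveLevel c n q →
          (bsigma n hn).IsTest (V, q) := by
        rintro (_ | _) V q h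
        exacts [.inl h, .inr h]
      obtain ⟨c, hc⟩ : ∃ c, IsPrenexLevel c n φ := by
        obtain h | h := h
        exacts [⟨_, h⟩, ⟨_, h⟩]
      obtain ⟨⟨q, h1, h2⟩, ⟨q', h1', h2'⟩⟩ := key c hc
      refine ⟨{(φ.allVars, q), (φ.allVars, q')}, (Set.finite_singleton _).insert _, ?_, ?_⟩
      · rintro _ (rfl | rfl)
        exacts [test _ _ _ h1, test _ _ _ h1']
      · intro w w' ν ν' h
        exact ⟨h2 _ _ subset_rfl hφ' ν ν' (h _ (.inl rfl)),
          h2' _ _ subset_rfl hφ' ν ν' (h _ (.inr rfl))⟩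
    | neg h ih =>
      obtain ⟨T, h1, h2, h3⟩ := ih hP hφ'
      exact ⟨T, h1, h2, fun ν ν' h => not_congr (h3 ν ν' h)⟩
    | and h h' ih ih' =>
      obtain ⟨T, h1, h2, h3⟩ := ih hP.1 (Finset.union_subset_left hφ')
      obtain ⟨T', h1', h2', h3'⟩ := ih' hP.2 (Finset.union_subset_right hφ')
      exact ⟨T ∪ T', h1.union h1', fun t ht => ht.elim (h2 t) (h2' t), fun ν ν' h =>
        and_congr (h3 ν ν' fun t ht => h t (.inl ht)) (h3' ν ν' fun t ht => h t (.inr ht))⟩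
    | or h h' ih ih' =>
      obtain ⟨T, h1, h2, h3⟩ := ih hP.1 (Finset.union_subset_left hφ')
      obtain ⟨T', h1', h2', h3'⟩ := ih' hP.2 (Finset.union_subset_right hφ')
      exact ⟨T ∪ T', h1.union h1', fun t ht => ht.elim (h2 t) (h2' t), fun ν ν' h =>
        or_congr (h3 ν ν' fun t ht => h t (.inl ht)) (h3' ν ν' fun t ht => h t (.inr ht))⟩

/-- The property `Q` of words is defined by a sentence of the shape of the fragment. -/
def PredDef (F : Fragment) (P : Atom A → Prop) (Q : Pred A) : Prop :=
  ∃ φ : Formula A, F.Shape φ ∧ φ.AtomsIn P ∧ φ.freeVars ⊆ ∅ ∧ ∀ w ν, Q w ν ↔ φ.Sat w ν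

variable {F : Fragment} {P : Atom A → Prop}

theorem PredDef.and (hP : ∀ (σ : ℕ → ℕ) a, P a → P (a.rename σ)) {Q R : Pred A}
    (hQ : F.PredDef P Q) (hR : F.PredDef P R) : F.PredDef P (fun w ν => Q w ν ∧ R w ν) := by
  cases F with
  | sigma n hn => exact PrenexDef.and hP hQ hR
  | pi n hn => exact PrenexDef.and hP hQ hR
  | _ =>
    obtain ⟨φ, a1, a2, a3, a4⟩ := hQ
    obtain ⟨ψ, b1, b2, b3, b4⟩ := hR
    refine ⟨.and φ ψ, ?_, ⟨a2, b2⟩, Finset.union_subset a3 b3,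
      fun w ν => and_congr (a4 w ν) (b4 w ν)⟩
    first
    | exact trivial
    | exact Finset.union_subset a1 b1
    | exact IsBoolComb.and a1 b1

theorem PredDef.or (hP : ∀ (σ : ℕ → ℕ) a, P a → P (a.rename σ)) {Q R : Pred A}
    (hQ : F.PredDef P Q) (hR : F.PredDef P R) : F.PredDef P (fun w ν => Q w ν ∨ R w ν) := by
  cases F with
  | sigma n hn => exact PrenexDef.or hP hQ hR
  | pi n hn => exact PrenexDef.or hP hQ hR
  | _ =>
    obtain ⟨φ, a1, a2, a3, a4⟩ := hQ
    obtain ⟨ψ, b1, b2, b3, b4⟩ := hR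
    refine ⟨.or φ ψ, ?_, ⟨a2, b2⟩, Finset.union_subset a3 b3,
      fun w ν => or_congr (a4 w ν) (b4 w ν)⟩
    first
    | exact trivial
    | exact Finset.union_subset a1 b1
    | exact IsBoolComb.or a1 b1

theorem PredDef.const (hPeq : ∀ x y, P (.eq x y)) (b : Prop) :
    F.PredDef P (fun _ _ => b) := by
  have fo : ∃ φ : Formula A, φ.allVars ⊆ {0, 1} ∧ φ.AtomsIn P ∧ φ.freeVars ⊆ ∅ ∧
      ∀ (w : FreeSemigroup A) (ν : ℕ → Pos w), b ↔ φ.Sat w ν := by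
    by_cases hb : b
    · exact ⟨.ex 0 (.atom (.eq 0 0)), by simp [Formula.allVars, Atom.vars], hPeq _ _,
        by simp [Formula.freeVars, Atom.vars], fun w ν => by
          have : Nonempty (Pos w) := ⟨ν 0⟩
          simp [hb, Formula.Sat, Atom.Sat]⟩
    · exact ⟨.ex 0 (.neg (.atom (.eq 0 0))), by simp [Formula.allVars, Atom.vars], hPeq _ _,
        by simp [Formula.freeVars, Atom.vars], fun w ν => by simp [hb, Formula.Sat, Atom.Sat]⟩
  cases F with
  | foEq =>
    obtain ⟨φ, h1, h2⟩ := fo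
    exact ⟨φ, trivial, h2⟩
  | foTwo => exact fo
  | sigma n hn =>
    obtain ⟨n, rfl⟩ := Nat.exists_eq_add_of_le' hn
    exact PrenexDef.const_succ hPeq b
  | pi n hn =>
    obtain ⟨n, rfl⟩ := Nat.exists_eq_add_of_le' hn
    exact PrenexDef.const_succ hPeq b
  | bsigma n hn =>
    obtain ⟨n, rfl⟩ := Nat.exists_eq_add_of_le' hn
    obtain ⟨φ, h1, h2⟩ := PrenexDef.const_succ (c := .ex) (n := n) (D := ∅) hPeq b
    exact ⟨φ, .base (.inl h1), h2⟩

theorem exists_basis_test [Finite A] (hP : ∀ (σ : ℕ → ℕ) a, P a → P (a.rename σ))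
    (hPeq : ∀ x y, P (.eq x y)) {t : Finset ℕ × List (Set Quant)} (ht : F.IsTest t) :
    ∃ Φ : Set (Pred A), Φ.Finite ∧ (∀ Q ∈ Φ, F.PredDef P Q) ∧
      ∀ {w w' : FreeSemigroup A} (ν : ℕ → Pos w) (ν' : ℕ → Pos w'),
        (∀ Q ∈ Φ, Q w ν → Q w' ν') → WSim P t.1 t.2 ∅ ν ν' := by
  cases F with
  | foEq =>
    obtain ⟨Φ, h1, h2, h3⟩ := exists_basis_allVars hPeq t.1 t.2
    refine ⟨Φ, h1, fun Q hQ => ?_, h3⟩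
    obtain ⟨φ, h4, h5⟩ := h2 Q hQ
    exact ⟨φ, trivial, h5⟩
  | foTwo =>
    obtain ⟨Φ, h1, h2, h3⟩ := exists_basis_allVars hPeq t.1 t.2
    refine ⟨Φ, h1, fun Q hQ => ?_, h3⟩
    obtain ⟨φ, h4, h5⟩ := h2 Q hQ
    exact ⟨φ, h4.trans ht.1, h5⟩
  | sigma n hn => exact exists_basis_prenex hP hPeq t.1 ht
  | pi n hn => exact exists_basis_prenex hP hPeq t.1 ht
  | bsigma n hn =>
    obtain ht | ht := ht
    · obtain ⟨Φ, h1, h2, h3⟩ := exists_basis_prenex hP hPeq t.1 ht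
      refine ⟨Φ, h1, fun Q hQ => ?_, h3⟩
      obtain ⟨φ, h4, h5⟩ := h2 Q hQ
      exact ⟨φ, .base (.inl h4), h5⟩
    · obtain ⟨Φ, h1, h2, h3⟩ := exists_basis_prenex hP hPeq t.1 ht
      refine ⟨Φ, h1, fun Q hQ => ?_, h3⟩
      obtain ⟨φ, h4, h5⟩ := h2 Q hQ
      exact ⟨φ, .base (.inr h4), h5⟩

/-- The first position, as a constant assignment. -/
def origin (w : FreeSemigroup A) : ℕ → Pos w := fun _ => ⟨0, by simp [letters]⟩

/-- A language is definable if and only if it is closed under finitely many of the games that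
correspond to the fragment. -/
theorem definableWith_iff [Finite A] (hP : ∀ (σ : ℕ → ℕ) a, P a → P (a.rename σ))
    (hPeq : ∀ x y, P (.eq x y)) {L : Set (FreeSemigroup A)} :
    F.DefinableWith P L ↔ ∃ T : Set (Finset ℕ × List (Set Quant)), T.Finite ∧
      (∀ t ∈ T, F.IsTest t) ∧ ∀ {w w' : FreeSemigroup A},
        (∀ t ∈ T, WSim P t.1 t.2 ∅ (origin w) (origin w')) → w ∈ L → w' ∈ L := by
  constructor
  · rintro ⟨φ, ⟨h1, h2, h3⟩, h4⟩
    obtain ⟨T, hT, hT', h⟩ := exists_tests_of_shape F h2 h3 h1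
    exact ⟨T, hT, hT', fun {w w'} hs hw => (h4 _ _).2 (h _ _ hs ((h4 _ _).1 hw))⟩
  · rintro ⟨T, hT, hT', h⟩
    choose! Φ hf hK hs using fun t ht => exists_basis_test hP hPeq (hT' t ht)
    have hfin : (⋃ t ∈ T, Φ t).Finite := hT.biUnion hf
    have hdef : ⋃ t ∈ T, Φ t ⊆ {Q | F.PredDef P Q} := by
      intro Q hQ
      simp only [Set.mem_iUnion] at hQ
      obtain ⟨t, ht, hQ⟩ := hQ
      exact hK t ht Q hQ
    have conn := fun (Ψ : Set (Pred A)) => @finite_conn A {Q | F.PredDef P Q}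
      (PredDef.const hPeq _) (PredDef.const hPeq _)
      (fun Q hQ R hR => PredDef.and hP hQ hR) (fun Q hQ R hR => PredDef.or hP hQ hR) Ψ
    -- The sentence says that, for some `w₀ ∈ L`, all basis properties of `w₀` hold. The disjunction
    -- is finite because the basis has finitely many subsets.
    obtain ⟨φ, h1, h2, h3, h4⟩ := (conn
      ((fun w₀ => (fun w ν => ∀ Q ∈ {Q ∈ ⋃ t ∈ T, Φ t | Q w₀ (origin w₀)}, Q w ν : Pred A)) '' L)
      (((hfin.finite_subsets.image fun Ψ => (fun w ν => ∀ Q ∈ Ψ, Q w ν : Pred A)).subset (by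
        rintro _ ⟨w₀, hw₀, rfl⟩
        exact ⟨_, fun Q hQ => hQ.1, rfl⟩)))
      (by
        rintro _ ⟨w₀, hw₀, rfl⟩
        exact (conn _ (hfin.subset fun Q hQ => hQ.1) fun Q hQ => hdef hQ.1).1)).2
    refine ⟨φ, ⟨Finset.subset_empty.1 h3, h1, h2⟩, fun w ν => ?_⟩
    rw [Formula.sat_congr φ (ν' := origin w) fun x hx => absurd (h3 hx) (Finset.notMem_empty _),
      ← h4]
    constructor
    · exact fun hw => ⟨_, ⟨w, hw, rfl⟩, fun Q hQ => hQ.2⟩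
    · rintro ⟨_, ⟨w₀, hw₀, rfl⟩, hw⟩
      exact h (fun t ht => hs t ht _ _ fun Q hQ hQ₀ =>
        hw Q ⟨Set.mem_iUnion₂.2 ⟨t, ht, hQ⟩, hQ₀⟩) hw₀

theorem weakAtom_rename (F : Fragment) (σ : ℕ → ℕ) (a : Atom A) (h : F.WeakAtom a) :
    F.WeakAtom (a.rename σ) := by cases a <;> exact h

theorem isEnriched_rename (σ : ℕ → ℕ) (a : Atom A) (h : a.IsEnriched) :
    (a.rename σ).IsEnriched := by cases a <;> exact h

/-- The atoms of the strong variant. -/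
def StrongAtom (F : Fragment) (a : Atom A) : Prop := F.WeakAtom a ∨ a.IsEnriched

theorem weakDefinable_iff [Finite A] {L : Set (FreeSemigroup A)} :
    F.WeakDefinable L ↔ ∃ T : Set (Finset ℕ × List (Set Quant)), T.Finite ∧
      (∀ t ∈ T, F.IsTest t) ∧ ∀ {w w' : FreeSemigroup A},
        (∀ t ∈ T, WSim F.WeakAtom t.1 t.2 ∅ (origin w) (origin w')) → w ∈ L → w' ∈ L :=
  definableWith_iff (weakAtom_rename F) fun _ _ => trivial

theorem strongDefinable_iff [Finite A] {L : Set (FreeSemigroup A)} :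
    F.StrongDefinable L ↔ ∃ T : Set (Finset ℕ × List (Set Quant)), T.Finite ∧
      (∀ t ∈ T, F.IsTest t) ∧ ∀ {w w' : FreeSemigroup A},
        (∀ t ∈ T, WSim F.StrongAtom t.1 t.2 ∅ (origin w) (origin w')) → w ∈ L → w' ∈ L :=
  definableWith_iff (fun σ a h => h.imp (weakAtom_rename F σ a) (isEnriched_rename σ a))
    fun _ _ => .inl trivial

end Fragment

end WordLogic
namespace WordLogic

/-! Well-formed words are those satisfying local conditions. -/

section WellFormed

variable {S : Type*} [Mul S]

namespace WFLetter

/-- The idempotent on the left of a letter, if any. -/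
def left : WFLetter S → Option (Idem S)
  | mid e _ _ => some e
  | first _ _ => none
  | last e _ => some e
  | single _ => none

/-- The idempotent on the right of a letter, if any. -/
def right : WFLetter S → Option (Idem S)
  | mid _ _ f => some f
  | first _ f => some f
  | last _ _ => none
  | single _ => none

/-- The element of the semigroup in the middle of a letter. -/
def core : WFLetter S → S
  | mid _ s _ => s
  | first s _ => s
  | last _ s => s
  | single s => s

/-- The letter `b` may follow the letter `a` in a well-formed word. -/
def Compat (a b : WFLetter S) : Prop := ∃ f, a.right = some f ∧ b.left = some f

instance [Finite S] : Finite (WFLetter S) :=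
  Finite.of_injective (fun a : WFLetter S => (a.left, a.core, a.right)) fun a b h => by
    cases a <;> cases b <;> simp_all [left, core, right]

end WFLetter

theorem isWFTail_iff {e : Idem S} {l : List (WFLetter S)} :
    IsWFTail e l ↔ (∃ a l', l = a :: l' ∧ a.left = some e) ∧ l.IsChain WFLetter.Compat ∧
      ∀ a ∈ l.getLast?, a.right = none := by
  constructor
  · intro h
    induction h with
    | last e s => exact ⟨⟨_, _, rfl, rfl⟩, by simp, by simp [WFLetter.right]⟩
    | mid e s f h ih =>
      obtain ⟨⟨a, l', rfl, ha⟩, h1, h2⟩ := ih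
      refine ⟨⟨_, _, rfl, rfl⟩, ?_, by simpa using h2⟩
      exact List.isChain_cons_cons.2 ⟨⟨f, rfl, ha⟩, h1⟩
  · rintro ⟨⟨a, l', rfl, ha⟩, h1, h2⟩
    induction l' generalizing a e with
    | nil =>
      simp only [List.getLast?_singleton, Option.mem_def, Option.some.injEq, forall_eq'] at h2
      cases a <;> simp_all [WFLetter.left, WFLetter.right]
      exact .last _ _
    | cons b l ih =>
      obtain ⟨⟨f, hf, hb⟩, h1⟩ := List.isChain_cons_cons.1 h1
      have := ih b hb h1 (by simpa using h2)
      cases a with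
      | mid e' s f' =>
        obtain rfl := Option.some.inj ha
        obtain rfl := Option.some.inj hf
        exact .mid _ _ _ this
      | first s f' => cases ha
      | last e' s => cases hf
      | single s => cases ha

theorem mem_wellFormedWords_iff_isChain {w : FreeSemigroup (WFLetter S)} :
    w ∈ wellFormedWords S ↔ w.head.left = none ∧ (letters w).IsChain WFLetter.Compat ∧
      ∀ a ∈ (letters w).getLast?, a.right = none := by
  obtain ⟨a, l⟩ := w
  simp only [wellFormedWords, letters, Set.mem_ofPred_eq, List.cons.injEq]
  constructor
  · rintro (⟨s, rfl, rfl⟩ | ⟨s, f, l, ⟨rfl, rfl⟩, h⟩)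
    · simp [WFLetter.left, WFLetter.right]
    · obtain ⟨⟨b, l, rfl, hb⟩, h1, h2⟩ := isWFTail_iff.1 h
      exact ⟨rfl, List.isChain_cons_cons.2 ⟨⟨f, rfl, hb⟩, h1⟩, by simpa using h2⟩
  · rintro ⟨h1, h2, h3⟩
    cases l with
    | nil => cases a <;> simp_all [WFLetter.left, WFLetter.right]
    | cons b l =>
      obtain ⟨⟨f, hf, hb⟩, h2⟩ := List.isChain_cons_cons.1 h2
      have := isWFTail_iff.2 ⟨⟨b, l, rfl, hb⟩, h2, by simpa using h3⟩
      cases a with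
      | mid e' s f' => cases h1
      | first s f' =>
        obtain rfl := Option.some.inj hf
        exact .inr ⟨s, f', _, ⟨rfl, rfl⟩, this⟩
      | last e' s => cases h1
      | single s => cases hf

/-- The conditions mention only labels and `<`, each in the form `∀∃` or `∀∀∃`; this is what puts
well-formedness into `Π₂(<)`. -/
theorem mem_wellFormedWords_iff {w : FreeSemigroup (WFLetter S)} :
    w ∈ wellFormedWords S ↔
      (∀ p : Pos w, (∀ z, ¬ z < p) → ((letters w).get p).left = none) ∧
      (∀ p : Pos w, (∀ z, ¬ p < z) → ((letters w).get p).right = none) ∧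
      ∀ p q : Pos w, p < q → (¬ ∃ z, p < z ∧ z < q) →
        ((letters w).get p).Compat ((letters w).get q) := by
  rw [mem_wellFormedWords_iff_isChain]
  have hpos : 0 < (letters w).length := by simp [letters]
  have hlast : (letters w).getLast? = some ((letters w).get ⟨(letters w).length - 1, by omega⟩) := by
    simp [List.getLast?_eq_getElem?]
  refine ⟨fun ⟨h1, h2, h3⟩ => ⟨fun p hp => ?_, fun p hp => ?_, fun p q hpq hz => ?_⟩,
    fun ⟨h1, h2, h3⟩ => ⟨h1 ⟨0, hpos⟩ fun z hz => by simp [Fin.lt_def] at hz, ?_, ?_⟩⟩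
  · have : p = ⟨0, hpos⟩ := by
      have := hp ⟨0, hpos⟩
      simp only [Fin.lt_def, Fin.ext_iff] at *; omega
    subst this; exact h1
  · refine h3 _ ?_
    have : p = ⟨(letters w).length - 1, by omega⟩ := by
      have := hp ⟨(letters w).length - 1, by omega⟩
      simp only [Fin.lt_def, Fin.ext_iff] at *; omega
    rw [hlast, this]; rfl
  · have hpq' : p.1 < q.1 := hpq
    have hq : q.1 = p.1 + 1 := by
      by_contra hne
      refine hz ⟨⟨p.1 + 1, by omega⟩, ?_, ?_⟩ <;> simp only [Fin.lt_def] at * <;> omega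
    have := List.isChain_iff_getElem.1 h2 p.1 (by omega)
    obtain ⟨q, hq'⟩ := q
    obtain rfl : q = p.1 + 1 := hq
    exact this
  · refine List.isChain_iff_getElem.2 fun i hi => ?_
    exact h3 ⟨i, by omega⟩ ⟨i + 1, hi⟩ (by simp [Fin.lt_def]) fun ⟨z, hz⟩ => by
      simp only [Fin.lt_def] at hz; omega
  · rw [hlast]
    intro a ha
    obtain rfl := Option.some.inj ha
    exact h2 _ fun z hz => by simp only [Fin.lt_def] at hz; omega

theorem Agree.label_eq {A X Y : Type*} [LinearOrder X] [LinearOrder Y] {P : Atom A → Prop}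
    {lab : X → A} {lab' : Y → A} {D : Finset ℕ} {ν : ℕ → X} {ν' : ℕ → Y}
    (h : Agree P lab lab' D ν ν') (hP : ∀ a x, P (.label a x)) {x : ℕ} (hx : x ∈ D) :
    lab (ν x) = lab' (ν' x) :=
  ((h (.label (lab (ν x)) x) (hP _ _) (by simpa [Atom.vars])).1 rfl).symm

theorem Agree.lt_iff {A X Y : Type*} [LinearOrder X] [LinearOrder Y] {P : Atom A → Prop}
    {lab : X → A} {lab' : Y → A} {D : Finset ℕ} {ν : ℕ → X} {ν' : ℕ → Y}
    (h : Agree P lab lab' D ν ν') {x y : ℕ} (hP : P (.lt x y)) (hx : x ∈ D) (hy : y ∈ D) :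
    ν x < ν y ↔ ν' x < ν' y :=
  h (.lt x y) hP (by simp [Atom.vars, Finset.insert_subset_iff, hx, hy])

/-- The set of well-formed words is closed under the game with two moves on the right followed by
one on the left. -/
theorem wellFormedWords_of_sim {P : Atom (WFLetter S) → Prop} (hl : ∀ a x, P (.label a x))
    (hlt : ∀ x y, P (.lt x y)) {w w' : FreeSemigroup (WFLetter S)} {ν : ℕ → Pos w}
    {ν' : ℕ → Pos w'} (h : WSim P {0, 1, 2} [{.all}, {.all}, {.ex}] ∅ ν ν')
    (hw : w ∈ wellFormedWords S) : w' ∈ wellFormedWords S := by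
  rw [mem_wellFormedWords_iff] at hw ⊢
  obtain ⟨w1, w2, w3⟩ := hw
  have H : ∀ p' q' : Pos w', ∃ p q : Pos w, (letters w).get p = (letters w').get p' ∧
      (letters w).get q = (letters w').get q' ∧ (p < q ↔ p' < q') ∧
      ∀ z, ∃ z', (p < z ↔ p' < z') ∧ (z < p ↔ z' < p') ∧ (z < q ↔ z' < q') := by
    intro p' q'
    obtain ⟨p, hp⟩ := h.2.2 rfl 0 (by simp) p'
    obtain ⟨q, hq⟩ := hp.2.2 rfl 1 (by simp) q'
    refine ⟨p, q, ?_, ?_, ?_, fun z => ?_⟩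
    · simpa using hq.1.label_eq hl (x := 0) (by simp)
    · simpa using hq.1.label_eq hl (x := 1) (by simp)
    · simpa using hq.1.lt_iff (hlt 0 1) (by simp) (by simp)
    · obtain ⟨z', hz⟩ := hq.2.1 rfl 2 (by simp) z
      exact ⟨z', by simpa using hz.agree.lt_iff (hlt 0 2) (by simp) (by simp),
        by simpa using hz.agree.lt_iff (hlt 2 0) (by simp) (by simp),
        by simpa using hz.agree.lt_iff (hlt 2 1) (by simp) (by simp)⟩
  refine ⟨fun p' hp' => ?_, fun p' hp' => ?_, fun p' q' hpq hz => ?_⟩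
  · obtain ⟨p, q, e1, e2, -, hz⟩ := H p' p'
    rw [← e1]
    refine w1 p fun z hzp => ?_
    obtain ⟨z', h1, h2, h3⟩ := hz z
    exact hp' z' (h2.1 hzp)
  · obtain ⟨p, q, e1, e2, -, hz⟩ := H p' p'
    rw [← e1]
    refine w2 p fun z hzp => ?_
    obtain ⟨z', h1, h2, h3⟩ := hz z
    exact hp' z' (h1.1 hzp)
  · obtain ⟨p, q, e1, e2, e3, hz'⟩ := H p' q'
    rw [← e1, ← e2]
    refine w3 p q (e3.2 hpq) fun ⟨z, hz1, hz2⟩ => ?_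
    obtain ⟨z', h1, h2, h3⟩ := hz' z
    exact hz ⟨z', h1.1 hz1, h3.1 hz2⟩

end WellFormed

/-- The three moves `∀∀∃` form a list of level `Π₂`. They fit into `Σₙ` for `n ≥ 3` after an empty
existential block, and into `BΣₙ` for `n ≥ 2` through its universal half. -/
theorem weakDefinable_wellFormedWords {F : Fragment} (hF : F.AbovePiTwo) (T : Type*)
    [Semigroup T] [Finite T] : F.WeakDefinable (wellFormedWords T) := by
  have pi : ∀ n, IsMoveLevel .all (n + 2) [{.all}, {.all}, {.ex}] := fun n =>
    .cons (.cons (.alternate (by simp) (.cons (.nil _ _))))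
  refine Fragment.weakDefinable_iff.2 ⟨{({0, 1, 2}, [{.all}, {.all}, {.ex}])},
    Set.finite_singleton _, ?_, fun {w w'} h => wellFormedWords_of_sim
      (P := F.WeakAtom) (fun _ _ => trivial) (fun _ _ => ?_) (h _ rfl)⟩
  · rintro _ rfl
    cases F with
    | foEq => exact hF.elim
    | foTwo => exact hF.elim
    | sigma n hn =>
      obtain ⟨n, rfl⟩ := Nat.exists_eq_add_of_le' (show 3 ≤ n from hF)
      exact .alternate (by simp) (pi n)
    | pi n hn =>
      obtain ⟨n, rfl⟩ := Nat.exists_eq_add_of_le' (show 2 ≤ n from hF)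
      exact pi n
    | bsigma n hn =>
      obtain ⟨n, rfl⟩ := Nat.exists_eq_add_of_le' (show 2 ≤ n from hF)
      exact .inr (pi n)
  · cases F <;> first | exact hF.elim | trivial

end WordLogic
namespace WordLogic

/-! Interpretation of a structure in another one, and windows around a position. -/

/-- If the elements of `X` are the elements of `Y` satisfying a condition that, like the label in
`X`, is determined by the remaining game, then duplicator wins on `X`. -/
theorem Sim.interpret {F : Fragment} {A B X X' Y Y' : Type*} [LinearOrder X] [LinearOrder X']
    [LinearOrder Y] [LinearOrder Y'] {lab : X → B} {lab' : X' → B} {labY : Y → A}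
    {labY' : Y' → A} {V V' : Finset ℕ} {tail : List (Set Quant)} (f : X ↪o Y) (f' : X' ↪o Y')
    (hV : V ⊆ V') :
    ∀ (q : List (Set Quant)) (_ : ∀ (q' : List (Set Quant)) (D : Finset ℕ) (ν : ℕ → Y)
      (ν' : ℕ → Y'), q' <:+ q → Sim F.StrongAtom labY labY' V' (q' ++ tail) D ν ν' → ∀ x ∈ D,
      (ν x ∈ Set.range f ↔ ν' x ∈ Set.range f') ∧
      ∀ i i', ν x = f i → ν' x = f' i' → lab i = lab' i')
    (D : Finset ℕ) (ν : ℕ → X) (ν' : ℕ → X'),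
    Sim F.StrongAtom labY labY' V' (q ++ tail) D (f ∘ ν) (f' ∘ ν') →
      Sim F.WeakAtom lab lab' V q D ν ν' := by
  have agree : ∀ (q : List (Set Quant)) (_ : ∀ (q' : List (Set Quant)) (D : Finset ℕ) (ν : ℕ → Y)
      (ν' : ℕ → Y'), q' <:+ q → Sim F.StrongAtom labY labY' V' (q' ++ tail) D ν ν' → ∀ x ∈ D,
      (ν x ∈ Set.range f ↔ ν' x ∈ Set.range f') ∧
      ∀ i i', ν x = f i → ν' x = f' i' → lab i = lab' i')
      (D : Finset ℕ) (ν : ℕ → X) (ν' : ℕ → X'),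
      Sim F.StrongAtom labY labY' V' (q ++ tail) D (f ∘ ν) (f' ∘ ν') →
      Agree F.WeakAtom lab lab' D ν ν' := by
    intro q H D ν ν' h a ha hD
    cases a with
    | label b x =>
      have hx : x ∈ D := by simpa [Atom.vars] using hD
      simp only [Atom.Holds, (H q D _ _ (List.suffix_refl _) h x hx).2 (ν x) (ν' x) rfl rfl]
    | eq x y => simpa [Atom.Holds] using h.agree (.eq x y) (.inl trivial) hD
    | lt x y => simpa [Atom.Holds] using h.agree (.lt x y) (.inl ha) hD
    | _ => exact ha.elim
  intro q
  induction q with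
  | nil => exact agree []
  | cons m q ih =>
    intro H D ν ν' h
    have H' := fun q' D ν ν' (hq : q' <:+ q) => H q' D ν ν' (hq.trans (List.suffix_cons m q))
    refine ⟨agree _ H D ν ν' h, fun hm x hx p => ?_, fun hm x hx p' => ?_⟩
    -- The move is played in `Y`. Membership in the range is preserved by the remaining game, so the
    -- answer comes from a point of `X'`.
    · obtain ⟨y, hy⟩ := h.2.1 hm x (hV hx) (f p)
      obtain ⟨p', rfl⟩ : y ∈ Set.range f' := by
        have := ((H' q _ _ _ (List.suffix_refl _) hy) x (Finset.mem_insert_self _ _)).1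
        simpa using this
      exact ⟨p', ih H' _ _ _ (by rwa [Function.comp_update, Function.comp_update])⟩
    · obtain ⟨y, hy⟩ := h.2.2 hm x (hV hx) (f' p')
      obtain ⟨p, rfl⟩ : y ∈ Set.range f := by
        have := ((H' q _ _ _ (List.suffix_refl _) hy) x (Finset.mem_insert_self _ _)).1
        simpa using this
      exact ⟨p, ih H' _ _ _ (by rwa [Function.comp_update, Function.comp_update])⟩

/-! ### Reading the letters around a position with successor moves -/

section Window

variable {A : Type*} {F : Fragment} {V : Finset ℕ} {w w' : FreeSemigroup A}

theorem sat_succ_iff {ν : ℕ → Pos w} {x y : ℕ} :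
    (Atom.succ x y : Atom A).Holds (letters w).get ν ↔ (ν y).1 = (ν x).1 + 1 := by
  have h2 := (ν y).2
  constructor
  · rintro ⟨h, hz⟩
    have h' : (ν x).1 < (ν y).1 := h
    by_contra hne
    exact hz ⟨⟨(ν x).1 + 1, by omega⟩, by simp [Fin.lt_def], by simp only [Fin.lt_def]; omega⟩
  · intro h
    refine ⟨by simp only [Fin.lt_def]; omega, fun ⟨z, hz⟩ => ?_⟩
    simp only [Fin.lt_def] at hz; omega

theorem sat_max_iff {ν : ℕ → Pos w} {x : ℕ} :
    (Atom.max x : Atom A).Holds (letters w).get ν ↔ (ν x).1 + 1 = (letters w).length := by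
  have h2 := (ν x).2
  constructor
  · intro h
    by_contra hne
    exact h ⟨(ν x).1 + 1, by omega⟩ (by simp [Fin.lt_def])
  · intro h z hz
    simp only [Fin.lt_def] at hz; omega

theorem sat_min_iff {ν : ℕ → Pos w} {x : ℕ} :
    (Atom.min x : Atom A).Holds (letters w).get ν ↔ (ν x).1 = 0 := by
  have h2 := (ν x).2
  constructor
  · intro h
    by_contra hne
    exact h ⟨0, by omega⟩ (by simp only [Fin.lt_def]; omega)
  · intro h z hz
    simp only [Fin.lt_def] at hz; omega

/-- A single move of either kind suffices: whichever side may be played, its successor position is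
chosen there, and the `succ` atom forces the answer to be the successor on the other side. The `max`
atom detects the end of the word. -/
theorem WSim.step_right {m : Set Quant} {q : List (Set Quant)} {D : Finset ℕ}
    {ν : ℕ → Pos w} {ν' : ℕ → Pos w'} (h : WSim F.StrongAtom V (m :: q) D ν ν')
    (hm : m.Nonempty) {x y : ℕ} (hx : x ∈ D) (hy : y ∈ V) (hxy : x ≠ y) :
    ((ν x).1 + 1 = (letters w).length ∧ (ν' x).1 + 1 = (letters w').length) ∨
    ∃ p p', p.1 = (ν x).1 + 1 ∧ p'.1 = (ν' x).1 + 1 ∧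
      WSim F.StrongAtom V q (insert y D) (Function.update ν y p) (Function.update ν' y p') := by
  have hmax := h.agree (.max x) (.inr trivial) (by simpa [Atom.vars])
  rw [sat_max_iff, sat_max_iff] at hmax
  by_cases hl : (ν x).1 + 1 = (letters w).length
  · exact .inl ⟨hl, hmax.1 hl⟩
  have hl' := mt hmax.2 hl
  have h1 := (ν x).2
  have h2 := (ν' x).2
  have succ : ∀ p p', WSim F.StrongAtom V q (insert y D) (Function.update ν y p)
      (Function.update ν' y p') → (p.1 = (ν x).1 + 1 ↔ p'.1 = (ν' x).1 + 1) := fun p p' hs => by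
    have := hs.agree (.succ x y) (.inr trivial) (by simp [Atom.vars, Finset.insert_subset_iff, hx])
    rw [sat_succ_iff, sat_succ_iff] at this
    simpa [hxy] using this
  right
  obtain ⟨_ | _, hc⟩ := hm
  · obtain ⟨p', hs⟩ := h.2.1 hc y hy ⟨(ν x).1 + 1, by omega⟩
    exact ⟨_, p', rfl, (succ _ _ hs).1 rfl, hs⟩
  · obtain ⟨p, hs⟩ := h.2.2 hc y hy ⟨(ν' x).1 + 1, by omega⟩
    exact ⟨p, _, (succ _ _ hs).2 rfl, rfl, hs⟩

theorem WSim.step_left {m : Set Quant} {q : List (Set Quant)} {D : Finset ℕ}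
    {ν : ℕ → Pos w} {ν' : ℕ → Pos w'} (h : WSim F.StrongAtom V (m :: q) D ν ν')
    (hm : m.Nonempty) {x y : ℕ} (hx : x ∈ D) (hy : y ∈ V) (hxy : x ≠ y) :
    ((ν x).1 = 0 ∧ (ν' x).1 = 0) ∨
    ∃ p p', (ν x).1 = p.1 + 1 ∧ (ν' x).1 = p'.1 + 1 ∧
      WSim F.StrongAtom V q (insert y D) (Function.update ν y p) (Function.update ν' y p') := by
  have hmin := h.agree (.min x) (.inr trivial) (by simpa [Atom.vars])
  rw [sat_min_iff, sat_min_iff] at hmin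
  by_cases hl : (ν x).1 = 0
  · exact .inl ⟨hl, hmin.1 hl⟩
  have hl' := mt hmin.2 hl
  have h1 := (ν x).2
  have h2 := (ν' x).2
  have succ : ∀ p p', WSim F.StrongAtom V q (insert y D) (Function.update ν y p)
      (Function.update ν' y p') → ((ν x).1 = p.1 + 1 ↔ (ν' x).1 = p'.1 + 1) := fun p p' hs => by
    have := hs.agree (.succ y x) (.inr trivial) (by simp [Atom.vars, Finset.insert_subset_iff, hx])
    rw [sat_succ_iff, sat_succ_iff] at this
    simpa [hxy] using this
  right
  obtain ⟨_ | _, hc⟩ := hm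
  · obtain ⟨p', hs⟩ := h.2.1 hc y hy ⟨(ν x).1 - 1, by omega⟩
    have e : (ν x).1 = (⟨(ν x).1 - 1, by omega⟩ : Pos w).1 + 1 := by simp only []; omega
    exact ⟨_, p', e, (succ _ _ hs).1 e, hs⟩
  · obtain ⟨p, hs⟩ := h.2.2 hc y hy ⟨(ν' x).1 - 1, by omega⟩
    have e : (ν' x).1 = (⟨(ν' x).1 - 1, by omega⟩ : Pos w').1 + 1 := by simp only []; omega
    exact ⟨p, _, (succ _ _ hs).2 e, e, hs⟩

theorem exists_other {V : Finset ℕ} (hV : {0, 1} ⊆ V) (x : ℕ) : ∃ y ∈ V, x ≠ y := by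
  by_cases hx : x = 0
  · exact ⟨1, hV (by simp), by omega⟩
  · exact ⟨0, hV (by simp), hx⟩

/-- Each step costs one move and names the next position by whichever of the variables `0` and `1`
differs from the current one. Two variables suffice, so the argument also covers `FO²`. -/
theorem WSim.right_window (hV : {0, 1} ⊆ V) :
    ∀ (k : ℕ) {q : List (Set Quant)} {D : Finset ℕ} {ν : ℕ → Pos w} {ν' : ℕ → Pos w'},
      WSim F.StrongAtom V q D ν ν' → k ≤ q.length → (∀ m ∈ q, m.Nonempty) → ∀ x ∈ D,
      ((letters w).drop (ν x).1).take k = ((letters w').drop (ν' x).1).take k := by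
  intro k
  induction k with
  | zero => simp
  | succ k ih =>
    intro q D ν ν' h hk hq x hx
    obtain _ | ⟨m, q⟩ := q
    · simp at hk
    obtain ⟨y, hy, hxy⟩ := exists_other hV x
    have hlab : (letters w)[(ν x).1] = (letters w')[(ν' x).1] :=
      h.agree.label_eq (fun _ _ => .inl trivial) hx
    rw [List.drop_eq_getElem_cons (ν x).2, List.drop_eq_getElem_cons (ν' x).2, List.take_succ_cons,
      List.take_succ_cons, hlab]
    congr 1
    obtain ⟨h1, h2⟩ | ⟨p, p', h1, h2, hs⟩ := h.step_right (hq m (by simp)) hx hy hxy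
    · rw [h1, h2]; simp
    · have := ih hs (by simpa using hk) (fun m hm => hq m (by simp [hm])) y
        (Finset.mem_insert_self _ _)
      simpa [h1, h2] using this

theorem WSim.left_window (hV : {0, 1} ⊆ V) :
    ∀ (k : ℕ) {q : List (Set Quant)} {D : Finset ℕ} {ν : ℕ → Pos w} {ν' : ℕ → Pos w'},
      WSim F.StrongAtom V q D ν ν' → k ≤ q.length → (∀ m ∈ q, m.Nonempty) → ∀ x ∈ D,
      ((letters w).take (ν x).1).reverse.take k = ((letters w').take (ν' x).1).reverse.take k := by
  intro k
  induction k with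
  | zero => simp
  | succ k ih =>
    intro q D ν ν' h hk hq x hx
    obtain _ | ⟨m, q⟩ := q
    · simp at hk
    obtain ⟨y, hy, hxy⟩ := exists_other hV x
    obtain ⟨h1, h2⟩ | ⟨p, p', h1, h2, hs⟩ := h.step_left (hq m (by simp)) hx hy hxy
    · simp [h1, h2]
    · have := ih hs (by simpa using hk) (fun m hm => hq m (by simp [hm])) y
        (Finset.mem_insert_self _ _)
      have hlab : (letters w)[p.1] = (letters w')[p'.1] := by
        simpa using hs.agree.label_eq (fun _ _ => .inl trivial) (Finset.mem_insert_self y D)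
      rw [h1, h2, List.take_succ_eq_append_getElem p.2, List.take_succ_eq_append_getElem p'.2,
        List.reverse_append, List.reverse_append]
      simp only [List.reverse_singleton, List.singleton_append, List.take_succ_cons, hlab]
      congr 1
      simpa using this

end Window

/-- Any number of moves can be appended without leaving the fragment: further rounds for `FO(=)` and
`FO²`, a longer last block for the alternation levels. -/
theorem Fragment.IsTest.exists_append {F : Fragment} {t : Finset ℕ × List (Set Quant)}
    (ht : F.IsTest t) (k : ℕ) : ∃ tail : List (Set Quant), tail.length = k ∧
      (∀ m ∈ t.2 ++ tail, m.Nonempty) ∧ F.IsTest (t.1 ∪ {0, 1}, t.2 ++ tail) := by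
  have level : ∀ (c : Quant) (n : ℕ), 1 ≤ n → IsMoveLevel c n t.2 →
      ∃ tail : List (Set Quant), tail.length = k ∧
      (∀ m ∈ t.2 ++ tail, m.Nonempty) ∧ IsMoveLevel c n (t.2 ++ tail) := by
    intro c n hn h
    obtain ⟨d, hd⟩ := h.exists_append hn
    exact ⟨_, List.length_replicate, (hd k).nonempty_of_mem, hd k⟩
  have univ : ∀ r, t.2 = List.replicate r Set.univ → ∃ tail : List (Set Quant), tail.length = k ∧
      (∀ m ∈ t.2 ++ tail, m.Nonempty) ∧ ∃ r, t.2 ++ tail = List.replicate r Set.univ := by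
    intro r hr
    refine ⟨List.replicate k Set.univ, List.length_replicate, ?_, r + k, ?_⟩ <;> rw [hr]
    · intro m hm
      rw [← List.replicate_add] at hm
      rw [List.eq_of_mem_replicate hm]
      exact ⟨.ex, trivial⟩
    · rw [List.replicate_add]
  cases F with
  | foEq =>
    obtain ⟨r, hr⟩ := ht
    exact univ r hr
  | foTwo =>
    obtain ⟨h, r, hr⟩ := ht
    obtain ⟨tail, h1, h2, h3⟩ := univ r hr
    exact ⟨tail, h1, h2, Finset.union_subset h subset_rfl, h3⟩
  | sigma n hn => exact level _ n hn ht
  | pi n hn => exact level _ n hn ht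
  | bsigma n hn =>
    obtain ht | ht := ht
    · obtain ⟨tail, h1, h2, h3⟩ := level _ n hn ht
      exact ⟨tail, h1, h2, .inl h3⟩
    · obtain ⟨tail, h1, h2, h3⟩ := level _ n hn ht
      exact ⟨tail, h1, h2, .inr h3⟩

end WordLogic
namespace WordLogic

/-! The canonical well-formed word of a word. -/

/-- Values are computed in `WithOne S` so that empty prefixes and missing idempotents can be treated
as `1`. -/
theorem coe_map_eq_prod {A S : Type*} [Semigroup S] (α : FreeSemigroup A →ₙ* S)
    (w : FreeSemigroup A) :
    (α w : WithOne S) = ((letters w).map fun a => (α (FreeSemigroup.of a) : WithOne S)).prod := by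
  obtain ⟨a, l⟩ := w
  simp only [letters]
  induction l generalizing a with
  | nil => simp [FreeSemigroup.of]
  | cons b l ih =>
    have : (⟨a, b :: l⟩ : FreeSemigroup A) = FreeSemigroup.of a * ⟨b, l⟩ := rfl
    rw [this, map_mul, WithOne.coe_mul, ih b]
    simp only [List.map_cons, List.prod_cons]

section Encode

open Fragment (origin)

variable {A S : Type*} [Semigroup S] (α : FreeSemigroup A →ₙ* S)

/-- The value of a possibly empty word. -/
def listValue (l : List A) : WithOne S :=
  (l.map fun a => (α (FreeSemigroup.of a) : WithOne S)).prod

theorem listValue_append (l l' : List A) :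
    listValue α (l ++ l') = listValue α l * listValue α l' := by simp [listValue]

@[simp] theorem listValue_nil : listValue α [] = 1 := rfl

theorem listValue_cons (a : A) (l : List A) :
    listValue α (a :: l) = α (FreeSemigroup.of a) * listValue α l := by simp [listValue]

theorem coe_map_mk (a : A) (l : List A) :
    ((α ⟨a, l⟩ : S) : WithOne S) = listValue α (a :: l) := coe_map_eq_prod α ⟨a, l⟩

open Classical in
/-- An idempotent that stabilizes on the right the value of some word whose reverse is a prefix
of `u`, if there is one. -/
noncomputable def stabilizer (u : List A) : Option (Idem S) :=
  if h : ∃ e : Idem S, ∃ v, v <+: u ∧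
    listValue α v.reverse * (e.1 : S) = listValue α v.reverse then some h.choose else none

/-- The adjoined unit is not fixed by any idempotent of `S`, so the first letter of a word gets no
idempotent on its left. -/
theorem stabilizer_nil : stabilizer α [] = none := by
  rw [stabilizer, dif_neg]
  rintro ⟨e, v, hv, h⟩
  rw [List.prefix_nil.1 hv] at h
  simp at h

/-- An idempotent fixing the value of a suffix on the right fixes, by associativity, the value of
the whole prefix. Looking at a bounded window is therefore enough. -/
theorem mul_stabilizer {u : List A} {k : ℕ} {e : Idem S} (h : stabilizer α (u.take k) = some e) :
    listValue α u.reverse * (e.1 : S) = listValue α u.reverse := by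
  rw [stabilizer] at h
  split_ifs at h with hex
  obtain ⟨v, hv, he⟩ := hex.choose_spec
  rw [Option.some.inj h] at he
  obtain ⟨v', rfl⟩ := hv.trans (List.take_prefix _ _)
  rw [List.reverse_append, listValue_append, mul_assoc, he]

/-- Among the `|S| + 1` nonempty prefixes of `t` two have the same value, so this value `s`
satisfies `s * x = s` for some `x`. The set of such `x` is a nonempty finite subsemigroup and
contains an idempotent. The stabilized word lies inside `t`, hence `c` plays no role. -/
theorem exists_stabilizer [Finite S] {t : List A} (ht : t.length = Nat.card S + 1) (c : List A) :
    ∃ j < t.length, (stabilizer α (((t.take j).reverse ++ c).take (Nat.card S))).isSome := by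
  obtain _ | ⟨a, t⟩ := t
  · simp at ht
  have := Fintype.ofFinite S
  obtain ⟨i, j, hij, he⟩ : ∃ i j : Fin (Nat.card S + 1), i < j ∧
      α ⟨a, t.take i⟩ = α ⟨a, t.take j⟩ := by
    obtain ⟨i, j, hij, he⟩ := Fintype.exists_ne_map_eq_of_card_lt
      (fun i : Fin (Nat.card S + 1) => α ⟨a, t.take i⟩) (by simp [Nat.card_eq_fintype_card])
    obtain h | h := hij.lt_or_gt
    exacts [⟨i, j, h, he⟩, ⟨j, i, h, he.symm⟩]
  have hlen : t.length = Nat.card S := by simpa using ht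
  have hj := j.2
  have hij' : i.1 < j.1 := hij
  obtain ⟨b, l, hbl⟩ : ∃ b l, (t.take j).drop i = b :: l := by
    refine List.exists_cons_of_length_pos ?_
    rw [List.length_drop, List.length_take]; omega
  have hsplit : t.take j = t.take i ++ b :: l := by
    rw [← hbl]
    conv_lhs => rw [← List.take_append_drop i.1 (t.take j)]
    rw [List.take_take, min_eq_left hij'.le]
  have hstab : α ⟨a, t.take i⟩ * α ⟨b, l⟩ = α ⟨a, t.take i⟩ := by
    rw [← map_mul]
    conv_rhs => rw [he, hsplit]
    rfl
  -- The existence of an idempotent is taken from the compact case, with the discrete topology.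
  let _ : TopologicalSpace S := ⊥
  have : DiscreteTopology S := ⟨rfl⟩
  obtain ⟨e, he, hee⟩ := exists_idempotent_in_compact_subsemigroup (M := S)
    (fun _ => continuous_of_discreteTopology) {x | α ⟨a, t.take i⟩ * x = α ⟨a, t.take i⟩}
    ⟨_, hstab⟩ (Set.toFinite _).isCompact
    (fun x hx y hy => by
      change _ * (x * y) = _
      rw [← mul_assoc, hx, hy])
  -- As `i < j ≤ |S|`, the stabilized prefix of `i + 1` letters fits into a window of length `|S|`.
  refine ⟨i + 1, by simp only [List.length_cons]; omega, ?_⟩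
  rw [stabilizer, dif_pos]
  · rfl
  refine ⟨⟨e, hee⟩, ((a :: t).take (i + 1)).reverse, ?_, ?_⟩
  · refine List.prefix_take_iff.2 ⟨List.prefix_append _ _, ?_⟩
    rw [List.length_reverse, List.length_take]; omega
  · rw [List.reverse_reverse, List.take_succ_cons, ← coe_map_mk, ← WithOne.coe_mul, he]

/-- Reads the letters of a word until a stabilizing idempotent shows up, and returns the value
read so far together with this idempotent. The first argument is the reverse of the prefix read
before. -/
noncomputable def scan (c : List A) (s : S) : List A → S × Option (Idem S)
  | [] => (s, none)
  | b :: r => match stabilizer α (c.take (Nat.card S)) with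
    | some e => (s, some e)
    | none => scan (b :: c) (s * α (FreeSemigroup.of b)) r

/-- The letter with the given left idempotent, element, and right idempotent. -/
def WFLetter.build : Option (Idem S) → S × Option (Idem S) → WFLetter S
  | some e, (s, some f) => mid e s f
  | some e, (s, none) => last e s
  | none, (s, some f) => first s f
  | none, (s, none) => single s

theorem take_cons_congr {c c' : List A} {k : ℕ} (h : c.take k = c'.take k) (b : A) :
    (b :: c).take k = (b :: c').take k := by
  cases k with
  | zero => rfl
  | succ k =>
    rw [List.take_succ_cons, List.take_succ_cons]
    have := congrArg (List.take k) h
    rw [List.take_take, List.take_take, min_eq_left (by omega)] at this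
    rw [this]

/-- Once a stabilizing idempotent shows up within `t`, what comes after `t` is never read. -/
theorem scan_append_congr {r r' : List A} :
    ∀ {t c c' : List A} {s : S}, c.take (Nat.card S) = c'.take (Nat.card S) →
      (r = r' ∨ ∃ j < t.length,
        (stabilizer α (((t.take j).reverse ++ c).take (Nat.card S))).isSome) →
      scan α c s (t ++ r) = scan α c' s (t ++ r') := by
  have same : ∀ {r c c' : List A} {s : S}, c.take (Nat.card S) = c'.take (Nat.card S) →
      scan α c s r = scan α c' s r := by
    intro r
    induction r with
    | nil => intros; rfl
    | cons b r ih =>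
      intro c c' s h
      rw [scan, scan, h]
      split
      · rfl
      · exact ih (take_cons_congr h b)
  intro t
  induction t with
  | nil =>
    rintro c c' s h (rfl | ⟨j, hj, -⟩)
    · exact same h
    · simp at hj
  | cons b t ih =>
    intro c c' s h hj
    rw [List.cons_append, List.cons_append, scan, scan, ← h]
    cases hst : stabilizer α (c.take (Nat.card S)) with
    | some e => rfl
    | none =>
      refine ih (take_cons_congr h b) (hj.imp id ?_)
      rintro ⟨_ | j, hj, hs⟩
      · simp [hst] at hs
      · exact ⟨j, by simpa using hj, by simpa using hs⟩

/-- The scan is local: it reads at most `|S| + 1` letters and consults only the `|S|` letters before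
its current point. If `r` is shorter than this bound, agreement of the windows forces `r = r'`. -/
theorem scan_congr [Finite S] {c c' r r' : List A} {s : S}
    (h : c.take (Nat.card S) = c'.take (Nat.card S))
    (hr : r.take (Nat.card S + 1) = r'.take (Nat.card S + 1)) :
    scan α c s r = scan α c' s r' := by
  rw [← List.take_append_drop (Nat.card S + 1) r, ← List.take_append_drop (Nat.card S + 1) r', ← hr]
  refine scan_append_congr α h ?_
  by_cases hl : Nat.card S + 1 ≤ r.length
  · exact .inr (exists_stabilizer α (by rw [List.length_take, min_eq_left hl]) c)
  · left
    have := congrArg List.length hr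
    rw [List.length_take, List.length_take] at this
    rw [List.drop_eq_nil_of_le (by omega), List.drop_eq_nil_of_le (by omega)]

/-- The letter associated with a position, given the reverse of the prefix before it, the letter
at the position and the suffix after it. -/
noncomputable def letterAt (c : List A) (b : A) (r : List A) : WFLetter S :=
  .build (stabilizer α (c.take (Nat.card S))) (scan α (b :: c) (α (FreeSemigroup.of b)) r)

/-- The positions that are kept: the first one and those preceded by a stabilizing idempotent. -/
def IsKept (c : List A) : Prop :=
  c = [] ∨ (stabilizer α (c.take (Nat.card S))).isSome

open Classical in
/-- The kept positions with their letters. -/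
noncomputable def encode (c : List A) : List A → List (ℕ × WFLetter S)
  | [] => []
  | b :: r => if IsKept α c then (c.length, letterAt α c b r) :: encode (b :: c) r
    else encode (b :: c) r

theorem mem_encode {i : ℕ} {x : WFLetter S} {r c : List A} :
    (i, x) ∈ encode α c r ↔ ∃ r₁ b r₂, r = r₁ ++ b :: r₂ ∧ IsKept α (r₁.reverse ++ c) ∧
      i = c.length + r₁.length ∧ x = letterAt α (r₁.reverse ++ c) b r₂ := by
  induction r generalizing c with
  | nil => simp [encode]
  | cons a r ih =>
    have hsplit : (∃ r₁ b r₂, a :: r = r₁ ++ b :: r₂ ∧ IsKept α (r₁.reverse ++ c) ∧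
        i = c.length + r₁.length ∧ x = letterAt α (r₁.reverse ++ c) b r₂) ↔
        (IsKept α c ∧ (i, x) = (c.length, letterAt α c a r)) ∨ (i, x) ∈ encode α (a :: c) r := by
      rw [ih]
      constructor
      · rintro ⟨_ | ⟨b', r₁⟩, b, r₂, h, h1, h2, h3⟩
        · obtain ⟨rfl, rfl⟩ := List.cons.inj h
          exact .inl ⟨h1, Prod.ext h2 h3⟩
        · obtain ⟨rfl, rfl⟩ := List.cons.inj h
          refine .inr ⟨r₁, b, r₂, rfl, by simpa using h1, ?_, by simpa using h3⟩
          simp only [List.length_cons] at h2 ⊢; omega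
      · rintro (⟨h1, h⟩ | ⟨r₁, b, r₂, rfl, h1, h2, h3⟩)
        · obtain ⟨rfl, rfl⟩ := Prod.mk.inj h
          exact ⟨[], a, r, rfl, h1, rfl, rfl⟩
        · refine ⟨a :: r₁, b, r₂, rfl, by simpa using h1, ?_, by simpa using h3⟩
          simp only [List.length_cons] at h2 ⊢; omega
    rw [hsplit, encode]
    split_ifs with h <;> simp [h]

theorem encode_pairwise {r c : List A} : (encode α c r).Pairwise fun a b => a.1 < b.1 := by
  induction r generalizing c with
  | nil => simp [encode]
  | cons a r ih =>
    rw [encode]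
    split_ifs with h
    · refine List.pairwise_cons.2 ⟨?_, ih⟩
      rintro ⟨i, x⟩ hi
      obtain ⟨r₁, b, r₂, -, -, h2, -⟩ := (mem_encode α).1 hi
      simp only [List.length_cons] at h2 ⊢; omega
    · exact ih

theorem isKept_iff {c : List A} (hc : c ≠ []) :
    IsKept α c ↔ (stabilizer α (c.take (Nat.card S))).isSome := by simp [IsKept, hc]

/-- The scan stops exactly at the next kept position, with the idempotent computed there; so the
right idempotent of a letter is the left idempotent of the next one. A scan reaching the end means
that no kept position remains. The first position, kept without an idempotent, is excluded by `c ≠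
[]`. -/
theorem encode_wf {r c : List A} (hc : c ≠ []) (s : S) :
    match (scan α c s r).2 with
    | none => encode α c r = []
    | some e => IsWFTail e ((encode α c r).map Prod.snd) := by
  induction r generalizing c s with
  | nil => simp [scan, encode]
  | cons b r ih =>
    have ih' := ih (c := b :: c) (by simp)
    rw [scan, encode]
    cases hst : stabilizer α (c.take (Nat.card S)) with
    | none =>
      rw [if_neg (by simp [isKept_iff α hc, hst])]
      exact ih' _
    | some e =>
      rw [if_pos (by simp [isKept_iff α hc, hst])]
      have := ih' (α (FreeSemigroup.of b))
      simp only [List.map_cons, letterAt, hst]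
      generalize scan α (b :: c) (α (FreeSemigroup.of b)) r = so at this ⊢
      obtain ⟨s', _ | f⟩ := so
      · simp only at this
        rw [this]
        exact .last _ _
      · exact .mid _ _ _ this

/-- An optional idempotent as an element of the semigroup with a unit adjoined. -/
def optValue (o : Option (Idem S)) : WithOne S := o.elim 1 fun e => (e.1 : WithOne S)

theorem letterValue_build (o : Option (Idem S)) (so : S × Option (Idem S)) :
    ((letterValue (WFLetter.build o so) : S) : WithOne S) = optValue o * so.1 * optValue so.2 := by
  obtain ⟨s, _ | f⟩ := so <;> cases o <;>
    simp [WFLetter.build, letterValue, optValue, WithOne.coe_mul]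

/-- Here `t` is the value of what precedes the current block and `s` the value read in the block so
far. At a kept position the inserted `e` fixes the value of the whole prefix (`mul_stabilizer`), so
it does not change the product; this prefix then becomes the new `t`. -/
theorem prod_encode {r c : List A} (hc : c ≠ []) (s : S) (t : WithOne S)
    (hs : listValue α c.reverse = t * s) :
    t * (scan α c s r).1 * optValue (scan α c s r).2 *
      ((encode α c r).map fun x => ((letterValue x.2 : S) : WithOne S)).prod =
      listValue α c.reverse * listValue α r := by
  induction r generalizing c s t with
  | nil => simp [scan, encode, hs, optValue]
  | cons b r ih =>
    have hb : listValue α (b :: c).reverse = listValue α c.reverse * α (FreeSemigroup.of b) := by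
      rw [List.reverse_cons, listValue_append, listValue_cons, listValue_nil, mul_one]
    rw [scan, encode, listValue_cons]
    cases hst : stabilizer α (c.take (Nat.card S)) with
    | none =>
      rw [if_neg (by simp [isKept_iff α hc, hst])]
      simp only
      rw [ih (by simp) _ t (by rw [hb, hs, WithOne.coe_mul, mul_assoc]), hb, mul_assoc]
    | some e =>
      rw [if_pos (by simp [isKept_iff α hc, hst])]
      have := ih (c := b :: c) (by simp) (α (FreeSemigroup.of b)) _ hb
      rw [hb, mul_assoc (listValue α c.reverse) (α (FreeSemigroup.of b) : WithOne S)] at this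
      rw [← this]
      simp only [List.map_cons, List.prod_cons, letterAt, hst, letterValue_build, ← hs]
      have he := mul_stabilizer α hst
      simp only [optValue, Option.elim, ← mul_assoc, he]

/-- The canonical well-formed word of a word. -/
noncomputable def canonicalWord (w : FreeSemigroup A) : FreeSemigroup (WFLetter S) :=
  ⟨letterAt α [] w.head w.tail, (encode α [w.head] w.tail).map Prod.snd⟩

theorem encode_letters (w : FreeSemigroup A) : encode α [] (letters w) =
    (0, letterAt α [] w.head w.tail) :: encode α [w.head] w.tail := by
  rw [letters, encode, if_pos (.inl rfl)]; rfl

theorem letters_canonicalWord (w : FreeSemigroup A) :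
    letters (canonicalWord α w) = (encode α [] (letters w)).map Prod.snd := by
  rw [encode_letters]; rfl

theorem canonicalWord_mem (w : FreeSemigroup A) : canonicalWord α w ∈ wellFormedWords S := by
  have := encode_wf α (r := w.tail) (c := [w.head]) (by simp) (α (FreeSemigroup.of w.head))
  simp only [wellFormedWords, Set.mem_ofPred_eq, canonicalWord, letters, letterAt, List.take_nil,
    stabilizer_nil]
  generalize scan α [w.head] (α (FreeSemigroup.of w.head)) w.tail = so at this ⊢
  obtain ⟨s, _ | f⟩ := so
  · simp only at this
    rw [this]
    exact .inl ⟨s, rfl⟩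
  · exact .inr ⟨s, f, _, rfl, this⟩

theorem beta_eq_prod (w : FreeSemigroup (WFLetter S)) :
    (beta S w : WithOne S) = ((letters w).map fun x => ((letterValue x : S) : WithOne S)).prod :=
  coe_map_eq_prod (beta S) w

theorem beta_canonicalWord (w : FreeSemigroup A) : beta S (canonicalWord α w) = α w := by
  rw [← WithOne.coe_inj, beta_eq_prod, coe_map_eq_prod α w]
  have := prod_encode α (r := w.tail) (c := [w.head]) (by simp) (α (FreeSemigroup.of w.head)) 1
    (by simp [listValue])
  simp only [canonicalWord, letters, List.map_cons, List.prod_cons, letterAt, letterValue_build,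
    List.take_nil, stabilizer_nil, List.map_map]
  simpa [listValue, optValue, Function.comp_def] using this

/-- The position of a word that corresponds to a position of its canonical word. -/
noncomputable def keptPos (w : FreeSemigroup A) : Pos (canonicalWord α w) ↪o Pos w := by
  have hlen : (letters (canonicalWord α w)).length = (encode α [] (letters w)).length := by
    rw [letters_canonicalWord, List.length_map]
  refine OrderEmbedding.ofStrictMono (fun i =>
    ⟨((encode α [] (letters w))[i.1]'(Nat.lt_of_lt_of_eq i.2 hlen)).1, ?_⟩) ?_
  · obtain ⟨r₁, b, r₂, h, -, h2, -⟩ := (mem_encode α).1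
      (List.getElem_mem (l := encode α [] (letters w)) (Nat.lt_of_lt_of_eq i.2 hlen))
    refine lt_of_eq_of_lt h2 ?_
    rw [h]; simp
  · intro i j hij
    exact List.pairwise_iff_getElem.1 (encode_pairwise α) _ _ _ _ hij

theorem keptPos_val (w : FreeSemigroup A) (i : Pos (canonicalWord α w)) :
    ((keptPos α w i).1, (letters (canonicalWord α w)).get i) ∈ encode α [] (letters w) := by
  have hlen : (letters (canonicalWord α w)).length = (encode α [] (letters w)).length := by
    rw [letters_canonicalWord, List.length_map]
  have : ((keptPos α w i).1, (letters (canonicalWord α w)).get i) =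
      (encode α [] (letters w))[i.1]'(Nat.lt_of_lt_of_eq i.2 hlen) := by
    refine Prod.ext rfl ?_
    simp [letters_canonicalWord]
  rw [this]
  exact List.getElem_mem _

theorem keptPos_spec (w : FreeSemigroup A) (i : Pos (canonicalWord α w)) :
    (letters (canonicalWord α w)).get i =
      letterAt α ((letters w).take (keptPos α w i)).reverse ((letters w).get (keptPos α w i))
        ((letters w).drop (keptPos α w i + 1)) := by
  obtain ⟨r₁, b, r₂, h, -, h2, h3⟩ := (mem_encode α).1 (keptPos_val α w i)
  simp only [List.length_nil, zero_add, List.append_nil] at h2 h3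
  rw [h3]
  congr 1
  · rw [h2, h]; simp
  · simp [h2, h]
  · rw [h2, h]; simp [List.drop_append]

theorem mem_range_keptPos {w : FreeSemigroup A} {p : Pos w} :
    p ∈ Set.range (keptPos α w) ↔ IsKept α ((letters w).take p).reverse := by
  constructor
  · rintro ⟨i, rfl⟩
    obtain ⟨r₁, b, r₂, h, h1, h2, -⟩ := (mem_encode α).1 (keptPos_val α w i)
    simp only [List.length_nil, zero_add, List.append_nil] at h1 h2
    rwa [h2, h, List.take_left]
  · intro hp
    have hmem : (p.1, letterAt α ((letters w).take p).reverse ((letters w).get p)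
        ((letters w).drop (p + 1))) ∈ encode α [] (letters w) := by
      refine (mem_encode α).2 ⟨(letters w).take p, (letters w).get p, (letters w).drop (p + 1), ?_,
        by simpa using hp, by simp, by simp⟩
      simp
    obtain ⟨i, hi, h⟩ := List.getElem_of_mem hmem
    refine ⟨⟨i, by rw [letters_canonicalWord, List.length_map]; exact hi⟩, Fin.ext ?_⟩
    exact congrArg Prod.fst h

/-- The tail reads enough of the neighbourhood to decide whether a position is kept and which letter
it carries: `|S|` letters before it, the letter itself and `|S| + 1` letters after it.
`Sim.interpret` then applies along `keptPos`. -/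
theorem sim_canonicalWord [Finite S] {F : Fragment} {V V' : Finset ℕ} (hV : V ⊆ V')
    (hV' : {0, 1} ⊆ V') {q tail : List (Set Quant)} (hq : ∀ m ∈ q ++ tail, m.Nonempty)
    (htail : Nat.card S + 2 ≤ tail.length) {w w' : FreeSemigroup A}
    (h : WSim F.StrongAtom V' (q ++ tail) ∅ (origin w) (origin w')) :
    WSim F.WeakAtom V q ∅ (origin (canonicalWord α w)) (origin (canonicalWord α w')) := by
  refine Sim.interpret (labY := (letters w).get) (labY' := (letters w').get) (tail := tail)
    (keptPos α w) (keptPos α w') hV q ?_ ∅ _ _ ?_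
  · intro q' D ν ν' hq' hs x hx
    have hlen : Nat.card S + 2 ≤ (q' ++ tail).length := by rw [List.length_append]; omega
    have hne : ∀ m ∈ q' ++ tail, m.Nonempty := fun m hm => hq m <| by
      rw [List.mem_append] at hm ⊢
      exact hm.imp_left fun h => hq'.subset h
    have hl := WSim.left_window hV' _ hs hlen hne x hx
    have hr := WSim.right_window hV' _ hs hlen hne x hx
    have hl' : ((letters w).take (ν x)).reverse.take (Nat.card S) =
        ((letters w').take (ν' x)).reverse.take (Nat.card S) := by
      have := congrArg (List.take (Nat.card S)) hl
      simpa only [List.take_take, min_eq_left (show Nat.card S ≤ Nat.card S + 2 by omega)]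
    -- The first position is recognized because the window has nonzero length, even if `|S|` were
    -- `0`.
    have hnil : ((letters w).take (ν x)).reverse = [] ↔
        ((letters w').take (ν' x)).reverse = [] := by
      have := congrArg (· = []) hl
      simpa only [List.take_eq_nil_iff, Nat.add_eq_zero_iff, OfNat.ofNat_ne_zero, and_false,
        false_or, eq_iff_iff] using this
    rw [List.drop_eq_getElem_cons (ν x).2, List.drop_eq_getElem_cons (ν' x).2, List.take_succ_cons,
      List.take_succ_cons] at hr
    obtain ⟨hb, hr⟩ := List.cons.inj hr
    refine ⟨?_, fun i i' hi hi' => ?_⟩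
    · rw [mem_range_keptPos, mem_range_keptPos, IsKept, IsKept, hnil, hl']
    · rw [keptPos_spec, keptPos_spec, ← hi, ← hi', letterAt, letterAt, hl']
      simp only [List.get_eq_getElem, hb]
      rw [scan_congr α (take_cons_congr hl' _) hr]
  · have : ∀ w : FreeSemigroup A, keptPos α w ∘ origin (canonicalWord α w) = origin w := fun w => by
      funext n
      refine Fin.ext ?_
      change ((encode α [] (letters w))[0]'_).1 = 0
      simp [encode_letters]
    rwa [this, this]

/-- The tests for `𝕃`, lengthened by `|S| + 2` moves, are tests for `L`: they transfer to canonical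
words, on which `β` takes the values of `α`, and membership in `L` depends only on `α`. -/
theorem strongDefinable_of_associatedLanguage [Finite A] [Finite S] {F : Fragment}
    {L : Set (FreeSemigroup A)} (hL : Recognizes α L)
    (h : F.WeakDefinable (associatedLanguage α L)) : F.StrongDefinable L := by
  obtain ⟨T, hT, hT', hs⟩ := Fragment.weakDefinable_iff.1 h
  choose! tail h1 h2 h3 using fun t ht =>
    Fragment.IsTest.exists_append (hT' t ht) (Nat.card S + 2)
  refine Fragment.strongDefinable_iff.2 ⟨(fun t => (t.1 ∪ {0, 1}, t.2 ++ tail t)) '' T,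
    hT.image _, ?_, fun {w w'} hw hwL => ?_⟩
  · rintro _ ⟨t, ht, rfl⟩
    exact h3 t ht
  · obtain ⟨P, rfl⟩ := hL
    have := hs (w := canonicalWord α w) (w' := canonicalWord α w') (fun t ht =>
      sim_canonicalWord α Finset.subset_union_left Finset.subset_union_right (h2 t ht)
        (h1 t ht).ge (hw _ ⟨t, ht, rfl⟩))
      ⟨canonicalWord_mem α w, by rw [beta_canonicalWord]; exact ⟨w, hwL, rfl⟩⟩
    obtain ⟨w₀, hw₀, he⟩ := this.2
    rw [beta_canonicalWord] at he
    rw [Set.mem_preimage, ← he]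
    exact hw₀

end Encode

end WordLogic
namespace WordLogic

/-! Back-and-forth systems and composition of games. -/

section BackAndForth

variable {A X Y : Type*} [LinearOrder X] [LinearOrder Y] {P : Atom A → Prop} {lab : X → A}
  {lab' : Y → A}

/-- The truth of `succ`, `min` and `max` depends on whether there is a point in a given order
position relative to the assigned ones, hence is preserved as soon as one more point can be matched
on either side. -/
theorem agree_of_extension {D : Finset ℕ} {ν : ℕ → X} {ν' : ℕ → Y}
    (hlab : ∀ x ∈ D, lab (ν x) = lab' (ν' x))
    (hlt : ∀ x ∈ D, ∀ y ∈ D, ν x < ν y ↔ ν' x < ν' y)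
    (forth : ∀ p, ∃ p', ∀ y ∈ D, (ν y < p ↔ ν' y < p') ∧ (p < ν y ↔ p' < ν' y))
    (back : ∀ p', ∃ p, ∀ y ∈ D, (ν y < p ↔ ν' y < p') ∧ (p < ν y ↔ p' < ν' y)) :
    Agree P lab lab' D ν ν' := by
  intro a _ ha
  cases a with
  | label a x => simp only [Atom.Holds, hlab x (by simpa [Atom.vars] using ha)]
  | eq x y =>
    have hx : x ∈ D := ha (by simp [Atom.vars])
    have hy : y ∈ D := ha (by simp [Atom.vars])
    simp only [Atom.Holds, le_antisymm_iff, ← not_lt, hlt x hx y hy, hlt y hy x hx]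
  | lt x y => exact hlt x (ha (by simp [Atom.vars])) y (ha (by simp [Atom.vars]))
  | succ x y =>
    have hx : x ∈ D := ha (by simp [Atom.vars])
    have hy : y ∈ D := ha (by simp [Atom.vars])
    refine and_congr (hlt x hx y hy) (not_congr ⟨?_, ?_⟩)
    · rintro ⟨z, h1, h2⟩
      obtain ⟨z', hz⟩ := forth z
      exact ⟨z', (hz x hx).1.1 h1, (hz y hy).2.1 h2⟩
    · rintro ⟨z', h1, h2⟩
      obtain ⟨z, hz⟩ := back z'
      exact ⟨z, (hz x hx).1.2 h1, (hz y hy).2.2 h2⟩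
  | min x =>
    have hx : x ∈ D := by simpa [Atom.vars] using ha
    constructor
    · intro h z' hz'
      obtain ⟨z, hz⟩ := back z'
      exact h z ((hz x hx).2.2 hz')
    · intro h z hz
      obtain ⟨z', hz'⟩ := forth z
      exact h z' ((hz' x hx).2.1 hz)
  | max x =>
    have hx : x ∈ D := by simpa [Atom.vars] using ha
    constructor
    · intro h z' hz'
      obtain ⟨z, hz⟩ := back z'
      exact h z ((hz x hx).1.2 hz')
    · intro h z hz
      obtain ⟨z', hz'⟩ := forth z
      exact h z' ((hz' x hx).1.1 hz)

/-- A back-and-forth system yields a winning strategy in all games. -/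
theorem sim_of_backAndForth (I : ℕ → Finset ℕ → (ℕ → X) → (ℕ → Y) → Prop)
    (hlab : ∀ r D ν ν', I r D ν ν' → ∀ x ∈ D, lab (ν x) = lab' (ν' x))
    (hlt : ∀ r D ν ν', I r D ν ν' → ∀ x ∈ D, ∀ y ∈ D, ν x < ν y ↔ ν' x < ν' y)
    (forth : ∀ r D ν ν', I (r + 1) D ν ν' → ∀ x p, ∃ p',
      I r (insert x D) (Function.update ν x p) (Function.update ν' x p'))
    (back : ∀ r D ν ν', I (r + 1) D ν ν' → ∀ x p', ∃ p,
      I r (insert x D) (Function.update ν x p) (Function.update ν' x p'))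
    (V : Finset ℕ) :
    ∀ (q : List (Set Quant)) (r : ℕ) (D : Finset ℕ) (ν : ℕ → X) (ν' : ℕ → Y), q.length < r →
      I r D ν ν' → Sim P lab lab' V q D ν ν' := by
  have agree : ∀ r D ν ν', I (r + 1) D ν ν' → Agree P lab lab' D ν ν' := by
    intro r D ν ν' h
    -- One spare round, played with a fresh variable, supplies the extensions needed for the
    -- enriched atoms; hence the strict bound `q.length < r` below.
    obtain ⟨z, hz⟩ := Infinite.exists_notMem_finset D
    have ext : ∀ p p', I r (insert z D) (Function.update ν z p) (Function.update ν' z p') →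
        ∀ y ∈ D, (ν y < p ↔ ν' y < p') ∧ (p < ν y ↔ p' < ν' y) := by
      intro p p' h y hy
      have hyz : y ≠ z := fun h => hz (h ▸ hy)
      have h1 := hlt _ _ _ _ h y (Finset.mem_insert_of_mem hy) z (Finset.mem_insert_self _ _)
      have h2 := hlt _ _ _ _ h z (Finset.mem_insert_self _ _) y (Finset.mem_insert_of_mem hy)
      simp only [Function.update_self, Function.update_of_ne hyz] at h1 h2
      exact ⟨h1, h2⟩
    exact agree_of_extension (hlab _ _ _ _ h) (hlt _ _ _ _ h)
      (fun p => (forth _ _ _ _ h z p).imp fun p' hp => ext p p' hp)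
      (fun p' => (back _ _ _ _ h z p').imp fun p hp => ext p p' hp)
  intro q
  induction q with
  | nil =>
    intro r D ν ν' hr h
    obtain ⟨r, rfl⟩ := Nat.exists_eq_add_of_lt hr
    exact agree _ _ _ _ h
  | cons m q ih =>
    intro r D ν ν' hr h
    obtain ⟨r, rfl⟩ := Nat.exists_eq_add_of_lt hr
    refine ⟨agree _ _ _ _ h, fun _ x _ p => ?_, fun _ x _ p' => ?_⟩
    · obtain ⟨p', hp⟩ := forth _ _ _ _ h x p
      exact ⟨p', ih _ _ _ _ (by simp only [List.length_cons]; omega) hp⟩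
    · obtain ⟨p, hp⟩ := back _ _ _ _ h x p'
      exact ⟨p, ih _ _ _ _ (by simp only [List.length_cons]; omega) hp⟩

theorem Sim.trans {Z : Type*} [LinearOrder Z] {lab'' : Z → A} {V : Finset ℕ} :
    ∀ {q : List (Set Quant)} {D : Finset ℕ} {ν : ℕ → X} {ν' : ℕ → Y} {ν'' : ℕ → Z},
      Sim P lab lab' V q D ν ν' → Sim P lab' lab'' V q D ν' ν'' →
        Sim P lab lab'' V q D ν ν'' := by
  intro q
  induction q with
  | nil => exact fun h h' a ha hD => (h a ha hD).trans (h' a ha hD)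
  | cons m q ih =>
    intro D ν ν' ν'' h h'
    refine ⟨fun a ha hD => (h.1 a ha hD).trans (h'.1 a ha hD), fun hm x hx p => ?_,
      fun hm x hx p'' => ?_⟩
    · obtain ⟨p', hp⟩ := h.2.1 hm x hx p
      obtain ⟨p'', hp'⟩ := h'.2.1 hm x hx p'
      exact ⟨p'', ih hp hp'⟩
    · obtain ⟨p', hp⟩ := h'.2.2 hm x hx p''
      obtain ⟨p, hp'⟩ := h.2.2 hm x hx p'
      exact ⟨p, ih hp' hp⟩

end BackAndForth

/-! Comparison of a long interval of integers with landmarks, and the lexicographic sum of copies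
of `ℤ` with their zeros as landmarks. -/

/-- A point `t` of the interval together with the element `(i, o)` of the lexicographic sum that
corresponds to it. -/
structure Match where
  t : ℤ
  i : ℕ
  o : ℤ

namespace Match

/-- The matched pairs have the same order and the same distance, up to the threshold `R`. -/
def Near (R : ℤ) (p q : Match) : Prop :=
  (p.i < q.i → p.t + R ≤ q.t) ∧ (q.i < p.i → q.t + R ≤ p.t) ∧
    (p.i = q.i → q.t - p.t = q.o - p.o ∨ (R ≤ q.t - p.t ∧ R ≤ q.o - p.o) ∨
      (R ≤ p.t - q.t ∧ R ≤ p.o - q.o))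

/-- `(i, o)` is an element of the sum of `n` copies of `ℤ`, without the negative elements of the
first and the positive ones of the last. -/
def IsCell (n : ℕ) (i : ℕ) (o : ℤ) : Prop :=
  i < n ∧ (o < 0 → 0 < i) ∧ (0 < o → i + 1 < n)

/-- The landmark of index `i`. -/
def landmark (M : ℤ) (i : ℕ) : Match := ⟨i * M, i, 0⟩

/-- A set of matches that contains the landmarks and preserves distances up to `R`. -/
structure IsSystem (n : ℕ) (M R : ℤ) (C : Set Match) : Prop where
  finite : C.Finite
  landmark_mem : ∀ i < n, landmark M i ∈ C
  isCell : ∀ p ∈ C, IsCell n p.i p.o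
  bounds : ∀ p ∈ C, 0 ≤ p.t ∧ p.t ≤ (n - 1 : ℕ) * M
  near : ∀ p ∈ C, ∀ q ∈ C, Near R p q

theorem Near.symm {R : ℤ} {p q : Match} (h : Near R p q) : Near R q p := by
  unfold Near at *; omega

theorem Near.refl {R : ℤ} (p : Match) : Near R p p := by
  unfold Near; omega

theorem Near.mono {R R' : ℤ} (hR : R' ≤ R) {p q : Match} (h : Near R p q) : Near R' p q := by
  unfold Near at *; omega

theorem landmark_near {M R : ℤ} (hM : R ≤ M) (i j : ℕ) (hR : 0 ≤ R) :
    Near R (landmark M i) (landmark M j) := by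
  have key : ∀ i j : ℕ, i < j → (i : ℤ) * M + R ≤ j * M := by
    intro i j hij
    have : ((i : ℤ) + 1) * M ≤ j * M :=
      mul_le_mul_of_nonneg_right (by exact_mod_cast hij) (hR.trans hM)
    linarith
  refine ⟨key i j, key j i, fun h => ?_⟩
  have h' : i = j := h
  subst h'
  left; simp

namespace IsSystem

variable {n : ℕ} {M R : ℤ} {C : Set Match}

theorem insert {p : Match} (h : IsSystem n M (2 * R) C) (hR : 1 ≤ R) (hp : IsCell n p.i p.o)
    (hb : 0 ≤ p.t ∧ p.t ≤ (n - 1 : ℕ) * M) (hn : ∀ q ∈ C, Near R q p) :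
    IsSystem n M R (insert p C) where
  finite := h.finite.insert p
  landmark_mem i hi := .inr (h.landmark_mem i hi)
  isCell q hq := by
    obtain rfl | hq := hq
    exacts [hp, h.isCell q hq]
  bounds q hq := by
    obtain rfl | hq := hq
    exacts [hb, h.bounds q hq]
  near q hq q' hq' := by
    obtain rfl | hq := hq <;> obtain rfl | hq' := hq'
    exacts [.refl _, (hn _ hq').symm, hn _ hq, (h.near _ hq _ hq').mono (by omega)]

/-- The new point lies between its matched neighbours `a` and `b`, which exist because both ends are
landmarks. Within distance `R` of one of them, the offset is copied from it. Otherwise the gap from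
`a` to `b` is at least `2 * R`, and the cell at distance `R` after that of `a` works. -/
theorem exists_cell (h : IsSystem n M (2 * R) C) (hR : 1 ≤ R) (hn : 0 < n) {t : ℤ} (ht : 0 ≤ t)
    (ht' : t ≤ (n - 1 : ℕ) * M) : ∃ i o, IsSystem n M R (Insert.insert ⟨t, i, o⟩ C) := by
  suffices H : ∃ i o, IsCell n i o ∧ ∀ q ∈ C, Near R q ⟨t, i, o⟩ by
    obtain ⟨i, o, h1, h2⟩ := H
    exact ⟨i, o, h.insert hR h1 ⟨ht, ht'⟩ h2⟩
  by_cases hex : ∃ p ∈ C, p.t = t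
  · obtain ⟨p, hp, rfl⟩ := hex
    exact ⟨p.i, p.o, h.isCell p hp, fun q hq => (h.near q hq p hp).mono (by omega)⟩
  push Not at hex
  have hfirst := h.landmark_mem 0 hn
  have hlast := h.landmark_mem (n - 1) (by omega)
  obtain ⟨a, ⟨haC, hat⟩, ha⟩ := Set.exists_max_image {p ∈ C | p.t < t} Match.t
    (h.finite.subset fun p hp => hp.1)
    ⟨_, hfirst, lt_of_le_of_ne (by simpa [landmark] using ht) (hex _ hfirst)⟩
  obtain ⟨b, ⟨hbC, hbt⟩, hb⟩ := Set.exists_min_image {p ∈ C | t < p.t} Match.t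
    (h.finite.subset fun p hp => hp.1)
    ⟨_, hlast, lt_of_le_of_ne ht' (hex _ hlast).symm⟩
  have hside : ∀ q ∈ C, q.t ≤ a.t ∨ b.t ≤ q.t := fun q hq => by
    obtain hlt | hlt := (hex q hq).lt_or_gt
    exacts [.inl (ha q ⟨hq, hlt⟩), .inr (hb q ⟨hq, hlt⟩)]
  have hab := h.near a haC b hbC
  have hac := h.isCell a haC
  have hbc := h.isCell b hbC
  have haf := h.near _ haC _ hfirst
  have hal := h.near _ haC _ hlast
  have hbf := h.near _ hbC _ hfirst
  simp only [Near, IsCell, landmark] at hab hac hbc haf hal hbf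
  generalize ((n - 1 : ℕ) : ℤ) * M = T at *
  by_cases h1 : t - a.t < R
  · refine ⟨a.i, a.o + (t - a.t), ?_, fun q hq => ?_⟩
    · simp only [IsCell]; omega
    · have hq1 := hside q hq
      have hq2 := h.near q hq a haC
      simp only [Near] at hq2 ⊢; omega
  by_cases h2 : b.t - t < R
  · refine ⟨b.i, b.o - (b.t - t), ?_, fun q hq => ?_⟩
    · simp only [IsCell]; push_cast at hbf; omega
    · have hq1 := hside q hq
      have hq2 := h.near q hq b hbC
      simp only [Near] at hq2 ⊢; omega
  refine ⟨a.i, a.o + R, ?_, fun q hq => ?_⟩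
  · simp only [IsCell]; omega
  · have hq2 := h.near q hq a haC
    have hq3 := h.near q hq b hbC
    clear ha hb hex hac hbc haf hal hbf hfirst hlast
    simp only [Near] at hq2 hq3 ⊢
    obtain hq1 | hq1 := hside q hq
    · clear hq3 hab; omega
    · have hqb : b.i < q.i ∨ (b.i = q.i ∧ b.o ≤ q.o) := by omega
      clear hq2 hq3; omega

/-- The converse move: neighbours are taken in the lexicographic order of cells, and only a
neighbour in the same copy of `ℤ` can be close. If neither is close, the threshold `2 * R` forces a
gap of that length in the interval, whether or not `a` and `b` lie in the same copy. -/
theorem exists_point (h : IsSystem n M (2 * R) C) (hR : 1 ≤ R) {i : ℕ} {o : ℤ}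
    (hc : IsCell n i o) : ∃ t, IsSystem n M R (Insert.insert ⟨t, i, o⟩ C) := by
  suffices H : ∃ t, (0 ≤ t ∧ t ≤ (n - 1 : ℕ) * M) ∧ ∀ q ∈ C, Near R q ⟨t, i, o⟩ by
    obtain ⟨t, h1, h2⟩ := H
    exact ⟨t, h.insert hR hc h1 h2⟩
  by_cases hex : ∃ p ∈ C, p.i = i ∧ p.o = o
  · obtain ⟨p, hp, rfl, rfl⟩ := hex
    exact ⟨p.t, h.bounds p hp, fun q hq => (h.near q hq p hp).mono (by omega)⟩
  push Not at hex
  have hn : 0 < n := by have := hc.1; omega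
  have hfirst := h.landmark_mem 0 hn
  have hlast := h.landmark_mem (n - 1) (by omega)
  have hf' := hex _ hfirst
  have hl' := hex _ hlast
  simp only [landmark] at hf' hl'
  obtain ⟨a, ⟨haC, hat⟩, ha⟩ := Set.exists_max_image
    {p ∈ C | p.i < i ∨ (p.i = i ∧ p.o < o)} (fun p => toLex (p.i, p.o))
    (h.finite.subset fun p hp => hp.1)
    ⟨_, hfirst, by simp only [landmark]; unfold IsCell at hc; omega⟩
  obtain ⟨b, ⟨hbC, hbt⟩, hb⟩ := Set.exists_min_image
    {p ∈ C | i < p.i ∨ (p.i = i ∧ o < p.o)} (fun p => toLex (p.i, p.o))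
    (h.finite.subset fun p hp => hp.1)
    ⟨_, hlast, by simp only [landmark]; unfold IsCell at hc; omega⟩
  simp only [Prod.Lex.toLex_le_toLex] at ha hb
  have hside : ∀ q ∈ C, (q.i < a.i ∨ (q.i = a.i ∧ q.o ≤ a.o)) ∨
      (b.i < q.i ∨ (b.i = q.i ∧ b.o ≤ q.o)) := fun q hq => by
    have := hex q hq
    obtain hlt | hlt : (q.i < i ∨ (q.i = i ∧ q.o < o)) ∨ (i < q.i ∨ (q.i = i ∧ o < q.o)) := by
      omega
    exacts [.inl (ha q ⟨hq, hlt⟩), .inr (hb q ⟨hq, hlt⟩)]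
  have hab := h.near a haC b hbC
  have hab' := h.bounds a haC
  have hbb' := h.bounds b hbC
  simp only [Near] at hab
  generalize ((n - 1 : ℕ) : ℤ) * M = T at *
  by_cases h1 : a.i = i ∧ o - a.o < R
  · refine ⟨a.t + (o - a.o), ?_, fun q hq => ?_⟩
    · omega
    · have hq1 := hside q hq
      have hq2 := h.near q hq a haC
      simp only [Near] at hq2 ⊢; omega
  by_cases h2 : b.i = i ∧ b.o - o < R
  · refine ⟨b.t - (b.o - o), ?_, fun q hq => ?_⟩
    · omega
    · have hq1 := hside q hq
      have hq2 := h.near q hq b hbC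
      simp only [Near] at hq2 ⊢; omega
  have hgap : a.t + 2 * R ≤ b.t := by omega
  refine ⟨a.t + R, ?_, fun q hq => ?_⟩
  · omega
  · have hq2 := h.near q hq a haC
    have hq3 := h.near q hq b hbC
    clear ha hb hab hex hf' hl' hab' hbb' hfirst hlast
    simp only [Near] at hq2 hq3 ⊢
    obtain hq1 | hq1 := hside q hq
    · clear hq3 h2 hbt; omega
    · have hqb : b.t ≤ q.t := by omega
      clear hq2 hq3; omega

end IsSystem

end Match

end WordLogic
namespace WordLogic

/-! Expansion of a well-formed word: every letter is replaced by a word for its middle element,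
surrounded by copies of words for its idempotents. -/

/-- Block, cell in the block, and index in the cell, ordered lexicographically. -/
abbrev Coord : Type := ℕ ×ₗ ℤ ×ₗ ℕ

namespace Coord

/-- The coordinate with the given components. -/
def mk (i : ℕ) (o : ℤ) (k : ℕ) : Coord := toLex (i, toLex (o, k))

/-- The block. -/
def block (z : Coord) : ℕ := (ofLex z).1

/-- The cell in the block. -/
def cell (z : Coord) : ℤ := (ofLex (ofLex z).2).1

/-- The index in the cell. -/
def idx (z : Coord) : ℕ := (ofLex (ofLex z).2).2

@[simp] theorem block_mk (i : ℕ) (o : ℤ) (k : ℕ) : (mk i o k).block = i := rfl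
@[simp] theorem cell_mk (i : ℕ) (o : ℤ) (k : ℕ) : (mk i o k).cell = o := rfl
@[simp] theorem idx_mk (i : ℕ) (o : ℤ) (k : ℕ) : (mk i o k).idx = k := rfl

theorem mk_eta (z : Coord) : mk z.block z.cell z.idx = z := rfl

theorem eq_iff {z z' : Coord} :
    z = z' ↔ z.block = z'.block ∧ z.cell = z'.cell ∧ z.idx = z'.idx := by
  refine ⟨by rintro rfl; exact ⟨rfl, rfl, rfl⟩, fun ⟨h1, h2, h3⟩ => ?_⟩
  rw [← mk_eta z, ← mk_eta z', h1, h2, h3]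

theorem lt_iff {z z' : Coord} : z < z' ↔ z.block < z'.block ∨
    (z.block = z'.block ∧ (z.cell < z'.cell ∨ (z.cell = z'.cell ∧ z.idx < z'.idx))) := by
  rw [Prod.Lex.lt_iff, Prod.Lex.lt_iff]; rfl

end Coord

section Expansion

variable {A S : Type*} [Semigroup S] (u : S → List A)

/-- The word in the given cell of the block of a letter. -/
def WFLetter.cellWord (c : WFLetter S) (o : ℤ) : List A :=
  if o = 0 then u c.core else
    if o < 0 then c.left.elim [] fun e => u e.1 else c.right.elim [] fun e => u e.1

/-- The word in the given cell. -/
def cellAt (l : List (WFLetter S)) (i : ℕ) (o : ℤ) : List A :=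
  l[i]?.elim [] fun c => c.cellWord u o

/-- The positions of the expansion, with infinitely many copies of the words for idempotents. -/
abbrev Expansion (l : List (WFLetter S)) : Type :=
  {z : Coord // z.idx < (cellAt u l z.block z.cell).length}

/-- The label of a position of the expansion. -/
def Expansion.label {l : List (WFLetter S)} (z : Expansion u l) : A :=
  (cellAt u l z.1.block z.1.cell)[z.1.idx]'z.2

variable {u}

theorem Expansion.label_eq {l l' : List (WFLetter S)} {z : Expansion u l} {z' : Expansion u l'}
    (h : cellAt u l z.1.block z.1.cell = cellAt u l' z'.1.block z'.1.cell)
    (h' : z.1.idx = z'.1.idx) : z.label = z'.label := by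
  simp only [label, h, h']

theorem cellAt_of_lt {l : List (WFLetter S)} {i : ℕ} (hi : i < l.length) (o : ℤ) :
    cellAt u l i o = l[i].cellWord u o := by simp [cellAt, hi]

theorem lt_length_of_cellAt {l : List (WFLetter S)} {i : ℕ} {o : ℤ} {k : ℕ}
    (h : k < (cellAt u l i o).length) : i < l.length := by
  by_contra hi
  rw [cellAt, List.getElem?_eq_none (by omega)] at h
  simp at h

/-- The neighbouring idempotents of the letters of a well-formed word. -/
structure Linked (l : List (WFLetter S)) : Prop where
  pos : 0 < l.length
  first : l[0].left = none
  last : l[l.length - 1].right = none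
  link : ∀ (i : ℕ) (hi : i + 1 < l.length), ∃ f, l[i].right = some f ∧ l[i + 1].left = some f

theorem linked_of_mem {w : FreeSemigroup (WFLetter S)} (hw : w ∈ wellFormedWords S) :
    Linked (letters w) := by
  rw [mem_wellFormedWords_iff_isChain] at hw
  obtain ⟨h1, h2, h3⟩ := hw
  have hpos : 0 < (letters w).length := by simp [letters]
  refine ⟨hpos, h1, h3 _ ?_, fun i hi => List.isChain_iff_getElem.1 h2 i hi⟩
  simp [List.getLast?_eq_getElem?]

namespace Linked

variable {l : List (WFLetter S)}

theorem left_eq_none_iff (h : Linked l) {i : ℕ} (hi : i < l.length) :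
    l[i].left = none ↔ i = 0 := by
  obtain _ | i := i
  · simp [h.first]
  · obtain ⟨f, -, hf⟩ := h.link i hi
    simp [hf]

theorem right_eq_none_iff (h : Linked l) {i : ℕ} (hi : i < l.length) :
    l[i].right = none ↔ i + 1 = l.length := by
  constructor
  · intro hr
    by_contra hne
    obtain ⟨f, hf, -⟩ := h.link i (by omega)
    simp [hf] at hr
  · intro hl
    obtain rfl : i = l.length - 1 := by omega
    exact h.last

theorem isCell_iff (h : Linked l) (hu : ∀ s, u s ≠ []) {i : ℕ} {o : ℤ} :
    0 < (cellAt u l i o).length ↔ Match.IsCell l.length i o := by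
  by_cases hi : i < l.length
  swap
  · exact ⟨fun h => (hi (lt_length_of_cellAt h)).elim, fun h => (hi h.1).elim⟩
  have hl := h.left_eq_none_iff hi
  have hr := h.right_eq_none_iff hi
  rw [cellAt_of_lt hi, WFLetter.cellWord]
  simp only [Match.IsCell]
  split_ifs with h0 h1
  · simp [List.length_pos_iff, hu]; omega
  · cases hL : l[i].left with
    | none => have := hl.1 hL; simp; omega
    | some e =>
      have := mt hl.2 (by simp [hL])
      simp [List.length_pos_iff, hu]; omega
  · cases hR : l[i].right with
    | none => have := hr.1 hR; simp; omega
    | some e =>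
      have := mt hr.2 (by simp [hR])
      simp [List.length_pos_iff, hu]; omega

/-- A match preserves the position relative to the landmarks. A cell strictly between two
consecutive landmarks may be matched into the right half of the first block or the left half of the
second; both halves contain copies of the same word because the two letters share their idempotent.
-/
theorem cellAt_eq_of_mem (h : Linked l) {N : ℕ} {R : ℤ} (hR : 1 ≤ R) {C : Set Match}
    (hC : Match.IsSystem l.length (2 * N + 1) R C) {i₀ i : ℕ} {o₀ o : ℤ} (hi : i₀ < l.length)
    (ho : |o₀| ≤ N) (hm : ⟨i₀ * (2 * N + 1) + o₀, i, o⟩ ∈ C) :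
    cellAt u l i₀ o₀ = cellAt u l i o := by
  rw [abs_le] at ho
  have hb := hC.bounds _ hm
  have hc := hC.isCell _ hm
  have hl := hC.near _ hm _ (hC.landmark_mem i₀ hi)
  simp only [Match.Near, Match.landmark, Match.IsCell] at hb hc hl
  rw [cellAt_of_lt hi, cellAt_of_lt hc.1]
  obtain ho' | ho' | ho' := lt_trichotomy o₀ 0
  · obtain _ | i₀ := i₀
    · simp only [Nat.cast_zero, zero_mul] at hb; omega
    have hl' := hC.near _ hm _ (hC.landmark_mem i₀ (by omega))
    simp only [Match.Near, Match.landmark] at hl'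
    push_cast at hl hl' hb
    rw [show ((i₀ : ℤ) + 1) * (2 * N + 1) = i₀ * (2 * N + 1) + (2 * N + 1) by ring] at hl hl' hb
    generalize (i₀ : ℤ) * (2 * N + 1) = K at *
    obtain ⟨rfl, h2⟩ | ⟨rfl, h2⟩ : (i = i₀ + 1 ∧ o < 0) ∨ (i = i₀ ∧ 0 < o) := by omega
    · simp only [WFLetter.cellWord, ho'.ne, h2.ne, ho', h2, if_true, if_false]
    · obtain ⟨f, h3, h4⟩ := h.link _ hi
      simp [WFLetter.cellWord, ho'.ne, h2.ne', ho', h2.not_gt, h3, h4]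
  · subst ho'
    generalize (i₀ : ℤ) * (2 * N + 1) = K at *
    obtain ⟨rfl, rfl⟩ : i = i₀ ∧ o = 0 := by omega
    rfl
  · by_cases hi' : i₀ + 1 < l.length
    · have hl' := hC.near _ hm _ (hC.landmark_mem (i₀ + 1) hi')
      simp only [Match.Near, Match.landmark] at hl'
      push_cast at hl'
      rw [show ((i₀ : ℤ) + 1) * (2 * N + 1) = i₀ * (2 * N + 1) + (2 * N + 1) by ring] at hl'
      generalize (i₀ : ℤ) * (2 * N + 1) = K at *
      obtain ⟨rfl, h2⟩ | ⟨rfl, h2⟩ : (i = i₀ ∧ 0 < o) ∨ (i = i₀ + 1 ∧ o < 0) := by omega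
      · simp only [WFLetter.cellWord, ho'.ne', h2.ne', ho'.not_gt, h2.not_gt, if_false]
      · obtain ⟨f, h3, h4⟩ := h.link _ hi'
        simp [WFLetter.cellWord, ho'.ne', h2.ne, ho'.not_gt, h2, h3, h4]
    · obtain rfl : i₀ = l.length - 1 := by omega
      omega

end Linked

/-- The linear position of a cell in the expansion truncated to `2 * N + 1` cells in each block. -/
def Coord.point (N : ℕ) (z : Coord) : ℤ := z.block * (2 * N + 1) + z.cell

/-- Block `i` occupies the interval of radius `N` around `i * (2 * N + 1)`, and these intervals are
disjoint. -/
theorem Coord.point_lt_iff {N : ℕ} {z z' : Coord} (hz : |z.cell| ≤ N) (hz' : |z'.cell| ≤ N) :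
    z.point N < z'.point N ↔ z.block < z'.block ∨ (z.block = z'.block ∧ z.cell < z'.cell) := by
  have key : ∀ i j : ℕ, i < j → (i : ℤ) * (2 * N + 1) + (2 * N + 1) ≤ j * (2 * N + 1) := by
    intro i j hij
    have : ((i : ℤ) + 1) * (2 * N + 1) ≤ j * (2 * N + 1) :=
      mul_le_mul_of_nonneg_right (by exact_mod_cast hij) (by positivity)
    linarith
  rw [abs_le] at hz hz'
  have h1 := key z.block z'.block
  have h2 := key z'.block z.block
  simp only [Coord.point]
  obtain h | h | h := lt_trichotomy z.block z'.block
  · have := h1 h; omega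
  · rw [h]; omega
  · have := h2 h; omega

theorem Coord.lt_iff_point {N : ℕ} {z z' : Coord} (hz : |z.cell| ≤ N) (hz' : |z'.cell| ≤ N) :
    z < z' ↔ z.point N < z'.point N ∨ (z.point N = z'.point N ∧ z.idx < z'.idx) := by
  have h1 := point_lt_iff hz hz'
  have h2 := point_lt_iff hz' hz
  rw [lt_iff]; omega

/-- The truncated expansion and the full one are equivalent. -/
theorem sim_expansion {l : List (WFLetter S)} (hl : Linked l) (hu : ∀ s, u s ≠ []) {N r : ℕ}
    (hN : 2 ^ r ≤ N) {v : FreeSemigroup A} (g : Pos v → Expansion u l) (hg : StrictMono g)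
    (hgN : ∀ p, |(g p).1.cell| ≤ N) (hgr : ∀ z : Expansion u l, |z.1.cell| ≤ N → ∃ p, g p = z)
    (hlab : ∀ p, (letters v).get p = (g p).label) (P : Atom A → Prop) (V : Finset ℕ)
    {q : List (Set Quant)} (hq : q.length < r) (ν : ℕ → Pos v) (ν' : ℕ → Expansion u l) :
    Sim P (letters v).get (Expansion.label u) V q ∅ ν ν' ∧
      Sim P (Expansion.label u) (letters v).get V q ∅ ν' ν := by
  -- Invariant with `r` rounds left: indices within cells are equal, and the cells are matched by a
  -- system of threshold `2 ^ r`. Each round halves the threshold.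
  let I : ℕ → Finset ℕ → (ℕ → Pos v) → (ℕ → Expansion u l) → Prop := fun r D ν ν' =>
    ∃ C, Match.IsSystem l.length (2 * N + 1) (2 ^ r) C ∧ ∀ x ∈ D,
      (g (ν x)).1.idx = (ν' x).1.idx ∧
      (⟨(g (ν x)).1.point N, (ν' x).1.block, (ν' x).1.cell⟩ : Match) ∈ C
  have hpow : ∀ r : ℕ, (1 : ℤ) ≤ 2 ^ r := fun r => one_le_pow₀ (by norm_num)
  have hcell : ∀ z : Expansion u l, Match.IsCell l.length z.1.block z.1.cell := fun z =>
    (hl.isCell_iff hu).1 (lt_of_le_of_lt (Nat.zero_le _) z.2)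
  have hI₁ : ∀ r D ν ν', I r D ν ν' → ∀ x ∈ D, (letters v).get (ν x) = (ν' x).label := by
    rintro r D ν ν' ⟨C, hC, h⟩ x hx
    rw [hlab]
    exact Expansion.label_eq
      (hl.cellAt_eq_of_mem (hpow r) hC (hcell _).1 (hgN _) (h x hx).2) (h x hx).1
  have hI₂ : ∀ r D ν ν', I r D ν ν' → ∀ x ∈ D, ∀ y ∈ D, ν x < ν y ↔ ν' x < ν' y := by
    rintro r D ν ν' ⟨C, hC, h⟩ x hx y hy
    have hn := hC.near _ (h x hx).2 _ (h y hy).2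
    have := hpow r
    rw [← hg.lt_iff_lt, ← Subtype.coe_lt_coe, ← Subtype.coe_lt_coe,
      Coord.lt_iff_point (hgN _) (hgN _), Coord.lt_iff, (h x hx).1, (h y hy).1]
    simp only [Match.Near] at hn
    omega
  have hupd : ∀ (r : ℕ) (D : Finset ℕ) (ν : ℕ → Pos v) (ν' : ℕ → Expansion u l) (C : Set Match)
      (x : ℕ) (p : Pos v) (p' : Expansion u l), (∀ x ∈ D, (g (ν x)).1.idx = (ν' x).1.idx ∧
        (⟨(g (ν x)).1.point N, (ν' x).1.block, (ν' x).1.cell⟩ : Match) ∈ C) →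
      (g p).1.idx = p'.1.idx → Match.IsSystem l.length (2 * N + 1) (2 ^ r)
        (insert ⟨(g p).1.point N, p'.1.block, p'.1.cell⟩ C) →
      I r (insert x D) (Function.update ν x p) (Function.update ν' x p') := by
    intro r D ν ν' C x p p' h hk hC
    refine ⟨_, hC, fun y hy => ?_⟩
    by_cases hyx : y = x
    · subst hyx; simp [hk]
    · have := h y (Finset.mem_of_mem_insert_of_ne hy hyx)
      simp only [Function.update_of_ne hyx]
      exact ⟨this.1, .inr this.2⟩
  have hI₃ : ∀ r D ν ν', I (r + 1) D ν ν' → ∀ x p, ∃ p',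
      I r (insert x D) (Function.update ν x p) (Function.update ν' x p') := by
    rintro r D ν ν' ⟨C, hC, h⟩ x p
    rw [pow_succ'] at hC
    have hc := hcell (g p)
    have hp := hgN p
    obtain ⟨i, o, hC'⟩ := hC.exists_cell (hpow r) hl.pos (t := (g p).1.point N)
      (by
        rw [abs_le] at hp
        simp only [Coord.point, Match.IsCell] at hc ⊢
        obtain h | h := Nat.eq_zero_or_pos (g p).1.block
        · simp only [h, Nat.cast_zero, zero_mul]; omega
        · have : (1 : ℤ) * (2 * N + 1) ≤ (g p).1.block * (2 * N + 1) :=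
            mul_le_mul_of_nonneg_right (by exact_mod_cast h) (by positivity)
          omega)
      (by
        rw [abs_le] at hp
        simp only [Coord.point, Match.IsCell] at hc ⊢
        obtain h | h : (g p).1.block = l.length - 1 ∨ (g p).1.block + 1 ≤ l.length - 1 := by omega
        · rw [h]; omega
        · have : (((g p).1.block : ℤ) + 1) * (2 * N + 1) ≤ (l.length - 1 : ℕ) * (2 * N + 1) :=
            mul_le_mul_of_nonneg_right (by exact_mod_cast h) (by positivity)
          rw [add_mul, one_mul] at this
          omega)
    have heq := hl.cellAt_eq_of_mem (u := u) (hpow r) hC' hc.1 hp (Set.mem_insert _ _)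
    refine ⟨⟨.mk i o (g p).1.idx, ?_⟩, hupd r D ν ν' C x p _ h rfl hC'⟩
    simp only [Coord.block_mk, Coord.cell_mk, Coord.idx_mk, ← heq]
    exact (g p).2
  have hI₄ : ∀ r D ν ν', I (r + 1) D ν ν' → ∀ x p', ∃ p,
      I r (insert x D) (Function.update ν x p) (Function.update ν' x p') := by
    rintro r D ν ν' ⟨C, hC, h⟩ x p'
    rw [pow_succ'] at hC
    obtain ⟨t, hC'⟩ := hC.exists_point (hpow r) (hcell p')
    have hb := hC'.bounds _ (Set.mem_insert _ _)
    simp only at hb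
    -- Division of `t + N` by `2 * N + 1`: the quotient is the block, and the remainder minus `N` is
    -- an offset between `-N` and `N`.
    obtain ⟨i₀, o₀, hi₀, ho₀, ht⟩ : ∃ (i₀ : ℕ) (o₀ : ℤ), i₀ < l.length ∧ |o₀| ≤ N ∧
        t = i₀ * (2 * N + 1) + o₀ := by
      have h1 := Int.mul_ediv_add_emod (t + N) (2 * N + 1)
      have h2 := Int.emod_nonneg (t + N) (show (2 * N + 1 : ℤ) ≠ 0 by omega)
      have h3 := Int.emod_lt_of_pos (t + N) (show (0 : ℤ) < 2 * N + 1 by omega)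
      have h4 : 0 ≤ (t + N) / (2 * N + 1) := Int.ediv_nonneg (by omega) (by omega)
      have h5 : (t + N) / (2 * N + 1) < l.length := by
        refine Int.ediv_lt_of_lt_mul (by omega) ?_
        have : (l.length : ℤ) = ((l.length - 1 : ℕ) : ℤ) + 1 := by have := hl.pos; omega
        rw [this, add_mul, one_mul]
        omega
      obtain ⟨i₀, hi₀⟩ := Int.eq_ofNat_of_zero_le h4
      refine ⟨i₀, t - i₀ * (2 * N + 1), by omega, ?_, by ring⟩
      rw [hi₀, mul_comm] at h1
      rw [abs_le]
      omega
    subst ht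
    have heq := hl.cellAt_eq_of_mem (u := u) (hpow r) hC' hi₀ ho₀ (Set.mem_insert _ _)
    obtain ⟨p, hp⟩ := hgr ⟨.mk i₀ o₀ p'.1.idx, by
      simp only [Coord.block_mk, Coord.cell_mk, Coord.idx_mk, heq]
      exact p'.2⟩ ho₀
    exact ⟨p, hupd r D ν ν' C x p p' h (by rw [hp]; rfl) (by rw [hp]; exact hC')⟩
  have hI₀ : ∀ ν ν', I r ∅ ν ν' := by
    intro ν ν'
    have hR : (2 : ℤ) ^ r ≤ N := by exact_mod_cast hN
    -- The game starts with the landmarks alone; consecutive ones are `2 * N + 1 ≥ 2 ^ r` apart.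
    refine ⟨Match.landmark (2 * N + 1) '' Set.Iio l.length, ⟨(Set.finite_Iio _).image _,
      fun i hi => ⟨i, hi, rfl⟩, ?_, ?_, ?_⟩, by simp⟩
    · rintro _ ⟨i, hi, rfl⟩
      simp only [Set.mem_Iio] at hi
      simp [Match.IsCell, Match.landmark, hi]
    · rintro _ ⟨i, hi, rfl⟩
      simp only [Set.mem_Iio] at hi
      refine ⟨by simp only [Match.landmark]; positivity,
        mul_le_mul_of_nonneg_right ?_ (by positivity)⟩
      exact_mod_cast Nat.le_sub_one_of_lt hi
    · rintro _ ⟨i, hi, rfl⟩ _ ⟨j, hj, rfl⟩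
      exact Match.landmark_near (by omega) i j (by positivity)
  refine ⟨sim_of_backAndForth I hI₁ hI₂ hI₃ hI₄ V q r ∅ ν ν' hq (hI₀ _ _),
    sim_of_backAndForth (fun r D ν ν' => I r D ν' ν)
      (fun r D ν ν' h x hx => (hI₁ r D ν' ν h x hx).symm)
      (fun r D ν ν' h x hx y hy => (hI₂ r D ν' ν h x hx y hy).symm)
      (fun r D ν ν' h x p => hI₄ r D ν' ν h x p) (fun r D ν ν' h x p => hI₃ r D ν' ν h x p)
      V q r ∅ ν' ν hq (hI₀ _ _)⟩

end Expansion

end WordLogic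
namespace WordLogic

/-! ### The truncated expansion as a word, and its value -/

section Truncation

variable {A S : Type*} [Semigroup S]

theorem map_getElem?_range {B : Type*} (l : List B) :
    (List.range l.length).map (fun k => l[k]?) = l.map some := by
  refine List.ext_getElem (by simp) fun i h1 h2 => ?_
  simp at h1
  simp [h1]

/-- The offsets of the cells in a block of the truncated expansion. -/
def offsets (N : ℕ) : List ℤ :=
  (List.range N).map (fun j : ℕ => (j : ℤ) - N) ++ 0 :: (List.range N).map fun j : ℕ => (j : ℤ) + 1

theorem mem_offsets {N : ℕ} {o : ℤ} : o ∈ offsets N ↔ |o| ≤ N := by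
  simp only [offsets, List.mem_append, List.mem_map, List.mem_range, List.mem_cons, abs_le]
  constructor
  · rintro (⟨j, hj, rfl⟩ | rfl | ⟨j, hj, rfl⟩) <;> omega
  · rintro ⟨h1, h2⟩
    obtain h | h | h := lt_trichotomy o 0
    · exact .inl ⟨(o + N).toNat, by omega, by omega⟩
    · exact .inr (.inl h)
    · exact .inr (.inr ⟨(o - 1).toNat, by omega, by omega⟩)

theorem offsets_pairwise (N : ℕ) : (offsets N).Pairwise (· < ·) := by
  refine List.pairwise_append.2 ⟨?_, List.pairwise_cons.2 ⟨?_, ?_⟩, ?_⟩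
  · exact List.pairwise_map.2 (List.pairwise_lt_range.imp fun h => by omega)
  · simp only [List.mem_map]; rintro _ ⟨j, -, rfl⟩; omega
  · exact List.pairwise_map.2 (List.pairwise_lt_range.imp fun h => by omega)
  · simp only [List.mem_map, List.mem_cons, List.mem_range]
    rintro _ ⟨j, hj, rfl⟩ _ (rfl | ⟨k, -, rfl⟩) <;> omega

variable (u : S → List A)

/-- The positions of the truncated expansion, from left to right. -/
def truncCoords (N : ℕ) (l : List (WFLetter S)) : List Coord :=
  (List.range l.length).flatMap fun i => (offsets N).flatMap fun o =>
    (List.range (cellAt u l i o).length).map (Coord.mk i o)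

/-- The letters of the truncated expansion. -/
def truncLetters (N : ℕ) (l : List (WFLetter S)) : List A :=
  (List.range l.length).flatMap fun i => (offsets N).flatMap fun o => cellAt u l i o

variable {u}

theorem truncCoords_pairwise (N : ℕ) (l : List (WFLetter S)) :
    (truncCoords u N l).Pairwise (· < ·) := by
  refine List.pairwise_flatMap.2 ⟨fun i _ => List.pairwise_flatMap.2 ⟨fun o _ => ?_, ?_⟩, ?_⟩
  · refine List.pairwise_map.2 (List.pairwise_lt_range.imp fun h => ?_)
    simpa [Coord.lt_iff] using h
  · refine (offsets_pairwise N).imp fun h => ?_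
    simp only [List.mem_map]
    rintro _ ⟨k, -, rfl⟩ _ ⟨k', -, rfl⟩
    simp [Coord.lt_iff, h]
  · refine List.pairwise_lt_range.imp fun h => ?_
    simp only [List.mem_map, List.mem_flatMap]
    rintro _ ⟨o, -, k, -, rfl⟩ _ ⟨o', -, k', -, rfl⟩
    simp [Coord.lt_iff, h]

theorem mem_truncCoords {N : ℕ} {l : List (WFLetter S)} {z : Coord} : z ∈ truncCoords u N l ↔
    z.idx < (cellAt u l z.block z.cell).length ∧ |z.cell| ≤ N := by
  simp only [truncCoords, List.mem_flatMap, List.mem_map, List.mem_range, mem_offsets]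
  constructor
  · rintro ⟨i, hi, o, ho, k, hk, rfl⟩
    exact ⟨hk, ho⟩
  · rintro ⟨h1, h2⟩
    exact ⟨z.block, lt_length_of_cellAt h1, z.cell, h2, z.idx, h1, z.mk_eta⟩

theorem map_truncCoords (N : ℕ) (l : List (WFLetter S)) :
    (truncCoords u N l).map (fun z => (cellAt u l z.block z.cell)[z.idx]?) =
      (truncLetters u N l).map some := by
  simp only [truncCoords, truncLetters, List.map_flatMap, List.map_map, ← map_getElem?_range]
  rfl

theorem listValue_flatMap {B : Type*} (α : FreeSemigroup A →ₙ* S) (f : B → List A) (l : List B) :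
    listValue α (l.flatMap f) = (l.map fun b => listValue α (f b)).prod := by
  induction l with
  | nil => rfl
  | cons b l ih => rw [List.flatMap_cons, listValue_append, ih, List.map_cons, List.prod_cons]

/-- A positive power of an idempotent is the idempotent itself, so the number of copies does not
affect the value. -/
theorem listValue_block (α : FreeSemigroup A →ₙ* S) (hu : ∀ s : S, listValue α (u s) = s) {N : ℕ}
    (hN : N ≠ 0) (c : WFLetter S) :
    listValue α ((offsets N).flatMap (c.cellWord u)) = ((letterValue c : S) : WithOne S) := by
  have hopt : ∀ o : Option (Idem S), optValue o ^ N = optValue o := by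
    rintro (_ | e)
    · exact one_pow N
    · obtain ⟨N, rfl⟩ := Nat.exists_eq_succ_of_ne_zero hN
      refine IsIdempotentElem.pow_succ_eq N ?_
      change ((e.1 : WithOne S)) * e.1 = e.1
      rw [← WithOne.coe_mul, e.2]
  have hval : ∀ o : Option (Idem S), listValue α (o.elim [] fun e => u e.1) = optValue o := by
    rintro (_ | e)
    · rfl
    · exact hu e.1
  have hleft : ((List.range N).map (fun j : ℕ => (j : ℤ) - N)).map
      (fun o => listValue α (c.cellWord u o)) = List.replicate N (optValue c.left) := by
    refine List.eq_replicate_iff.2 ⟨by simp, ?_⟩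
    simp only [List.mem_map, List.mem_range]
    rintro _ ⟨_, ⟨j, hj, rfl⟩, rfl⟩
    rw [WFLetter.cellWord, if_neg (by omega), if_pos (by omega), hval]
  have hright : ((List.range N).map (fun j : ℕ => (j : ℤ) + 1)).map
      (fun o => listValue α (c.cellWord u o)) = List.replicate N (optValue c.right) := by
    refine List.eq_replicate_iff.2 ⟨by simp, ?_⟩
    simp only [List.mem_map, List.mem_range]
    rintro _ ⟨_, ⟨j, hj, rfl⟩, rfl⟩
    rw [WFLetter.cellWord, if_neg (by omega), if_neg (by omega), hval]
  rw [listValue_flatMap, offsets, List.map_append, List.map_cons, List.prod_append,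
    List.prod_cons, hleft, hright, List.prod_replicate, List.prod_replicate, hopt, hopt,
    WFLetter.cellWord, if_pos rfl, hu, ← mul_assoc]
  cases c <;> simp [WFLetter.left, WFLetter.right, WFLetter.core, optValue, letterValue]

theorem listValue_truncLetters (α : FreeSemigroup A →ₙ* S) (hu : ∀ s : S, listValue α (u s) = s)
    {N : ℕ} (hN : N ≠ 0) (w : FreeSemigroup (WFLetter S)) :
    listValue α (truncLetters u N (letters w)) = (beta S w : WithOne S) := by
  rw [beta_eq_prod, truncLetters, listValue_flatMap]
  congr 1
  refine List.ext_getElem (by simp) fun i h1 h2 => ?_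
  simp only [List.length_map, List.length_range] at h1
  simp only [List.getElem_map, List.getElem_range, cellAt_of_lt h1]
  exact listValue_block α hu hN _

/-- The truncated expansion is a word, whose image is the value of the expanded word. -/
theorem exists_truncation (α : FreeSemigroup A →ₙ* S) (hu : ∀ s : S, listValue α (u s) = s)
    {N : ℕ} (hN : N ≠ 0) (w : FreeSemigroup (WFLetter S)) :
    ∃ (v : FreeSemigroup A) (g : Pos v → Expansion u (letters w)), α v = beta S w ∧
      StrictMono g ∧ (∀ p, |(g p).1.cell| ≤ N) ∧
      (∀ z : Expansion u (letters w), |z.1.cell| ≤ N → ∃ p, g p = z) ∧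
      ∀ p, (letters v).get p = (g p).label := by
  have hval := listValue_truncLetters α hu hN w
  -- The list of letters is nonempty because its value lies in `S` and so is not the adjoined unit.
  obtain ⟨v, hv⟩ : ∃ v : FreeSemigroup A, letters v = truncLetters u N (letters w) := by
    cases h : truncLetters u N (letters w) with
    | nil => rw [h, listValue_nil] at hval; exact (WithOne.coe_ne_one hval.symm).elim
    | cons a l => exact ⟨⟨a, l⟩, rfl⟩
  have hmap := map_truncCoords (u := u) N (letters w)
  rw [← hv] at hmap
  have hlen : (letters v).length = (truncCoords u N (letters w)).length := by
    simpa using (congrArg List.length hmap).symm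
  have hmem : ∀ p : Pos v, (truncCoords u N (letters w))[p.1]'(hlen ▸ p.2) ∈ _ := fun p =>
    List.getElem_mem _
  refine ⟨v, fun p => ⟨(truncCoords u N (letters w))[p.1]'(hlen ▸ p.2),
    (mem_truncCoords.1 (hmem p)).1⟩, ?_, ?_, fun p => (mem_truncCoords.1 (hmem p)).2, ?_, ?_⟩
  · rw [← WithOne.coe_inj, ← hval, ← hv]
    exact coe_map_eq_prod α v
  · intro p p' h
    exact List.pairwise_iff_getElem.1 (truncCoords_pairwise N (letters w)) _ _ _ _ h
  · intro z hz
    obtain ⟨p, hp, h⟩ := List.getElem_of_mem (mem_truncCoords.2 ⟨z.2, hz⟩)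
    exact ⟨⟨p, hlen ▸ hp⟩, Subtype.ext h⟩
  · intro p
    have h1 : ((letters v).map some)[p.1]? = some (some ((letters v).get p)) := by simp
    rw [← hmap, List.getElem?_map, List.getElem?_eq_getElem (hlen ▸ p.2), Option.map_some,
      Option.some_inj, List.getElem?_eq_getElem (mem_truncCoords.1 (hmem p)).1,
      Option.some_inj] at h1
    exact h1.symm

end Truncation

/-! ### From weak games on well-formed words to strong games on expansions -/

section Expansion

variable {A S : Type*} [Semigroup S] {u : S → List A}

namespace Expansion

variable {l : List (WFLetter S)}

theorem block_lt (z : Expansion u l) : z.1.block < l.length := lt_length_of_cellAt z.2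

theorem idx_lt (z : Expansion u l) :
    z.1.idx < ((l[z.1.block]'z.block_lt).cellWord u z.1.cell).length := by
  have := z.2
  rwa [cellAt_of_lt z.block_lt] at this

/-- The position with the given coordinates. -/
def mk {i : ℕ} (hi : i < l.length) (o : ℤ) (k : ℕ) (hk : k < (l[i].cellWord u o).length) :
    Expansion u l :=
  ⟨.mk i o k, by simpa [cellAt_of_lt hi] using hk⟩

/-- A block with an idempotent on its right has no last position. The offset `|o| + 1` is both
positive and beyond the given offset `o`. -/
theorem exists_right (hl : Linked l) (hu : ∀ s, u s ≠ []) (z : Expansion u l)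
    (h : (l[z.1.block]'z.block_lt).right ≠ none) :
    ∃ z' : Expansion u l, z'.1.block = z.1.block ∧ z < z' := by
  have h1 := mt (hl.right_eq_none_iff z.block_lt).2 h
  have h2 := z.block_lt
  refine ⟨⟨.mk z.1.block (|z.1.cell| + 1) 0, (hl.isCell_iff hu).2 ?_⟩, rfl, ?_⟩
  · simp only [Match.IsCell, Coord.block_mk, Coord.cell_mk]
    have := abs_nonneg z.1.cell
    omega
  · rw [← Subtype.coe_lt_coe, Coord.lt_iff]
    exact .inr ⟨rfl, .inl (Int.lt_add_one_of_le (le_abs_self z.1.cell))⟩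

theorem exists_left (hl : Linked l) (hu : ∀ s, u s ≠ []) (z : Expansion u l)
    (h : (l[z.1.block]'z.block_lt).left ≠ none) :
    ∃ z' : Expansion u l, z'.1.block = z.1.block ∧ z' < z := by
  have h1 := mt (hl.left_eq_none_iff z.block_lt).2 h
  have h2 := z.block_lt
  refine ⟨⟨.mk z.1.block (-(|z.1.cell| + 1)) 0, (hl.isCell_iff hu).2 ?_⟩, rfl, ?_⟩
  · simp only [Match.IsCell, Coord.block_mk, Coord.cell_mk]
    have := abs_nonneg z.1.cell
    omega
  · rw [← Subtype.coe_lt_coe, Coord.lt_iff]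
    have := neg_abs_le z.1.cell
    exact .inr ⟨rfl, .inl (show -(|z.1.cell| + 1) < z.1.cell by omega)⟩

end Expansion

/-- Positions of two expansions with the same cell, index and letter of the block. -/
structure Twin {l l' : List (WFLetter S)} (z : Expansion u l) (z' : Expansion u l') : Prop where
  letter : l[z.1.block]'z.block_lt = l'[z'.1.block]' z'.block_lt
  cell : z.1.cell = z'.1.cell
  idx : z.1.idx = z'.1.idx

namespace Twin

variable {l l' : List (WFLetter S)}

theorem symm {z : Expansion u l} {z' : Expansion u l'} (h : Twin z z') : Twin z' z :=
  ⟨h.letter.symm, h.cell.symm, h.idx.symm⟩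

theorem label_eq {z : Expansion u l} {z' : Expansion u l'} (h : Twin z z') :
    z.label = z'.label := by
  refine Expansion.label_eq ?_ h.idx
  rw [cellAt_of_lt z.block_lt, cellAt_of_lt z'.block_lt, h.letter, h.cell]

/-- Any position in the block of `z` has a twin in the block of `z'`. -/
theorem exists_twin {z : Expansion u l} {z' : Expansion u l'} (h : Twin z z') (y : Expansion u l)
    (hy : y.1.block = z.1.block) :
    ∃ y' : Expansion u l', y'.1.block = z'.1.block ∧ Twin y y' := by
  have hl : l[y.1.block]'y.block_lt = l'[z'.1.block]' z'.block_lt := by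
    rw [← h.letter]; simp only [hy]
  refine ⟨.mk z'.block_lt y.1.cell y.1.idx ?_, rfl, hl, rfl, rfl⟩
  rw [← hl]; exact y.idx_lt

theorem lt_iff {z y : Expansion u l} {z' y' : Expansion u l'} (hz : Twin z z') (hy : Twin y y')
    (h : z.1.block < y.1.block ↔ z'.1.block < y'.1.block)
    (h' : z.1.block = y.1.block ↔ z'.1.block = y'.1.block) : z < y ↔ z' < y' := by
  rw [← Subtype.coe_lt_coe, ← Subtype.coe_lt_coe, Coord.lt_iff, Coord.lt_iff, h, h', hz.cell,
    hy.cell, hz.idx, hy.idx]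

theorem lt_iff_of_eq {z y : Expansion u l} {z' y' : Expansion u l'} (hz : Twin z z')
    (hy : Twin y y') (h : z.1.block = y.1.block) (h' : z'.1.block = y'.1.block) :
    z < y ↔ z' < y' :=
  hz.lt_iff hy (by omega) (by omega)

theorem not_lt_of_min (hl : Linked l) (hl' : Linked l') (hu : ∀ s, u s ≠ []) {z : Expansion u l}
    {z' : Expansion u l'} (h : Twin z z') (hz : ∀ y, ¬ y < z) (y' : Expansion u l') :
    ¬ y' < z' := by
  intro hy'
  by_cases hb : y'.1.block = z'.1.block
  · obtain ⟨y, hyb, hy⟩ := h.symm.exists_twin y' hb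
    exact hz y ((hy.lt_iff_of_eq h.symm hb hyb).1 hy')
  · have hlt := hy'
    rw [← Subtype.coe_lt_coe, Coord.lt_iff] at hlt
    have h0 : z'.1.block ≠ 0 := by omega
    have := mt (hl'.left_eq_none_iff z'.block_lt).1 h0
    rw [← h.letter] at this
    obtain ⟨y, -, hy⟩ := Expansion.exists_left hl hu z this
    exact hz y hy

theorem not_lt_of_max (hl : Linked l) (hl' : Linked l') (hu : ∀ s, u s ≠ []) {z : Expansion u l}
    {z' : Expansion u l'} (h : Twin z z') (hz : ∀ y, ¬ z < y) (y' : Expansion u l') :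
    ¬ z' < y' := by
  intro hy'
  by_cases hb : y'.1.block = z'.1.block
  · obtain ⟨y, hyb, hy⟩ := h.symm.exists_twin y' hb
    exact hz y ((h.symm.lt_iff_of_eq hy hb.symm hyb.symm).1 hy')
  · have hlt := hy'
    rw [← Subtype.coe_lt_coe, Coord.lt_iff] at hlt
    have h0 : z'.1.block + 1 ≠ l'.length := by have := y'.block_lt; omega
    have := mt (hl'.right_eq_none_iff z'.block_lt).1 h0
    rw [← h.letter] at this
    obtain ⟨y, -, hy⟩ := Expansion.exists_right hl hu z this
    exact hz y hy

/-- A block with a successor block has no last position, so consecutive positions share their block,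
and inside a block all is determined by its letter. Only equality of blocks has to be preserved,
which is why the argument works for `FO(=)`. -/
theorem succ_imp (hl : Linked l) (hu : ∀ s, u s ≠ []) {z y : Expansion u l}
    {z' y' : Expansion u l'} (hz : Twin z z') (hy : Twin y y')
    (hb : z.1.block = y.1.block ↔ z'.1.block = y'.1.block)
    (h : z < y ∧ ¬ ∃ t, z < t ∧ t < y) : z' < y' ∧ ¬ ∃ t, z' < t ∧ t < y' := by
  have heq : z.1.block = y.1.block := by
    by_contra hne
    have hlt := h.1
    rw [← Subtype.coe_lt_coe, Coord.lt_iff] at hlt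
    have hr : (l[z.1.block]'z.block_lt).right ≠ none := by
      rw [Ne, hl.right_eq_none_iff z.block_lt]
      have := y.block_lt; omega
    obtain ⟨t, ht, hzt⟩ := Expansion.exists_right hl hu z hr
    refine h.2 ⟨t, hzt, ?_⟩
    rw [← Subtype.coe_lt_coe, Coord.lt_iff]
    omega
  refine ⟨(hz.lt_iff_of_eq hy heq (hb.1 heq)).1 h.1, ?_⟩
  rintro ⟨t', h1, h2⟩
  have ht' : t'.1.block = z'.1.block := by
    have := hb.1 heq
    rw [← Subtype.coe_lt_coe, Coord.lt_iff] at h1 h2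
    omega
  obtain ⟨t, htb, ht⟩ := hz.symm.exists_twin t' ht'
  exact h.2 ⟨t, (hz.symm.lt_iff_of_eq ht ht'.symm htb.symm).1 h1,
    (ht.lt_iff_of_eq hy.symm (ht'.trans (hb.1 heq)) (htb.trans heq)).1 h2⟩

end Twin

/-- A winning strategy in the weak game on two well-formed words yields one in the strong game on
their expansions. -/
theorem sim_expansion_of_sim {F : Fragment} {w w' : FreeSemigroup (WFLetter S)}
    (hl : Linked (letters w)) (hl' : Linked (letters w')) (hu : ∀ s, u s ≠ []) {V : Finset ℕ} :
    ∀ (q : List (Set Quant)) (D : Finset ℕ) (μ : ℕ → Pos w) (μ' : ℕ → Pos w')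
      (ν : ℕ → Expansion u (letters w)) (ν' : ℕ → Expansion u (letters w')),
      WSim F.WeakAtom V q D μ μ' →
      (∀ x ∈ D, (ν x).1.block = μ x ∧ (ν' x).1.block = μ' x ∧ (ν x).1.cell = (ν' x).1.cell ∧
        (ν x).1.idx = (ν' x).1.idx) →
      Sim F.StrongAtom (Expansion.label u) (Expansion.label u) V q D ν ν' := by
  have hletter : ∀ (q : List (Set Quant)) (D : Finset ℕ) (μ : ℕ → Pos w) (μ' : ℕ → Pos w'),
      WSim F.WeakAtom V q D μ μ' → ∀ x ∈ D, (letters w)[(μ x).1] = (letters w')[(μ' x).1] :=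
    fun q D μ μ' h x hx => h.agree.label_eq (fun _ _ => trivial) hx
  have agree : ∀ (q : List (Set Quant)) (D : Finset ℕ) (μ : ℕ → Pos w) (μ' : ℕ → Pos w')
      (ν : ℕ → Expansion u (letters w)) (ν' : ℕ → Expansion u (letters w')),
      WSim F.WeakAtom V q D μ μ' →
      (∀ x ∈ D, (ν x).1.block = μ x ∧ (ν' x).1.block = μ' x ∧ (ν x).1.cell = (ν' x).1.cell ∧
        (ν x).1.idx = (ν' x).1.idx) →
      Agree F.StrongAtom (Expansion.label u) (Expansion.label u) D ν ν' := by
    intro q D μ μ' ν ν' h hν a ha hD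
    have twin : ∀ x ∈ D, Twin (ν x) (ν' x) := fun x hx => by
      obtain ⟨h1, h2, h3, h4⟩ := hν x hx
      refine ⟨?_, h3, h4⟩
      have := hletter q D μ μ' h x hx
      simpa only [h1, h2] using this
    have block : ∀ x ∈ D, ∀ y ∈ D,
        ((ν x).1.block = (ν y).1.block ↔ (ν' x).1.block = (ν' y).1.block) := fun x hx y hy => by
      have := h.agree (.eq x y) trivial (by simp [Atom.vars, Finset.insert_subset_iff, hx, hy])
      simp only [Atom.Holds, Fin.ext_iff] at this
      rw [(hν x hx).1, (hν y hy).1, (hν x hx).2.1, (hν y hy).2.1, this]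
    cases a with
    | label a x => simp only [Atom.Holds, (twin x (by simpa [Atom.vars] using hD)).label_eq]
    | eq x y =>
      have hx : x ∈ D := hD (by simp [Atom.vars])
      have hy : y ∈ D := hD (by simp [Atom.vars])
      simp only [Atom.Holds, Subtype.ext_iff, Coord.eq_iff, block x hx y hy, (twin x hx).cell,
        (twin y hy).cell, (twin x hx).idx, (twin y hy).idx]
    | lt x y =>
      have hx : x ∈ D := hD (by simp [Atom.vars])
      have hy : y ∈ D := hD (by simp [Atom.vars])
      refine (twin x hx).lt_iff (twin y hy) ?_ (block x hx y hy)
      rw [(hν x hx).1, (hν y hy).1, (hν x hx).2.1, (hν y hy).2.1]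
      exact h.agree.lt_iff (ha.resolve_right id) hx hy
    | succ x y =>
      have hx : x ∈ D := hD (by simp [Atom.vars])
      have hy : y ∈ D := hD (by simp [Atom.vars])
      exact ⟨(twin x hx).succ_imp hl hu (twin y hy) (block x hx y hy),
        (twin x hx).symm.succ_imp hl' hu (twin y hy).symm (block x hx y hy).symm⟩
    | min x =>
      have hx : x ∈ D := by simpa [Atom.vars] using hD
      exact ⟨(twin x hx).not_lt_of_min hl hl' hu, (twin x hx).symm.not_lt_of_min hl' hl hu⟩
    | max x =>
      have hx : x ∈ D := by simpa [Atom.vars] using hD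
      exact ⟨(twin x hx).not_lt_of_max hl hl' hu, (twin x hx).symm.not_lt_of_max hl' hl hu⟩
  have hupd : ∀ (D : Finset ℕ) (μ : ℕ → Pos w) (μ' : ℕ → Pos w')
      (ν : ℕ → Expansion u (letters w)) (ν' : ℕ → Expansion u (letters w')) (x : ℕ) i i' p p',
      (∀ x ∈ D, (ν x).1.block = μ x ∧ (ν' x).1.block = μ' x ∧ (ν x).1.cell = (ν' x).1.cell ∧
        (ν x).1.idx = (ν' x).1.idx) →
      (p.1.block = i.1 ∧ p'.1.block = i'.1 ∧ p.1.cell = p'.1.cell ∧ p.1.idx = p'.1.idx) →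
      ∀ y ∈ insert x D, (Function.update ν x p y).1.block = Function.update μ x i y ∧
        (Function.update ν' x p' y).1.block = Function.update μ' x i' y ∧
        (Function.update ν x p y).1.cell = (Function.update ν' x p' y).1.cell ∧
        (Function.update ν x p y).1.idx = (Function.update ν' x p' y).1.idx := by
    intro D μ μ' ν ν' x i i' p p' h hp y hy
    by_cases hyx : y = x
    · subst hyx; simpa using hp
    · simpa only [Function.update_of_ne hyx] using h y (Finset.mem_of_mem_insert_of_ne hy hyx)
  intro q
  induction q with
  | nil => exact agree []
  | cons m q ih =>
    intro D μ μ' ν ν' h hν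
    refine ⟨agree _ D μ μ' ν ν' h hν, fun hm x hx p => ?_, fun hm x hx p' => ?_⟩
    -- The block of the chosen position is played in the weak game. The answer carries the same
    -- letter, so the same cell and index exist in the block of the answer.
    · obtain ⟨i', hi⟩ := h.2.1 hm x hx ⟨p.1.block, p.block_lt⟩
      have hlet := hletter _ _ _ _ hi x (Finset.mem_insert_self _ _)
      simp only [Function.update_self] at hlet
      refine ⟨.mk i'.2 p.1.cell p.1.idx ?_, ih _ _ _ _ _ hi
        (hupd D μ μ' ν ν' x _ _ _ _ hν ⟨rfl, rfl, rfl, rfl⟩)⟩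
      have := p.idx_lt
      rwa [show (letters w)[p.1.block]'p.block_lt = (letters w')[i'.1] from hlet] at this
    · obtain ⟨i, hi⟩ := h.2.2 hm x hx ⟨p'.1.block, p'.block_lt⟩
      have hlet := hletter _ _ _ _ hi x (Finset.mem_insert_self _ _)
      simp only [Function.update_self] at hlet
      refine ⟨.mk i.2 p'.1.cell p'.1.idx ?_, ih _ _ _ _ _ hi
        (hupd D μ μ' ν ν' x _ _ _ _ hν ⟨rfl, rfl, rfl, rfl⟩)⟩
      have := p'.idx_lt
      rwa [show (letters w')[p'.1.block]' p'.block_lt = (letters w)[i.1] from hlet.symm] at this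

/-- Membership of `w'` in `𝕃` has two parts. Well-formedness passes from `w` by the tests `T₁`. The
value is handled by composing three strategies, through the idealized expansions, between truncated
expansions `x` and `x'` of `w` and `w'`, with `α x = β w` and `α x' = β w'`. -/
theorem associatedLanguage_of_strongDefinable [Finite A] [Finite S] {F : Fragment}
    (hF : F.WeakDefinable (wellFormedWords S)) (α : FreeSemigroup A →ₙ* S)
    (hα : Function.Surjective α) {L : Set (FreeSemigroup A)} (hL : Recognizes α L)
    (h : F.StrongDefinable L) : F.WeakDefinable (associatedLanguage α L) := by
  obtain ⟨T, hT, hT', hs⟩ := Fragment.strongDefinable_iff.1 h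
  obtain ⟨T₁, hT₁, hT₁', hs₁⟩ := Fragment.weakDefinable_iff.1 hF
  refine Fragment.weakDefinable_iff.2 ⟨T ∪ T₁, hT.union hT₁, fun t ht => ht.elim (hT' t) (hT₁' t),
    fun {w w'} hw => ?_⟩
  rintro ⟨hwf, hβ⟩
  have hwf' := hs₁ (fun t ht => hw t (.inr ht)) hwf
  refine ⟨hwf', ?_⟩
  choose v hv using hα
  have hu : ∀ s : S, listValue α (letters (v s)) = s := fun s =>
    (coe_map_eq_prod α (v s)).symm.trans (congrArg _ (hv s))
  have hne : ∀ s : S, letters (v s) ≠ [] := fun s => by simp [letters]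
  -- A common bound on the lengths of the finitely many tests; `2 ^ r` copies of each idempotent
  -- word then suffice.
  obtain ⟨r, hr⟩ : ∃ r, ∀ t ∈ T, t.2.length < r := by
    obtain ⟨r, hr⟩ := (hT.image fun t => t.2.length).bddAbove
    exact ⟨r + 1, fun t ht => Nat.lt_succ_of_le (hr ⟨t, ht, rfl⟩)⟩
  obtain ⟨x, g, hx, h1, h2, h3, h4⟩ := exists_truncation (u := fun s => letters (v s)) α hu
    (pow_ne_zero r two_ne_zero) w
  obtain ⟨x', g', hx', h1', h2', h3', h4'⟩ := exists_truncation (u := fun s => letters (v s)) α hu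
    (pow_ne_zero r two_ne_zero) w'
  have hlw := linked_of_mem hwf
  have hlw' := linked_of_mem hwf'
  rw [← hx] at hβ
  obtain ⟨P, rfl⟩ := hL
  obtain ⟨y, hy, hyx⟩ := hβ
  rw [← hx']
  refine ⟨x', hs (w := x) (fun t ht => ?_) (by rw [Set.mem_preimage, ← hyx]; exact hy), rfl⟩
  have a1 := (sim_expansion hlw hne le_rfl g h1 h2 h3 h4 F.StrongAtom t.1 (hr t ht)
    (Fragment.origin x) fun _ => g (Fragment.origin x 0)).1
  have a2 := (sim_expansion hlw' hne le_rfl g' h1' h2' h3' h4' F.StrongAtom t.1 (hr t ht)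
    (Fragment.origin x') fun _ => g' (Fragment.origin x' 0)).2
  have a3 := sim_expansion_of_sim (u := fun s => letters (v s)) hlw hlw' hne t.2 ∅ _ _
    (fun _ => g (Fragment.origin x 0)) (fun _ => g' (Fragment.origin x' 0)) (hw t (.inl ht))
    (by simp)
  exact a1.trans (a3.trans a2)

end Expansion

end WordLogic

/-! ### The theorem -/

theorem mainTheorem4 :
    (∀ F : WordLogic.Fragment,
      (∀ (T : Type v) [Semigroup T] [Finite T],
        F.WeakDefinable (WordLogic.wellFormedWords T)) →
      ∀ (A : Type u) [Finite A] (S : Type v) [Semigroup S] [Finite S]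
        (α : FreeSemigroup A →ₙ* S), Function.Surjective α →
        ∀ L : Set (FreeSemigroup A), WordLogic.Recognizes α L →
          (F.StrongDefinable L ↔ F.WeakDefinable (WordLogic.associatedLanguage α L))) ∧
    (∀ F : WordLogic.Fragment, F.AbovePiTwo →
      ∀ (T : Type v) [Semigroup T] [Finite T],
        F.WeakDefinable (WordLogic.wellFormedWords T)) :=
  ⟨fun _ hF _ _ S _ _ α hα _ hL =>
    ⟨WordLogic.associatedLanguage_of_strongDefinable (hF S) α hα hL,
      WordLogic.strongDefinable_of_associatedLanguage α hL⟩,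
    fun _ hF T _ _ => WordLogic.weakDefinable_wellFormedWords hF T⟩
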